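/- Let $T,\ell,\rho,\nu,\mathbf c,\kappa>0$ and $\mathbf e\in\mathbb R$, and let $X=\{\phi\in W^{1,2}(0,\ell):\phi(0)=0\}$. **Preisach operator.** Let $g:(0,\infty)\times\mathbb R\to\mathbb R$ be measurable, Lipschitz continuous in the second variable, with $g(r,0)=0$ for a.e. $r>0$. Assume that there are $\mu,\mu_1\in L^1(0,\infty)$ with $$0\le \tfrac{\partial g}{\partial v}(r,v)\le\mu(r),\qquad |v|\,\tfrac{\partial g}{\partial v}(r,v)\le\mu_1(r)\qquad\text{for a.e. }(r,v)\in(0,\infty)\times\mathbb R,$$ that $0<\int_0^\infty\int_{-\infty}^\infty\frac{\partial g}{\partial v}(r,v)\,dv\,dr<\infty$, and that $v\,\frac{\partial g}{\partial v}(r,v)$ belongs to $L^1((0,\infty)\times\mathbb R)$. For $q\in W^{1,1}(0,T)$ and $r>0$ let $\xi_r\in W^{1,1}(0,T)$ be the unique solution of $$|q(t)-\xi_r(t)|\le r\ \ \forall t\in[0,T],\qquad \dot\xi_r(t)\,(q(t)-\xi_r(t)-rz)\ge0\ \text{ for a.e. }t\text{ and all }|z|\le1,\qquad \xi_r(0)=\max\{q(0)-r,\min\{0,q(0)+r\}\},$$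 and extend $q\mapsto\xi_r$ continuously to $C[0,T]$. For $q\in C[0,T]$ put $$\mathcal P[q](t)=\int_0^\infty g(r,\xi_r(t))\,dr,\qquad \mathcal U[q](t)=\int_0^\infty G(r,\xi_r(t))\,dr,\qquad G(r,v)=\int_0^v v'\,\tfrac{\partial g}{\partial v}(r,v')\,dv'.$$ **Operator $\mathcal W$.** Let $f:\mathbb R\to(0,\infty)$ be differentiable with bounded and Lipschitz continuous derivative $f'$, and let $\varepsilon\mapsto 1/f(\varepsilon)$ and $\varepsilon\mapsto\varepsilon/f(\varepsilon)$ be Lipschitz continuous. Let $r\in C[0,T]$. For $\varepsilon\in C[0,T]$ let $q\in C[0,T]$ be the unique solution of $$q(t)+\frac{1}{\kappa f(\varepsilon(t))}\mathcal P[q](t)=\frac{1}{\kappa f(\varepsilon(t))}\,(r(t)-\mathbf e\,\varepsilon(t))\qquad\forall t\in[0,T]$$ (with $q=E/f(\varepsilon)$ this is $\mathbf e\varepsilon+\kappa E+\mathcal P[E/f(\varepsilon)]=r$), and put $$\mathcal W[\varepsilon]=-\frac{\mathbf e}{\kappa}\,(r-\mathbf e\,\varepsilon-\mathcal P[q])+f'(\varepsilon)\,\mathcal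 U[q].$$ **Theorem.** Let $s\in L^2(0,T)$, $u^0\in X$ and $u^1\in L^2(0,\ell)$. Then there is exactly one $u\in C([0,T];X)$ with $u_{xt}\in L^2((0,\ell)\times(0,T))$, $u_t\in C([0,T];L^2(0,\ell))$ and $u_{tt}\in L^2(0,T;X')$ such that $u(\cdot,0)=u^0$, $u_t(\cdot,0)=u^1$ and, for a.e. $t\in(0,T)$ and all $\phi\in X$, $$\rho\,\langle u_{tt}(t),\phi\rangle_{X',X}+\int_0^\ell\bigl(\mathbf c\,u_x+\nu\,u_{xt}+\mathcal W[u_x]\bigr)(x,t)\,\phi_x(x)\,dx=s(t)\,\phi(\ell).$$ Here $\mathcal W$ acts, for a.e. $x\in(0,\ell)$, on the function $u_x(x,\cdot)\in C[0,T]$. This is the variational form of $\rho u_{tt}-\nu u_{xxt}-\mathbf c u_{xx}=\mathcal W[u_x]_x$ with $u(0,t)=0$ and $(\nu u_{xt}+\mathbf c u_x+\mathcal W[u_x])(\ell,t)=s(t)$. -/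

import Mathlib

open MeasureTheory Set Filter Topology

noncomputable section

namespace PiezoBeam

/-! ### The play operator and the Preisach operator on `C[0,T]` -/

/-- `ξ ∈ W^{1,1}(0,T)` is the response of the play with threshold `r` to the input
`q ∈ W^{1,1}(0,T)`: it solves the variational inequality that defines the play.
Elements of `W^{1,1}(0,T)` are identified with absolutely continuous functions on `[0,T]`. -/
structure IsPlayAC (T r : ℝ) (q ξ : ℝ → ℝ) : Prop where
  input_ac : AbsolutelyContinuousOnInterval q 0 T
  output_ac : AbsolutelyContinuousOnInterval ξ 0 T
  constraint : ∀ t ∈ Icc 0 T, |q t - ξ t| ≤ r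
  inequality : ∀ᵐ t ∂(volume.restrict (Ioo 0 T)), ∀ z : ℝ, |z| ≤ 1 →
    0 ≤ deriv ξ t * (q t - ξ t - r * z)
  initial : ξ 0 = max (q 0 - r) (min 0 (q 0 + r))

/-- The continuous extension of the play from `W^{1,1}(0,T)` to `C[0,T]`: the input `q ∈ C[0,T]`
is a uniform limit of `W^{1,1}` inputs, and `ξ` is the uniform limit of their responses. -/
def IsPlay (T r : ℝ) (q ξ : ℝ → ℝ) : Prop :=
  ∃ qn ξn : ℕ → ℝ → ℝ, (∀ n, IsPlayAC T r (qn n) (ξn n)) ∧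
    TendstoUniformlyOn qn q atTop (Icc 0 T) ∧ TendstoUniformlyOn ξn ξ atTop (Icc 0 T)

/-- The play operator: `play T r q t` is `ξ_r(t)` for `t ∈ [0,T]`
(the values outside `[0,T]` have no meaning and are never used). -/
def play (T r : ℝ) (q : ℝ → ℝ) : ℝ → ℝ := Classical.epsilon (IsPlay T r q)

/-- The Preisach operator `P[q](t) = ∫₀^∞ g(r, ξ_r(t)) dr`. -/
def preisach (T : ℝ) (g : ℝ → ℝ → ℝ) (q : ℝ → ℝ) (t : ℝ) : ℝ :=
  ∫ r in Ioi (0 : ℝ), g r (play T r q t)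

/-- `G(r,v) = ∫₀^v v' ∂g/∂v(r,v') dv'`. -/
def potentialDensity (g : ℝ → ℝ → ℝ) (r v : ℝ) : ℝ :=
  ∫ v' in (0 : ℝ)..v, v' * deriv (g r) v'

/-- The Preisach potential `U[q](t) = ∫₀^∞ G(r, ξ_r(t)) dr`. -/
def potential (T : ℝ) (g : ℝ → ℝ → ℝ) (q : ℝ → ℝ) (t : ℝ) : ℝ :=
  ∫ r in Ioi (0 : ℝ), potentialDensity g r (play T r q t)

/-- Assumptions on the function `g : (0,∞) × ℝ → ℝ` that generates the Preisach operator
(its values for `r ≤ 0` play no role). -/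
structure PreisachHypothesis (g : ℝ → ℝ → ℝ) : Prop where
  measurable : Measurable (Function.uncurry g)
  lipschitz : ∀ r : ℝ, 0 < r → ∃ K : NNReal, LipschitzWith K (g r)
  zero : ∀ᵐ r ∂(volume.restrict (Ioi (0 : ℝ))), g r 0 = 0
  deriv_le : ∃ μ : ℝ → ℝ, IntegrableOn μ (Ioi 0) ∧
    ∀ᵐ p ∂((volume : Measure (ℝ × ℝ)).restrict (Ioi 0 ×ˢ univ)),
      0 ≤ deriv (g p.1) p.2 ∧ deriv (g p.1) p.2 ≤ μ p.1
  deriv_integrable : IntegrableOn (fun p : ℝ × ℝ => deriv (g p.1) p.2) (Ioi 0 ×ˢ univ)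
  deriv_integral_pos : 0 < ∫ p in Ioi (0 : ℝ) ×ˢ (univ : Set ℝ), deriv (g p.1) p.2
  mul_deriv_integrable :
    IntegrableOn (fun p : ℝ × ℝ => p.2 * deriv (g p.1) p.2) (Ioi 0 ×ˢ univ)
  mul_deriv_le : ∃ μ₁ : ℝ → ℝ, IntegrableOn μ₁ (Ioi 0) ∧
    ∀ᵐ p ∂((volume : Measure (ℝ × ℝ)).restrict (Ioi 0 ×ˢ univ)),
      |p.2| * deriv (g p.1) p.2 ≤ μ₁ p.1

/-- Assumptions on the constitutive function `f`: it is positive and differentiable, its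
derivative is bounded and Lipschitz continuous, and `1 / f` and `ε ↦ ε / f ε` are
Lipschitz continuous. -/
structure ConstitutiveHypothesis (f : ℝ → ℝ) : Prop where
  pos : ∀ ε, 0 < f ε
  differentiable : Differentiable ℝ f
  deriv_bounded : ∃ C : ℝ, ∀ ε, |deriv f ε| ≤ C
  deriv_lipschitz : ∃ K : NNReal, LipschitzWith K (deriv f)
  inv_lipschitz : ∃ K : NNReal, LipschitzWith K (fun ε => 1 / f ε)
  div_lipschitz : ∃ K : NNReal, LipschitzWith K (fun ε => ε / f ε)

/-! ### Elimination of the electric field -/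

/-- `q ∈ C[0,T]` solves `q + (κ f(ε))⁻¹ P[q] = (κ f(ε))⁻¹ (r - e ε)` on `[0,T]`. With
`q = E / f(ε)` this is the dielectric law `e ε + κ E + P[E / f(ε)] = r`. -/
def IsInverseState (T : ℝ) (g : ℝ → ℝ → ℝ) (f : ℝ → ℝ) (κ e : ℝ) (r ε q : ℝ → ℝ) : Prop :=
  ContinuousOn q (Icc 0 T) ∧
    ∀ t ∈ Icc 0 T,
      q t + 1 / (κ * f (ε t)) * preisach T g q t = 1 / (κ * f (ε t)) * (r t - e * ε t)

/-- The inverse Preisach operator `ε ↦ q`. -/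
def inverseState (T : ℝ) (g : ℝ → ℝ → ℝ) (f : ℝ → ℝ) (κ e : ℝ) (r ε : ℝ → ℝ) : ℝ → ℝ :=
  Classical.epsilon (IsInverseState T g f κ e r ε)

/-- The hysteresis operator `W[ε] = -(e/κ) (r - e ε - P[q]) + f'(ε) U[q]`, where `q` is obtained
from `ε` by the inverse Preisach operator. -/
def W (T : ℝ) (g : ℝ → ℝ → ℝ) (f : ℝ → ℝ) (κ e : ℝ) (r ε : ℝ → ℝ) (t : ℝ) : ℝ :=
  -(e / κ) * (r t - e * ε t - preisach T g (inverseState T g f κ e r ε) t)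
    + deriv f (ε t) * potential T g (inverseState T g f κ e r ε) t

/-! ### Function spaces on `(0,ℓ)` -/

/-- `L²(0,ℓ)`. -/
abbrev H (ℓ : ℝ) : Type := Lp ℝ 2 (volume.restrict (Ioo (0 : ℝ) ℓ))

theorem integrableOn_H {ℓ x : ℝ} (hx : x ≤ ℓ) (ψ : H ℓ) : IntegrableOn (ψ : ℝ → ℝ) (Ioc 0 x) := by
  have h : Integrable (ψ : ℝ → ℝ) (volume.restrict (Ioo (0 : ℝ) ℓ)) :=
    (Lp.memLp ψ).integrable (by norm_num)
  have h2 : IntegrableOn (ψ : ℝ → ℝ) (Ioc 0 ℓ) := by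
    rw [integrableOn_Ioc_iff_integrableOn_Ioo]; exact h
  exact h2.mono_set (Ioc_subset_Ioc_right hx)

theorem ae_H {ℓ x : ℝ} (hx : x ≤ ℓ) {p : ℝ → Prop}
    (h : ∀ᵐ y ∂(volume.restrict (Ioo (0 : ℝ) ℓ)), p y) :
    ∀ᵐ y ∂(volume.restrict (Ioc (0 : ℝ) x)), p y := by
  have h2 : ∀ᵐ y ∂(volume.restrict (Ioc (0 : ℝ) ℓ)), p y := by
    rwa [← restrict_Ioo_eq_restrict_Ioc]
  exact ae_mono (Measure.restrict_mono (Ioc_subset_Ioc_right hx) le_rfl) h2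

/-- `X = {φ ∈ W^{1,2}(0,ℓ) : φ(0) = 0}` with the norm of `W^{1,2}(0,ℓ)`. An element is the pair
`(φ, φ_x)` in `L²(0,ℓ) × L²(0,ℓ)`; that `φ_x` is the weak derivative of `φ` and that
the continuous representative of `φ` vanishes at `0` is expressed
by `φ(x) = ∫₀ˣ φ_x(y) dy` for almost every `x ∈ (0,ℓ)`. -/
def X (ℓ : ℝ) : Submodule ℝ (WithLp 2 (H ℓ × H ℓ)) where
  carrier := {p | ∀ᵐ x ∂(volume.restrict (Ioo (0 : ℝ) ℓ)),
    (p.fst : ℝ → ℝ) x = ∫ y in Ioc 0 x, (p.snd : ℝ → ℝ) y}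
  zero_mem' := by
    filter_upwards [Lp.coeFn_zero ℝ 2 (volume.restrict (Ioo (0 : ℝ) ℓ)),
      ae_restrict_mem measurableSet_Ioo] with x hx hm
    have h0 := ae_H hm.2.le (Lp.coeFn_zero ℝ 2 (volume.restrict (Ioo (0 : ℝ) ℓ)))
    have h1 : ∫ y in Ioc 0 x, ((0 : H ℓ) : ℝ → ℝ) y = 0 := by
      rw [integral_congr_ae h0]; simp
    change ((0 : H ℓ) : ℝ → ℝ) x = ∫ y in Ioc 0 x, ((0 : H ℓ) : ℝ → ℝ) y
    rw [h1, hx, Pi.zero_apply]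
  add_mem' := by
    intro p q hp hq
    filter_upwards [hp, hq, Lp.coeFn_add p.fst q.fst, ae_restrict_mem measurableSet_Ioo]
      with x h1 h2 h3 hm
    have h0 := ae_H hm.2.le (Lp.coeFn_add p.snd q.snd)
    have h4 : ∫ y in Ioc 0 x, ((p.snd + q.snd : H ℓ) : ℝ → ℝ) y
        = (∫ y in Ioc 0 x, (p.snd : ℝ → ℝ) y) + ∫ y in Ioc 0 x, (q.snd : ℝ → ℝ) y := by
      rw [integral_congr_ae h0]
      exact integral_add (integrableOn_H hm.2.le p.snd) (integrableOn_H hm.2.le q.snd)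
    change ((p.fst + q.fst : H ℓ) : ℝ → ℝ) x = ∫ y in Ioc 0 x, ((p.snd + q.snd : H ℓ) : ℝ → ℝ) y
    rw [h3, h4, Pi.add_apply, h1, h2]
  smul_mem' := by
    intro a p hp
    filter_upwards [hp, Lp.coeFn_smul a p.fst, ae_restrict_mem measurableSet_Ioo] with x h1 h3 hm
    have h0 := ae_H hm.2.le (Lp.coeFn_smul a p.snd)
    have h4 : ∫ y in Ioc 0 x, ((a • p.snd : H ℓ) : ℝ → ℝ) y
        = a * ∫ y in Ioc 0 x, (p.snd : ℝ → ℝ) y := by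
      rw [integral_congr_ae h0]
      exact integral_const_mul a _
    change ((a • p.fst : H ℓ) : ℝ → ℝ) x = ∫ y in Ioc 0 x, ((a • p.snd : H ℓ) : ℝ → ℝ) y
    rw [h3, h4, Pi.smul_apply, h1, smul_eq_mul]

/-- The inclusion `X → L²(0,ℓ)`. -/
def toL2 (ℓ : ℝ) : X ℓ →L[ℝ] H ℓ := (WithLp.fstL 2 ℝ (H ℓ) (H ℓ)).comp (X ℓ).subtypeL

/-- The derivative `X → L²(0,ℓ)`, `φ ↦ φ_x`. -/
def ddx (ℓ : ℝ) : X ℓ →L[ℝ] H ℓ := (WithLp.sndL 2 ℝ (H ℓ) (H ℓ)).comp (X ℓ).subtypeL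

/-- The boundary value `φ(ℓ)` of the continuous representative `x ↦ ∫₀ˣ φ_x(y) dy`. -/
def endValue {ℓ : ℝ} (φ : X ℓ) : ℝ := ∫ y in Ioc 0 ℓ, (ddx ℓ φ : ℝ → ℝ) y

/-- The embedding `L²(0,ℓ) → X'`, `v ↦ (φ ↦ ∫₀^ℓ v φ dx)`. -/
def toDual (ℓ : ℝ) (v : H ℓ) : StrongDual ℝ (X ℓ) := (innerSL ℝ v).comp (toL2 ℓ)

/-! ### Weak solutions -/

/-- `u : [0,T] → X` is a weak solution of
`ρ u_tt - ν u_xxt - c u_xx = W[u_x]_x`, `u(0,t) = 0`, `(ν u_xt + c u_x + W[u_x])(ℓ,t) = s(t)`,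
`u(·,0) = u⁰`, `u_t(·,0) = u¹`, with the regularity `u ∈ C([0,T];X)`, `u_xt ∈ L²((0,ℓ)×(0,T))`,
`u_t ∈ C([0,T];L²(0,ℓ))`, `u_tt ∈ L²(0,T;X')`. Here `v = u_t`, `w = u_xt` (where
`L²((0,ℓ)×(0,T))` is regarded as `L²(0,T;L²(0,ℓ))`), `z = u_tt`, and `ε` is the representative
of `u_x` for which `ε(x,·) ∈ C[0,T]` for almost every `x`, so that `W` acts on it. -/
def IsWeakSolution (T ℓ ρ ν c κ e : ℝ) (g : ℝ → ℝ → ℝ) (f r s : ℝ → ℝ)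
    (u₀ : X ℓ) (u₁ : H ℓ) (u : ℝ → X ℓ) : Prop :=
  ContinuousOn u (Icc 0 T) ∧
  ∃ (v w : ℝ → H ℓ) (z : ℝ → StrongDual ℝ (X ℓ)) (ε : ℝ → ℝ → ℝ),
    -- the time derivatives
    ContinuousOn v (Icc 0 T) ∧
    (∀ t ∈ Icc 0 T, HasDerivWithinAt (fun τ => toL2 ℓ (u τ)) (v t) (Icc 0 T) t) ∧
    MemLp w 2 (volume.restrict (Ioo 0 T)) ∧
    (∀ t ∈ Icc 0 T, ddx ℓ (u t) = ddx ℓ (u 0) + ∫ τ in (0 : ℝ)..t, w τ) ∧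
    MemLp z 2 (volume.restrict (Ioo 0 T)) ∧
    (∀ t ∈ Icc 0 T, toDual ℓ (v t) = toDual ℓ (v 0) + ∫ τ in (0 : ℝ)..t, z τ) ∧
    -- the strain
    (∀ᵐ x ∂(volume.restrict (Ioo 0 ℓ)), ContinuousOn (ε x) (Icc 0 T)) ∧
    (∀ t ∈ Icc 0 T, (fun x => ε x t) =ᵐ[volume.restrict (Ioo 0 ℓ)] (ddx ℓ (u t) : ℝ → ℝ)) ∧
    -- the initial conditions
    u 0 = u₀ ∧ v 0 = u₁ ∧
    -- the variational equation
    (∀ᵐ t ∂(volume.restrict (Ioo 0 T)),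
      MemLp (fun x => W T g f κ e r (ε x) t) 2 (volume.restrict (Ioo 0 ℓ)) ∧
      ∀ φ : X ℓ,
        ρ * z t φ + ∫ x in Ioo 0 ℓ,
            (c * ε x t + ν * (w t : ℝ → ℝ) x + W T g f κ e r (ε x) t) * (ddx ℓ φ : ℝ → ℝ) x
          = s t * endValue φ)

end PiezoBeam

end

/-!
The argument reduces the beam equation to a fixed point problem of Volterra type for the strain rate
`w = u_xt ∈ L²(0,T;L²(0,ℓ))`.

*The hysteresis operator.* The point is that `W` is causal and Lipschitz continuous in the maximum
norm on every interval `[0,t]` (`exists_lipschitz_W`). The play is nonexpansive in the input and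
`1`-Lipschitz in the threshold, so `P` and `U` are bounded and Lipschitz continuous. The operator
`ε ↦ q` solves `q + a P[q] = h` with a coefficient `a = 1 / (κ f(ε))` that depends on time, hence
monotonicity of `P` alone does not bound its inverse. The resolvent estimate
`abs_sub_le_of_resolvent` does: if `ξ₁ - ξ₂` increases at threshold `ρ`, then one of the two plays
is pushed by its input, and then the differences at all smaller thresholds, and the difference of the
inputs, are at least as large (`IsPlayAC.ae_rise_nested`). Where such a difference is positive, the
thresholds below `ρ` therefore contribute with a favourable sign and only the tail `∫_ρ^∞` has to be
estimated, which yields a Gronwall argument in the threshold with the bound `η exp (A ∫ μ)`.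
Existence of `q` follows by the continuity method (`surjective_id_add_of_expanding`).

*The linear part.* With `J` the primitive on `L²(0,ℓ)`, so that `J w = u_t`, the momentum balance
reads `ρ (J* v)' + ν w = F`, `v = J w`. The functions `w = w₀ + ∫₀ᵗ w₁` solve it with data that are
dense in `L²(0,T;L²) × L²`, and the energy estimate obtained by testing with `w` passes to the limit
(`exists_isLinearSolution`); the estimate holds on each `[0,t]`.

*The coupling.* Since `W` acts on the function `u_x(x,·)` for almost every `x`, the primitive of `w`
in time is constructed as an element of `L²((0,ℓ);C[0,T])`, with the norm of its maximum over `[0,t]`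
controlled by `∫₀ᵗ ‖w‖` (`exists_isPrimitive`). The map that sends `w` to the strain, to the stress
`c ε + W[ε]`, and then to the solution of the linear equation satisfies
`∫₀ᵗ ‖Θw₁ - Θw₂‖² ≤ C ∫₀ᵗ ∫₀^τ ‖w₁ - w₂‖² dτ`. Some iterate of it is a contraction
(`existsUnique_fixedPoint_of_energy_le`), and its fixed points are exactly the strain rates of weak
solutions (`isWeakSolution_of_isLinearSolution`, `IsWeakSolution.exists_strainRate`).
-/

noncomputable section

namespace PiezoBeam

/-! ### The play with absolutely continuous inputs -/

/-- An absolutely continuous function cannot exceed a level `M` if it starts below `M` and does not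
increase while it is above `M`. -/
theorem ac_le_of_deriv_nonpos {w : ℝ → ℝ} {T t M : ℝ} (hw : AbsolutelyContinuousOnInterval w 0 T)
    (ht : t ∈ Icc 0 T) (h0 : w 0 ≤ M)
    (h : ∀ᵐ τ ∂(volume.restrict (Ioo 0 T)), τ < t → M < w τ → deriv w τ ≤ 0) : w t ≤ M := by
  by_contra! hMt
  have hT : (0 : ℝ) ≤ T := ht.1.trans ht.2
  have hcont : ContinuousOn w (Icc 0 t) :=
    (hw.continuousOn).mono (by rw [uIcc_of_le hT]; exact Icc_subset_Icc_right ht.2)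
  -- after its last visit below the level `M`, the function would have to increase
  set S : Set ℝ := {τ ∈ Icc 0 t | w τ ≤ M}
  have hSc : IsCompact S := by
    have : IsClosed S := hcont.preimage_isClosed_of_isClosed isClosed_Icc (isClosed_Iic (a := M))
    exact isCompact_Icc.of_isClosed_subset this (fun x hx => hx.1)
  have hSn : S.Nonempty := ⟨0, ⟨le_rfl, ht.1⟩, h0⟩
  have ht0 : sSup S ∈ S := hSc.sSup_mem hSn
  set t₀ := sSup S
  have hlt : t₀ < t := lt_of_le_of_ne ht0.1.2 (fun he => by
    have := ht0.2; rw [he] at this; linarith)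
  have hac : AbsolutelyContinuousOnInterval w t₀ t := hw.mono (by
    rw [uIcc_of_le hT, uIcc_of_le hlt.le]; exact Icc_subset_Icc ht0.1.1 ht.2)
  have hint := hac.integral_deriv_eq_sub
  have hle : ∫ x in t₀..t, deriv w x ≤ 0 := by
    rw [intervalIntegral.integral_of_le hlt.le, ← integral_Ioc_eq_integral_Ioo.symm]
    apply integral_nonpos_of_ae
    rw [EventuallyLE, ae_restrict_iff' measurableSet_Ioo]
    rw [ae_restrict_iff' measurableSet_Ioo] at h
    filter_upwards [h] with τ hτ hm
    refine hτ ⟨ht0.1.1.trans_lt hm.1, hm.2.trans_le ht.2⟩ hm.2 ?_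
    by_contra! hle
    have : τ ∈ S := ⟨⟨ht0.1.1.trans hm.1.le, hm.2.le⟩, hle⟩
    exact absurd (le_csSup hSc.bddAbove this) (not_le.mpr hm.1)
  have := ht0.2
  linarith

/-- The distance of two outputs of plays can increase only at times when the upper output is pushed
up by its input or the lower one is pushed down by its input. -/
theorem IsPlayAC.ae_rise {T r₁ r₂ : ℝ} {q₁ q₂ ξ₁ ξ₂ : ℝ → ℝ} (hT : 0 ≤ T)
    (h₁ : IsPlayAC T r₁ q₁ ξ₁)
    (h₂ : IsPlayAC T r₂ q₂ ξ₂) : ∀ᵐ τ ∂(volume.restrict (Ioo 0 T)),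
      0 < deriv (fun s => ξ₁ s - ξ₂ s) τ → ξ₁ τ = q₁ τ - r₁ ∨ ξ₂ τ = q₂ τ + r₂ := by
  filter_upwards [h₁.inequality, h₂.inequality, ae_restrict_of_ae h₁.output_ac.ae_differentiableAt,
    ae_restrict_of_ae h₂.output_ac.ae_differentiableAt, ae_restrict_mem measurableSet_Ioo]
    with τ i₁ i₂ d₁ d₂ hm hpos
  have hI : τ ∈ Icc 0 T := Ioo_subset_Icc_self hm
  rw [uIcc_of_le hT] at d₁ d₂
  rw [deriv_fun_sub (d₁ hI) (d₂ hI)] at hpos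
  have c₁ := abs_le.mp (h₁.constraint τ hI)
  have c₂ := abs_le.mp (h₂.constraint τ hI)
  rcases lt_or_ge 0 (deriv ξ₁ τ) with hp | hp
  · left
    have := nonneg_of_mul_nonneg_right (i₁ 1 (by simp)) hp
    linarith
  · right
    have hn : deriv ξ₂ τ < 0 := by linarith
    have := nonpos_of_mul_nonneg_right (i₂ (-1) (by simp)) hn
    linarith

theorem abs_playInit_sub_le (r a b : ℝ) :
    |max (a - r) (min 0 (a + r)) - max (b - r) (min 0 (b + r))| ≤ |a - b| := by
  rcases abs_cases (a - b) with h | h <;>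
  · rw [abs_le]; constructor <;> grind

theorem abs_playInit_sub_le' {r ρ : ℝ} (h : r ≤ ρ) (a : ℝ) :
    |max (a - r) (min 0 (a + r)) - max (a - ρ) (min 0 (a + ρ))| ≤ ρ - r := by
  rw [abs_le]; constructor <;> grind

theorem IsPlayAC.sub_le {T r t M : ℝ} {q₁ q₂ ξ₁ ξ₂ : ℝ → ℝ} (ht : t ∈ Icc 0 T)
    (h₁ : IsPlayAC T r q₁ ξ₁) (h₂ : IsPlayAC T r q₂ ξ₂)
    (hM : ∀ τ ∈ Icc 0 t, |q₁ τ - q₂ τ| ≤ M) : ξ₁ t - ξ₂ t ≤ M := by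
  have hT : (0 : ℝ) ≤ T := ht.1.trans ht.2
  refine ac_le_of_deriv_nonpos (w := fun s => ξ₁ s - ξ₂ s) (h₁.output_ac.sub h₂.output_ac) ht ?_ ?_
  · have := abs_playInit_sub_le r (q₁ 0) (q₂ 0)
    rw [← h₁.initial, ← h₂.initial] at this
    exact (le_abs_self _).trans (this.trans (hM 0 ⟨le_rfl, ht.1⟩))
  · filter_upwards [h₁.ae_rise hT h₂, ae_restrict_mem measurableSet_Ioo] with τ hr hm hτ hlt
    by_contra! hpos
    have hI : τ ∈ Icc 0 T := Ioo_subset_Icc_self hm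
    have c₁ := abs_le.mp (h₁.constraint τ hI)
    have c₂ := abs_le.mp (h₂.constraint τ hI)
    have := (abs_le.mp (hM τ ⟨hm.1.le, hτ.le⟩)).2
    rcases hr hpos with h | h <;> linarith

/-- The play is nonexpansive in the maximum norm. -/
theorem IsPlayAC.abs_sub_le {T r t M : ℝ} {q₁ q₂ ξ₁ ξ₂ : ℝ → ℝ} (ht : t ∈ Icc 0 T)
    (h₁ : IsPlayAC T r q₁ ξ₁) (h₂ : IsPlayAC T r q₂ ξ₂)
    (hM : ∀ τ ∈ Icc 0 t, |q₁ τ - q₂ τ| ≤ M) : |ξ₁ t - ξ₂ t| ≤ M := by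
  have := h₁.sub_le ht h₂ hM
  have := h₂.sub_le ht h₁ (fun τ hτ => by rw [abs_sub_comm]; exact hM τ hτ)
  rw [abs_le]; constructor <;> linarith

/-- The output of the play is `1`-Lipschitz in the threshold. -/
theorem IsPlayAC.abs_sub_le_threshold {T r ρ t : ℝ} {q ξ η : ℝ → ℝ} (ht : t ∈ Icc 0 T)
    (hrρ : r ≤ ρ) (h₁ : IsPlayAC T r q ξ) (h₂ : IsPlayAC T ρ q η) : |ξ t - η t| ≤ ρ - r := by
  have hT : (0 : ℝ) ≤ T := ht.1.trans ht.2
  have h0 := abs_le.mp (abs_playInit_sub_le' hrρ (q 0))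
  rw [← h₁.initial, ← h₂.initial] at h0
  have k₁ : ξ t - η t ≤ ρ - r := by
    refine ac_le_of_deriv_nonpos (w := fun s => ξ s - η s) (h₁.output_ac.sub h₂.output_ac) ht
      h0.2 ?_
    filter_upwards [h₁.ae_rise hT h₂, ae_restrict_mem measurableSet_Ioo] with τ hr hm hτ hlt
    by_contra! hpos
    have hI : τ ∈ Icc 0 T := Ioo_subset_Icc_self hm
    have c₁ := abs_le.mp (h₁.constraint τ hI)
    have c₂ := abs_le.mp (h₂.constraint τ hI)
    rcases hr hpos with h | h <;> linarith
  have k₂ : η t - ξ t ≤ ρ - r := by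
    refine ac_le_of_deriv_nonpos (w := fun s => η s - ξ s) (h₂.output_ac.sub h₁.output_ac) ht
      (by linarith) ?_
    filter_upwards [h₂.ae_rise hT h₁, ae_restrict_mem measurableSet_Ioo] with τ hr hm hτ hlt
    by_contra! hpos
    have hI : τ ∈ Icc 0 T := Ioo_subset_Icc_self hm
    have c₁ := abs_le.mp (h₁.constraint τ hI)
    have c₂ := abs_le.mp (h₂.constraint τ hI)
    rcases hr hpos with h | h <;> linarith
  rw [abs_le]; constructor <;> linarith

/-- When the difference `ξ₁ - ξ₂` of the responses to two inputs increases at threshold `ρ`, then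
for all smaller thresholds the difference of the responses lies between that difference and the
difference of the inputs. -/
theorem IsPlayAC.ae_rise_nested {T ρ : ℝ} {q₁ q₂ : ℝ → ℝ} {ξ₁ ξ₂ : ℝ → ℝ → ℝ} (hT : 0 ≤ T)
    (hρ : 0 < ρ) (h₁ : ∀ r, 0 < r → IsPlayAC T r q₁ (ξ₁ r))
    (h₂ : ∀ r, 0 < r → IsPlayAC T r q₂ (ξ₂ r)) : ∀ᵐ τ ∂(volume.restrict (Ioo 0 T)),
      0 < deriv (fun s => ξ₁ ρ s - ξ₂ ρ s) τ → ξ₁ ρ τ - ξ₂ ρ τ ≤ q₁ τ - q₂ τ ∧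
        ∀ r, 0 < r → r ≤ ρ → ξ₁ ρ τ - ξ₂ ρ τ ≤ ξ₁ r τ - ξ₂ r τ := by
  filter_upwards [(h₁ ρ hρ).ae_rise hT (h₂ ρ hρ), ae_restrict_mem measurableSet_Ioo]
    with τ hr hm hpos
  have hI : τ ∈ Icc 0 T := Ioo_subset_Icc_self hm
  have c₁ := abs_le.mp ((h₁ ρ hρ).constraint τ hI)
  have c₂ := abs_le.mp ((h₂ ρ hρ).constraint τ hI)
  refine ⟨by rcases hr hpos with h | h <;> linarith, fun r hr0 hrρ => ?_⟩
  have e₁ := abs_le.mp ((h₁ r hr0).constraint τ hI)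
  have e₂ := abs_le.mp ((h₂ r hr0).constraint τ hI)
  have l₁ := abs_le.mp ((h₁ r hr0).abs_sub_le_threshold hI hrρ (h₁ ρ hρ))
  have l₂ := abs_le.mp ((h₂ r hr0).abs_sub_le_threshold hI hrρ (h₂ ρ hρ))
  rcases hr hpos with h | h <;> linarith

/-! ### Existence of the play for piecewise monotone inputs -/

/-- The function `q` is Lipschitz continuous and piecewise monotone on `[a,b]`. -/
inductive PiecewiseMonotone (q : ℝ → ℝ) : ℝ → ℝ → Prop
  | mono {a b : ℝ} {K : NNReal} (hab : a ≤ b) (hq : LipschitzOnWith K q (Icc a b))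
      (hm : MonotoneOn q (Icc a b)) : PiecewiseMonotone q a b
  | anti {a b : ℝ} {K : NNReal} (hab : a ≤ b) (hq : LipschitzOnWith K q (Icc a b))
      (hm : AntitoneOn q (Icc a b)) : PiecewiseMonotone q a b
  | concat {a b c : ℝ} (h₁ : PiecewiseMonotone q a b) (h₂ : PiecewiseMonotone q b c) :
      PiecewiseMonotone q a c

theorem PiecewiseMonotone.le {q : ℝ → ℝ} {a b : ℝ} (h : PiecewiseMonotone q a b) : a ≤ b := by
  induction h with
  | mono hab => exact hab
  | anti hab => exact hab
  | concat _ _ h₁ h₂ => exact h₁.trans h₂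

/-- `ξ` is a Lipschitz continuous response of the play to `q` on the interval `[a,b]`, without
a condition at `a`. -/
structure IsPlayOn (r : ℝ) (q ξ : ℝ → ℝ) (a b : ℝ) : Prop where
  lipschitz : ∃ K : NNReal, LipschitzOnWith K ξ (Icc a b)
  constraint : ∀ t ∈ Icc a b, |q t - ξ t| ≤ r
  inequality : ∀ᵐ t, t ∈ Ioo a b → ∀ z : ℝ, |z| ≤ 1 → 0 ≤ deriv ξ t * (q t - ξ t - r * z)

theorem lipschitzOnWith_concat {ξ : ℝ → ℝ} {a b c : ℝ} {K₁ K₂ : NNReal} (hab : a ≤ b) (hbc : b ≤ c)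
    (h₁ : LipschitzOnWith K₁ ξ (Icc a b)) (h₂ : LipschitzOnWith K₂ ξ (Icc b c)) :
    LipschitzOnWith (max K₁ K₂) ξ (Icc a c) := by
  have key : ∀ x ∈ Icc a c, ∀ y ∈ Icc a c, x ≤ y →
      dist (ξ x) (ξ y) ≤ (max K₁ K₂ : NNReal) * dist x y := by
    intro x hx y hy hxy
    have hK₁ : (K₁ : ℝ) ≤ (max K₁ K₂ : NNReal) := NNReal.coe_le_coe.mpr (le_max_left _ _)
    have hK₂ : (K₂ : ℝ) ≤ (max K₁ K₂ : NNReal) := NNReal.coe_le_coe.mpr (le_max_right _ _)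
    rcases le_total y b with hyb | hyb
    · refine (h₁.dist_le_mul x ⟨hx.1, hxy.trans hyb⟩ y ⟨hy.1, hyb⟩).trans ?_
      gcongr
    rcases le_total b x with hbx | hbx
    · refine (h₂.dist_le_mul x ⟨hbx, hx.2⟩ y ⟨hyb, hy.2⟩).trans ?_
      gcongr
    have e₁ := h₁.dist_le_mul x ⟨hx.1, hbx⟩ b ⟨hab, le_rfl⟩
    have e₂ := h₂.dist_le_mul b ⟨le_rfl, hbc⟩ y ⟨hyb, hy.2⟩
    have e₃ := dist_triangle (ξ x) (ξ b) (ξ y)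
    have e₄ : dist x y = dist x b + dist b y := by
      simp only [Real.dist_eq]
      rw [abs_of_nonpos (by linarith), abs_of_nonpos (by linarith), abs_of_nonpos (by linarith)]
      ring
    have e₅ : (K₁ : ℝ) * dist x b ≤ (max K₁ K₂ : NNReal) * dist x b := by gcongr
    have e₆ : (K₂ : ℝ) * dist b y ≤ (max K₁ K₂ : NNReal) * dist b y := by gcongr
    rw [e₄, mul_add]; linarith
  refine LipschitzOnWith.of_dist_le_mul fun x hx y hy => ?_
  rcases le_total x y with h | h
  · exact key x hx y hy h
  · rw [dist_comm (ξ x), dist_comm x]; exact key y hy x hx h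

theorem IsPlayOn.concat {r : ℝ} {q ξ₁ ξ₂ : ℝ → ℝ} {a b c : ℝ} (hab : a ≤ b) (hbc : b ≤ c)
    (h₁ : IsPlayOn r q ξ₁ a b) (h₂ : IsPlayOn r q ξ₂ b c) (he : ξ₁ b = ξ₂ b) :
    IsPlayOn r q (fun t => if t ≤ b then ξ₁ t else ξ₂ t) a c := by
  set ξ : ℝ → ℝ := fun t => if t ≤ b then ξ₁ t else ξ₂ t with hξ
  have e₁ : EqOn ξ ξ₁ (Icc a b) := fun t ht => by simp [hξ, ht.2]
  have e₂ : EqOn ξ ξ₂ (Icc b c) := fun t ht => by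
    rcases ht.1.eq_or_lt with rfl | h
    · simp [hξ, he]
    · simp [hξ, not_le.mpr h]
  refine ⟨?_, ?_, ?_⟩
  · obtain ⟨K₁, k₁⟩ := h₁.lipschitz
    obtain ⟨K₂, k₂⟩ := h₂.lipschitz
    exact ⟨_, lipschitzOnWith_concat hab hbc
      (fun x hx y hy => by rw [e₁ hx, e₁ hy]; exact k₁ hx hy)
      (fun x hx y hy => by rw [e₂ hx, e₂ hy]; exact k₂ hx hy)⟩
  · intro t ht
    rcases le_total t b with h | h
    · rw [e₁ ⟨ht.1, h⟩]; exact h₁.constraint t ⟨ht.1, h⟩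
    · rw [e₂ ⟨h, ht.2⟩]; exact h₂.constraint t ⟨h, ht.2⟩
  · have hb : ∀ᵐ t : ℝ, t ≠ b := by simp [ae_iff, measure_singleton]
    filter_upwards [h₁.inequality, h₂.inequality, hb] with t i₁ i₂ htb ht
    rcases lt_or_gt_of_ne htb with h | h
    · have hev : ξ =ᶠ[𝓝 t] ξ₁ := by
        filter_upwards [Icc_mem_nhds ht.1 h] with s hs using e₁ hs
      rw [hev.deriv_eq, hev.eq_of_nhds]
      exact i₁ ⟨ht.1, h⟩
    · have hev : ξ =ᶠ[𝓝 t] ξ₂ := by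
        filter_upwards [Icc_mem_nhds h ht.2] with s hs using e₂ hs
      rw [hev.deriv_eq, hev.eq_of_nhds]
      exact i₂ ⟨h, ht.2⟩

/-- For an increasing input the output is pushed up by the lower boundary of the admissible band:
`ξ = max (q - r) x`. -/
theorem exists_isPlayOn_of_monotoneOn {r a b x : ℝ} {q : ℝ → ℝ} {K : NNReal} (hab : a ≤ b)
    (hq : LipschitzOnWith K q (Icc a b)) (hm : MonotoneOn q (Icc a b)) (hx : |q a - x| ≤ r) :
    ∃ ξ, IsPlayOn r q ξ a b ∧ ξ a = x := by
  have hx' := abs_le.mp hx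
  have hmax : MonotoneOn (fun t => max (q t - r) x) (Icc a b) := fun s hs t ht hst =>
    max_le_max (sub_le_sub_right (hm hs ht hst) r) le_rfl
  refine ⟨fun t => max (q t - r) x, ⟨⟨K, ?_⟩, ?_, ?_⟩, max_eq_right (by linarith)⟩
  · refine LipschitzOnWith.of_dist_le_mul fun s hs t ht => ?_
    refine le_trans ?_ (hq.dist_le_mul s hs t ht)
    rw [Real.dist_eq, Real.dist_eq]
    refine (abs_max_sub_max_le_abs _ _ _).trans (le_of_eq ?_)
    congr 1; ring
  · intro t ht
    have := hm ⟨le_rfl, hab⟩ ht ht.1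
    rw [abs_le]; constructor <;> grind
  · refine Eventually.of_forall fun t ht z hz => ?_
    have hI : Icc a b ∈ 𝓝 t := Icc_mem_nhds ht.1 ht.2
    have hd : 0 ≤ deriv (fun t => max (q t - r) x) t := by
      rw [← derivWithin_of_mem_nhds hI]; exact hmax.derivWithin_nonneg
    rcases lt_or_ge (q t - r) x with h | h
    · have hc : ContinuousAt q t := (hq.continuousOn).continuousAt hI
      have hev : (fun t => max (q t - r) x) =ᶠ[𝓝 t] fun _ => x := by
        filter_upwards [(hc.sub_const r).eventually (gt_mem_nhds h)] with s hs
          using max_eq_right (le_of_lt hs)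
      rw [hev.deriv_eq]; simp
    · refine mul_nonneg hd ?_
      have hr : 0 ≤ r := (abs_nonneg _).trans hx
      have := mul_le_mul_of_nonneg_left (abs_le.mp hz).2 hr
      simp only [max_eq_left h]
      linarith

theorem exists_isPlayOn_of_antitoneOn {r a b x : ℝ} {q : ℝ → ℝ} {K : NNReal} (hab : a ≤ b)
    (hq : LipschitzOnWith K q (Icc a b)) (hm : AntitoneOn q (Icc a b)) (hx : |q a - x| ≤ r) :
    ∃ ξ, IsPlayOn r q ξ a b ∧ ξ a = x := by
  have hx' : |-q a - -x| ≤ r := by rw [← abs_neg]; convert hx using 2; ring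
  obtain ⟨ξ, h, h0⟩ := exists_isPlayOn_of_monotoneOn (q := fun t => -q t) hab hq.neg hm.neg hx'
  refine ⟨fun t => -ξ t, ⟨?_, ?_, ?_⟩, by simp [h0]⟩
  · obtain ⟨K', hK⟩ := h.lipschitz
    exact ⟨K', hK.neg⟩
  · intro t ht
    rw [← abs_neg]; convert h.constraint t ht using 2; ring
  · filter_upwards [h.inequality] with t i ht z hz
    have := i ht (-z) (by rwa [abs_neg])
    rw [deriv.fun_neg]
    convert this using 1; ring

theorem PiecewiseMonotone.exists_isPlayOn {r : ℝ} {q : ℝ → ℝ} {a b : ℝ}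
    (h : PiecewiseMonotone q a b) {x : ℝ} (hx : |q a - x| ≤ r) :
    ∃ ξ, IsPlayOn r q ξ a b ∧ ξ a = x := by
  induction h generalizing x with
  | mono hab hq hm => exact exists_isPlayOn_of_monotoneOn hab hq hm hx
  | anti hab hq hm => exact exists_isPlayOn_of_antitoneOn hab hq hm hx
  | @concat a b c h₁ h₂ ih₁ ih₂ =>
    obtain ⟨ξ₁, k₁, e₁⟩ := ih₁ hx
    obtain ⟨ξ₂, k₂, e₂⟩ := ih₂ (k₁.constraint b ⟨h₁.le, le_rfl⟩)
    exact ⟨_, k₁.concat h₁.le h₂.le k₂ e₂.symm, by simp [h₁.le, e₁]⟩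

theorem PiecewiseMonotone.lipschitzOnWith {q : ℝ → ℝ} {a b : ℝ} (h : PiecewiseMonotone q a b) :
    ∃ K, LipschitzOnWith K q (Icc a b) := by
  induction h with
  | mono _ hq => exact ⟨_, hq⟩
  | anti _ hq => exact ⟨_, hq⟩
  | concat h₁ h₂ ih₁ ih₂ =>
    obtain ⟨K₁, k₁⟩ := ih₁
    obtain ⟨K₂, k₂⟩ := ih₂
    exact ⟨_, lipschitzOnWith_concat h₁.le h₂.le k₁ k₂⟩

theorem PiecewiseMonotone.exists_isPlayAC {r T : ℝ} (hr : 0 < r) {q : ℝ → ℝ}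
    (h : PiecewiseMonotone q 0 T) : ∃ ξ, IsPlayAC T r q ξ := by
  have hx : |q 0 - max (q 0 - r) (min 0 (q 0 + r))| ≤ r := by
    rw [abs_le]; constructor <;> grind
  obtain ⟨ξ, k, e⟩ := h.exists_isPlayOn hx
  obtain ⟨K, hK⟩ := h.lipschitzOnWith
  obtain ⟨K', hK'⟩ := k.lipschitz
  refine ⟨ξ, ?_, ?_, k.constraint, ?_, e⟩
  · rw [← uIcc_of_le h.le] at hK; exact hK.absolutelyContinuousOnInterval
  · rw [← uIcc_of_le h.le] at hK'; exact hK'.absolutelyContinuousOnInterval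
  · rw [ae_restrict_iff' measurableSet_Ioo]; exact k.inequality

/-! ### The play on continuous inputs -/

/-- The piecewise affine interpolant of `q` at the nodes `i * T / n`. -/
def interp (T : ℝ) (q : ℝ → ℝ) (n : ℕ) (t : ℝ) : ℝ :=
  q (⌊t * n / T⌋₊ * T / n) +
    (t * n / T - ⌊t * n / T⌋₊) * (q ((⌊t * n / T⌋₊ + 1) * T / n) - q (⌊t * n / T⌋₊ * T / n))

theorem interp_eq {T : ℝ} (hT : 0 < T) (q : ℝ → ℝ) {n : ℕ} (hn : 0 < n) (i : ℕ) {t : ℝ}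
    (ht : t ∈ Icc (i * T / n) ((i + 1) * T / n)) :
    interp T q n t = q (i * T / n) + (t * n / T - i) * (q ((i + 1) * T / n) - q (i * T / n)) := by
  have hn' : (0 : ℝ) < n := Nat.cast_pos.mpr hn
  have h1 : (i : ℝ) ≤ t * n / T := by
    have := ht.1; rw [div_le_iff₀ hn'] at this; rwa [le_div_iff₀ hT]
  rcases ht.2.eq_or_lt with h | h
  · have e : t * n / T = ((i + 1 : ℕ) : ℝ) := by rw [h]; push_cast; field_simp
    unfold interp
    rw [e, Nat.floor_natCast]; push_cast; ring
  · have h2 : t * n / T < i + 1 := by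
      rw [lt_div_iff₀ hn'] at h; rwa [div_lt_iff₀ hT]
    have e : ⌊t * n / T⌋₊ = i := (Nat.floor_eq_iff ((Nat.cast_nonneg i).trans h1)).mpr ⟨h1, h2⟩
    unfold interp
    rw [e]

theorem piecewiseMonotone_interp {T : ℝ} (hT : 0 < T) (q : ℝ → ℝ) {n : ℕ} (hn : 0 < n) (k : ℕ) :
    PiecewiseMonotone (interp T q n) 0 (k * T / n) := by
  have hn' : (0 : ℝ) < n := Nat.cast_pos.mpr hn
  induction k with
  | zero =>
    simp only [Nat.cast_zero, zero_mul, zero_div]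
    have hs : (Icc (0 : ℝ) 0).Subsingleton := by rw [Icc_self]; exact subsingleton_singleton
    exact .mono (K := 0) le_rfl (fun x hx y hy => by simp [hs hx hy]) (hs.monotoneOn _)
  | succ i ih =>
    refine ih.concat ?_
    push_cast
    have hle : (i : ℝ) * T / n ≤ (i + 1) * T / n := by gcongr; linarith
    set d := q ((i + 1) * T / n) - q (i * T / n) with hd
    have hL : LipschitzOnWith (Real.toNNReal (n / T * |d|)) (interp T q n)
        (Icc (i * T / n) ((i + 1) * T / n)) := by
      refine LipschitzOnWith.of_dist_le_mul fun s hs t ht => ?_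
      rw [interp_eq hT q hn i hs, interp_eq hT q hn i ht, Real.dist_eq, Real.dist_eq, ← hd,
        Real.coe_toNNReal _ (by positivity)]
      rw [show q (i * T / n) + (s * n / T - i) * d - (q (i * T / n) + (t * n / T - i) * d)
        = n / T * d * (s - t) by ring, abs_mul, abs_mul, abs_of_nonneg (by positivity)]
    rcases le_total 0 d with h | h
    · refine .mono hle hL fun s hs t ht hst => ?_
      rw [interp_eq hT q hn i hs, interp_eq hT q hn i ht, ← hd]
      gcongr
    · refine .anti hle hL fun s hs t ht hst => ?_
      rw [interp_eq hT q hn i hs, interp_eq hT q hn i ht, ← hd]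
      have : (s * n / T - i) ≤ (t * n / T - i) := by gcongr
      have := mul_le_mul_of_nonpos_right this h
      linarith

theorem exists_node {T t : ℝ} (hT : 0 < T) {n : ℕ} (hn : 0 < n) (ht : t ∈ Icc 0 T) :
    ∃ i : ℕ, i < n ∧ t ∈ Icc (i * T / n) ((i + 1) * T / n) := by
  have hn' : (0 : ℝ) < n := Nat.cast_pos.mpr hn
  have hx0 : 0 ≤ t * n / T := by have := ht.1; positivity
  rcases ht.2.eq_or_lt with h | h
  · refine ⟨n - 1, by omega, ?_⟩
    rw [Nat.cast_sub hn, h]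
    constructor
    · rw [div_le_iff₀ hn', Nat.cast_one]; nlinarith
    · rw [le_div_iff₀ hn', Nat.cast_one]; nlinarith
  · refine ⟨⌊t * n / T⌋₊, ?_, ?_, ?_⟩
    · rw [Nat.floor_lt hx0, div_lt_iff₀ hT]; nlinarith
    · have := Nat.floor_le hx0
      rw [le_div_iff₀ hT] at this; rwa [div_le_iff₀ hn']
    · have := (Nat.lt_floor_add_one (t * n / T)).le
      rw [div_le_iff₀ hT] at this; rwa [le_div_iff₀ hn']

theorem tendstoUniformlyOn_interp {T : ℝ} (hT : 0 < T) {q : ℝ → ℝ}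
    (hq : ContinuousOn q (Icc 0 T)) :
    TendstoUniformlyOn (fun n => interp T q (n + 1)) q atTop (Icc 0 T) := by
  rw [Metric.tendstoUniformlyOn_iff]
  intro ε hε
  obtain ⟨δ, hδ, hu⟩ := Metric.uniformContinuousOn_iff.mp
    (isCompact_Icc.uniformContinuousOn_of_continuous hq) ε hε
  have hlim : Tendsto (fun n : ℕ => T / ((n : ℝ) + 1)) atTop (𝓝 0) :=
    tendsto_const_div_atTop_nhds_zero_nat T |>.comp (tendsto_add_atTop_nat 1) |>.congr
      (fun n => by simp)
  filter_upwards [hlim.eventually (gt_mem_nhds hδ)] with n hn t ht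
  have hn0 : (0 : ℝ) < ((n + 1 : ℕ) : ℝ) := by positivity
  obtain ⟨i, hi, hti⟩ := exists_node hT n.succ_pos ht
  rw [interp_eq hT q n.succ_pos i hti]
  simp only [Nat.succ_eq_add_one] at hti ⊢
  set N : ℝ := ((n + 1 : ℕ) : ℝ) with hN
  have hTN : T / N < δ := by rw [hN]; push_cast; exact hn
  have hiN : (i : ℝ) + 1 ≤ N := by rw [hN]; exact_mod_cast hi
  have hstep : (i + 1) * T / N = i * T / N + T / N := by ring
  have hTN0 : 0 < T / N := by positivity
  have m₁ : i * T / N ∈ Icc 0 T := ⟨by positivity, hti.1.trans ht.2⟩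
  have m₂ : (i + 1) * T / N ∈ Icc 0 T :=
    ⟨by positivity, by rw [div_le_iff₀ hn0]; nlinarith⟩
  have b₁ := hu t ht _ m₁ (by
    rw [Real.dist_eq, abs_of_nonneg (by linarith [hti.1])]; linarith [hti.2])
  have b₂ := hu t ht _ m₂ (by
    rw [Real.dist_eq, abs_of_nonpos (by linarith [hti.2])]; linarith [hti.1])
  have hθ0 : 0 ≤ t * N / T - i := by
    have := hti.1; rw [div_le_iff₀ hn0] at this; rw [sub_nonneg, le_div_iff₀ hT]; exact this
  have hθ1 : t * N / T - i ≤ 1 := by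
    have := hti.2; rw [le_div_iff₀ hn0] at this; rw [sub_le_iff_le_add, div_le_iff₀ hT]; linarith
  set θ := t * N / T - i
  rw [Real.dist_eq, abs_lt] at b₁ b₂ ⊢
  have hc := convex_Ioo (-ε) ε b₁ b₂ (sub_nonneg.mpr hθ1) hθ0 (sub_add_cancel 1 θ)
  simp only [smul_eq_mul] at hc
  rw [show ∀ x y z : ℝ, x - (y + θ * (z - y)) = (1 - θ) * (x - y) + θ * (x - z) from
    fun x y z => by ring]
  exact hc

theorem exists_piecewiseMonotone_approx {T : ℝ} (hT : 0 < T) {q : ℝ → ℝ}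
    (hq : ContinuousOn q (Icc 0 T)) : ∃ p : ℕ → ℝ → ℝ, (∀ n, PiecewiseMonotone (p n) 0 T) ∧
      TendstoUniformlyOn p q atTop (Icc 0 T) := by
  refine ⟨fun n => interp T q (n + 1), fun n => ?_, tendstoUniformlyOn_interp hT hq⟩
  have := piecewiseMonotone_interp hT q n.succ_pos (n + 1)
  rwa [mul_comm, Nat.succ_eq_add_one, mul_div_assoc, div_self (by positivity), mul_one] at this

theorem IsPlayAC.isPlay {T r : ℝ} {q ξ : ℝ → ℝ} (h : IsPlayAC T r q ξ) : IsPlay T r q ξ :=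
  ⟨fun _ => q, fun _ => ξ, fun _ => h,
    fun _ hu => Eventually.of_forall fun _ _ _ => refl_mem_uniformity hu,
    fun _ hu => Eventually.of_forall fun _ _ _ => refl_mem_uniformity hu⟩

theorem IsPlay.abs_sub_le {T r t M : ℝ} {q₁ q₂ ξ₁ ξ₂ : ℝ → ℝ} (ht : t ∈ Icc 0 T)
    (h₁ : IsPlay T r q₁ ξ₁) (h₂ : IsPlay T r q₂ ξ₂)
    (hM : ∀ τ ∈ Icc 0 t, |q₁ τ - q₂ τ| ≤ M) : |ξ₁ t - ξ₂ t| ≤ M := by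
  obtain ⟨p₁, x₁, k₁, l₁, m₁⟩ := h₁
  obtain ⟨p₂, x₂, k₂, l₂, m₂⟩ := h₂
  refine le_of_forall_pos_le_add fun ε hε => ?_
  have hlim : Tendsto (fun n => |x₁ n t - x₂ n t|) atTop (𝓝 |ξ₁ t - ξ₂ t|) :=
    ((m₁.tendsto_at ht).sub (m₂.tendsto_at ht)).abs
  refine le_of_tendsto hlim ?_
  rw [Metric.tendstoUniformlyOn_iff] at l₁ l₂
  filter_upwards [l₁ (ε / 2) (by positivity), l₂ (ε / 2) (by positivity)] with n a₁ a₂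
  refine (k₁ n).abs_sub_le ht (k₂ n) fun τ hτ => ?_
  have hτ' : τ ∈ Icc 0 T := ⟨hτ.1, hτ.2.trans ht.2⟩
  have b₁ := a₁ τ hτ'
  have b₂ := a₂ τ hτ'
  have b₃ := hM τ hτ
  rw [Real.dist_eq, abs_lt] at b₁ b₂
  rw [abs_le] at b₃ ⊢
  constructor <;> linarith

/-- By nonexpansivity, the responses to approximating inputs form a uniform Cauchy sequence. -/
theorem exists_isPlay {T r : ℝ} (hT : 0 < T) (hr : 0 < r) {q : ℝ → ℝ}
    (hq : ContinuousOn q (Icc 0 T)) : ∃ ξ, IsPlay T r q ξ := by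
  obtain ⟨p, hp, hpq⟩ := exists_piecewiseMonotone_approx hT hq
  choose x hx using fun n => (hp n).exists_isPlayAC hr
  have hC : UniformCauchySeqOn x atTop (Icc 0 T) := by
    have hC := hpq.uniformCauchySeqOn
    rw [Metric.uniformCauchySeqOn_iff] at hC ⊢
    intro ε hε
    obtain ⟨N, hN⟩ := hC (ε / 2) (by positivity)
    refine ⟨N, fun m hm n hn t ht => ?_⟩
    refine lt_of_le_of_lt ((hx m).abs_sub_le ht (hx n) (M := ε / 2) fun τ hτ => ?_) (by linarith)
    exact (hN m hm n hn τ ⟨hτ.1, hτ.2.trans ht.2⟩).le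
  have hlim : ∀ t, ∃ y, t ∈ Icc 0 T → Tendsto (fun n => x n t) atTop (𝓝 y) := fun t => by
    by_cases ht : t ∈ Icc 0 T
    · obtain ⟨y, hy⟩ := cauchySeq_tendsto_of_complete (hC.cauchy_map ht)
      exact ⟨y, fun _ => hy⟩
    · exact ⟨0, fun h => absurd h ht⟩
  choose ξ hξ using hlim
  exact ⟨ξ, p, x, hx, hpq, hC.tendstoUniformlyOn_of_tendsto hξ⟩

/-- The response to a continuous input exists, so `play` is not a junk value of `epsilon`. -/
theorem isPlay_play {T r : ℝ} (hT : 0 < T) (hr : 0 < r) {q : ℝ → ℝ}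
    (hq : ContinuousOn q (Icc 0 T)) : IsPlay T r q (play T r q) :=
  Classical.epsilon_spec (exists_isPlay hT hr hq)

theorem IsPlayAC.continuousOn_input {T r : ℝ} (hT : 0 < T) {q ξ : ℝ → ℝ} (h : IsPlayAC T r q ξ) :
    ContinuousOn q (Icc 0 T) := by
  have := h.input_ac.continuousOn
  rwa [uIcc_of_le hT.le] at this

theorem IsPlayAC.play_eq {T r t : ℝ} (hT : 0 < T) (hr : 0 < r) {q ξ : ℝ → ℝ}
    (h : IsPlayAC T r q ξ) (ht : t ∈ Icc 0 T) : play T r q t = ξ t := by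
  have := (isPlay_play hT hr (h.continuousOn_input hT)).abs_sub_le ht h.isPlay (M := 0) (by simp)
  have := abs_nonpos_iff.mp this
  linarith

/-- The play is nonexpansive in the maximum norm on every interval `[0,t]`. -/
theorem abs_play_sub_le {T r t M : ℝ} (hT : 0 < T) (hr : 0 < r) {q₁ q₂ : ℝ → ℝ}
    (hq₁ : ContinuousOn q₁ (Icc 0 T)) (hq₂ : ContinuousOn q₂ (Icc 0 T)) (ht : t ∈ Icc 0 T)
    (hM : ∀ τ ∈ Icc 0 t, |q₁ τ - q₂ τ| ≤ M) : |play T r q₁ t - play T r q₂ t| ≤ M :=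
  (isPlay_play hT hr hq₁).abs_sub_le ht (isPlay_play hT hr hq₂) hM

theorem PiecewiseMonotone.continuousOn {q : ℝ → ℝ} {a b : ℝ} (h : PiecewiseMonotone q a b) :
    ContinuousOn q (Icc a b) := by
  obtain ⟨K, hK⟩ := h.lipschitzOnWith
  exact hK.continuousOn

/-- The play of a continuous input is `1`-Lipschitz in the threshold. -/
theorem abs_play_sub_le_threshold {T r ρ t : ℝ} (hT : 0 < T) (hr : 0 < r) (hrρ : r ≤ ρ)
    {q : ℝ → ℝ} (hq : ContinuousOn q (Icc 0 T)) (ht : t ∈ Icc 0 T) :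
    |play T r q t - play T ρ q t| ≤ ρ - r := by
  refine le_of_forall_pos_le_add fun ε hε => ?_
  obtain ⟨p, hp, hpq⟩ := exists_piecewiseMonotone_approx hT hq
  rw [Metric.tendstoUniformlyOn_iff] at hpq
  obtain ⟨n, hn⟩ := (hpq (ε / 2) (by positivity)).exists
  have hρ := hr.trans_le hrρ
  obtain ⟨ξ, hξ⟩ := (hp n).exists_isPlayAC hr
  obtain ⟨η, hη⟩ := (hp n).exists_isPlayAC hρ
  have hd : ∀ τ ∈ Icc 0 t, |q τ - p n τ| ≤ ε / 2 := fun τ hτ =>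
    (hn τ ⟨hτ.1, hτ.2.trans ht.2⟩).le
  have a₁ := abs_le.mp (abs_play_sub_le hT hr hq (hp n).continuousOn ht hd)
  have a₂ := abs_le.mp (abs_play_sub_le hT hρ hq (hp n).continuousOn ht hd)
  rw [hξ.play_eq hT hr ht] at a₁
  rw [hη.play_eq hT hρ ht] at a₂
  have a₃ := abs_le.mp (hξ.abs_sub_le_threshold ht hrρ hη)
  rw [abs_le]; constructor <;> linarith

theorem continuousOn_play_threshold {T t : ℝ} (hT : 0 < T) {q : ℝ → ℝ}
    (hq : ContinuousOn q (Icc 0 T)) (ht : t ∈ Icc 0 T) :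
    ContinuousOn (fun r => play T r q t) (Ioi 0) := by
  refine LipschitzOnWith.continuousOn (K := 1) (LipschitzOnWith.of_dist_le_mul ?_)
  intro r hr ρ hρ
  rw [NNReal.coe_one, one_mul, Real.dist_eq, Real.dist_eq]
  rcases le_total r ρ with h | h
  · refine (abs_play_sub_le_threshold hT hr h hq ht).trans ?_
    rw [abs_sub_comm]; exact le_abs_self _
  · rw [abs_sub_comm]
    exact (abs_play_sub_le_threshold hT hρ h hq ht).trans (le_abs_self _)

theorem continuousOn_play {T r : ℝ} (hT : 0 < T) (hr : 0 < r) {q : ℝ → ℝ}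
    (hq : ContinuousOn q (Icc 0 T)) : ContinuousOn (play T r q) (Icc 0 T) := by
  obtain ⟨p, x, hx, -, hl⟩ := isPlay_play hT hr hq
  refine hl.continuousOn (Frequently.of_forall fun n => ?_)
  have := (hx n).output_ac.continuousOn
  rwa [uIcc_of_le hT.le] at this

/-! ### Operators of Preisach type -/

/-- A density `h : (0,∞) × ℝ → ℝ` which for almost every threshold `r` is bounded by `b r` and
Lipschitz continuous with constant `m r`, where `b` and `m` are integrable. Both the density of the
Preisach operator and that of its potential are of this kind. -/
structure IsPreisachDensity (h : ℝ → ℝ → ℝ) (m b : ℝ → ℝ) : Prop where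
  integrable_lip : IntegrableOn m (Ioi 0)
  integrable_bound : IntegrableOn b (Ioi 0)
  lip_nonneg : ∀ r, 0 ≤ m r
  aestronglyMeasurable : ∀ φ : ℝ → ℝ, ContinuousOn φ (Ioi 0) →
    AEStronglyMeasurable (fun r => h r (φ r)) (volume.restrict (Ioi 0))
  lipschitz : ∀ᵐ r ∂(volume.restrict (Ioi (0 : ℝ))), ∀ u v, |h r u - h r v| ≤ m r * |u - v|
  bound : ∀ᵐ r ∂(volume.restrict (Ioi (0 : ℝ))), ∀ v, |h r v| ≤ b r

/-- The operator of Preisach type with density `h`. -/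
def playIntegral (T : ℝ) (h : ℝ → ℝ → ℝ) (q : ℝ → ℝ) (t : ℝ) : ℝ :=
  ∫ r in Ioi (0 : ℝ), h r (play T r q t)

namespace IsPreisachDensity

variable {h : ℝ → ℝ → ℝ} {m b : ℝ → ℝ} {T t : ℝ} {q q₁ q₂ : ℝ → ℝ}

theorem integrableOn (hh : IsPreisachDensity h m b) (hT : 0 < T) (hq : ContinuousOn q (Icc 0 T))
    (ht : t ∈ Icc 0 T) : IntegrableOn (fun r => h r (play T r q t)) (Ioi 0) := by
  refine hh.integrable_bound.mono'
    (hh.aestronglyMeasurable _ (continuousOn_play_threshold hT hq ht)) ?_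
  filter_upwards [hh.bound] with r hr using hr _

theorem abs_playIntegral_le (hh : IsPreisachDensity h m b) :
    |playIntegral T h q t| ≤ ∫ r in Ioi 0, b r := by
  rw [← Real.norm_eq_abs]
  refine norm_integral_le_of_norm_le hh.integrable_bound ?_
  filter_upwards [hh.bound] with r hr using hr _

theorem abs_playIntegral_sub_le (hh : IsPreisachDensity h m b) (hT : 0 < T)
    (hq₁ : ContinuousOn q₁ (Icc 0 T)) (hq₂ : ContinuousOn q₂ (Icc 0 T)) (ht : t ∈ Icc 0 T) {M : ℝ}
    (hM : ∀ τ ∈ Icc 0 t, |q₁ τ - q₂ τ| ≤ M) :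
    |playIntegral T h q₁ t - playIntegral T h q₂ t| ≤ (∫ r in Ioi 0, m r) * M := by
  unfold playIntegral
  rw [← integral_sub (hh.integrableOn hT hq₁ ht) (hh.integrableOn hT hq₂ ht), ← integral_mul_const]
  rw [← Real.norm_eq_abs]
  refine norm_integral_le_of_norm_le (hh.integrable_lip.mul_const M) ?_
  filter_upwards [hh.lipschitz, ae_restrict_mem measurableSet_Ioi] with r hr hr0
  refine (hr _ _).trans ?_
  have := abs_play_sub_le hT hr0 hq₁ hq₂ ht hM
  have := hh.lip_nonneg r
  gcongr

theorem continuousOn_playIntegral (hh : IsPreisachDensity h m b) (hT : 0 < T)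
    (hq : ContinuousOn q (Icc 0 T)) : ContinuousOn (playIntegral T h q) (Icc 0 T) := by
  refine continuousOn_of_dominated (bound := b) (fun t ht => (hh.integrableOn hT hq ht).1)
    (fun t ht => ?_) hh.integrable_bound ?_
  · filter_upwards [hh.bound] with r hr using hr _
  · filter_upwards [hh.lipschitz, ae_restrict_mem measurableSet_Ioi] with r hr hr0
    have hc : Continuous (h r) := by
      refine (LipschitzWith.of_dist_le_mul (K := ⟨m r, hh.lip_nonneg r⟩) fun u v => ?_).continuous
      exact hr u v
    exact hc.comp_continuousOn (continuousOn_play hT hr0 hq)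

end IsPreisachDensity

theorem ae_ae_of_ae_restrict_Ioi_prod {p : ℝ × ℝ → Prop}
    (h : ∀ᵐ x ∂((volume : Measure (ℝ × ℝ)).restrict (Ioi 0 ×ˢ univ)), p x) :
    ∀ᵐ r ∂(volume.restrict (Ioi (0 : ℝ))), ∀ᵐ v : ℝ, p (r, v) := by
  rw [Measure.volume_eq_prod, ← Measure.prod_restrict, Measure.restrict_univ] at h
  exact Measure.ae_ae_of_ae_prod h

theorem integrable_prod_of_integrableOn {F : ℝ × ℝ → ℝ} (h : IntegrableOn F (Ioi 0 ×ˢ univ)) :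
    Integrable F ((volume.restrict (Ioi (0 : ℝ))).prod volume) := by
  rwa [IntegrableOn, Measure.volume_eq_prod, ← Measure.prod_restrict, Measure.restrict_univ] at h

theorem lipschitz_integral_deriv {k : ℝ → ℝ} {K : NNReal} (hk : LipschitzWith K k) (u v : ℝ) :
    ∫ x in u..v, deriv k x = k v - k u :=
  (hk.lipschitzOnWith (s := uIcc u v)).absolutelyContinuousOnInterval.integral_deriv_eq_sub

theorem PreisachHypothesis.ae_monotone {g : ℝ → ℝ → ℝ} (hg : PreisachHypothesis g) :
    ∀ᵐ r ∂(volume.restrict (Ioi (0 : ℝ))), Monotone (g r) := by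
  obtain ⟨μ, -, hμ⟩ := hg.deriv_le
  filter_upwards [ae_ae_of_ae_restrict_Ioi_prod hμ, ae_restrict_mem measurableSet_Ioi]
    with r hr hr0 u v huv
  obtain ⟨K, hK⟩ := hg.lipschitz r hr0
  rw [← sub_nonneg, ← lipschitz_integral_deriv hK]
  exact intervalIntegral.integral_nonneg_of_ae huv (by filter_upwards [hr] with x hx using hx.1)

/-- The bound is `∫ |∂g/∂v| dv`, since `g r 0 = 0`. -/
theorem PreisachHypothesis.exists_isPreisachDensity {g : ℝ → ℝ → ℝ} (hg : PreisachHypothesis g) :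
    ∃ m b, IsPreisachDensity g m b := by
  obtain ⟨μ, hμi, hμ⟩ := hg.deriv_le
  have hD := integrable_prod_of_integrableOn hg.deriv_integrable
  refine ⟨fun r => |μ r|, fun r => ∫ v, ‖deriv (g r) v‖, hμi.abs, hD.norm.integral_prod_left,
    fun r => abs_nonneg _, fun φ hφ => ?_, ?_, ?_⟩
  · have := hφ.aemeasurable (μ := volume) measurableSet_Ioi
    exact (hg.measurable.comp_aemeasurable (aemeasurable_id.prodMk this)).aestronglyMeasurable
  · filter_upwards [ae_ae_of_ae_restrict_Ioi_prod hμ, ae_restrict_mem measurableSet_Ioi]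
      with r hr hr0 u v
    obtain ⟨K, hK⟩ := hg.lipschitz r hr0
    rw [← lipschitz_integral_deriv hK]
    rw [← Real.norm_eq_abs]
    refine intervalIntegral.norm_integral_le_of_norm_le_const_ae ?_
    filter_upwards [hr] with x hx _
    rw [Real.norm_eq_abs, abs_of_nonneg hx.1]
    exact hx.2.trans (le_abs_self _)
  · filter_upwards [hD.prod_right_ae, ae_restrict_mem measurableSet_Ioi, hg.zero] with r hr hr0 h0 v
    obtain ⟨K, hK⟩ := hg.lipschitz r hr0
    have := lipschitz_integral_deriv hK 0 v
    rw [h0, sub_zero] at this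
    rw [← this, ← Real.norm_eq_abs]
    refine (intervalIntegral.norm_integral_le_integral_norm_uIoc).trans ?_
    exact setIntegral_le_integral hr.norm (Eventually.of_forall fun x => norm_nonneg _)

theorem PreisachHypothesis.exists_isPreisachDensity_potential {g : ℝ → ℝ → ℝ}
    (hg : PreisachHypothesis g) : ∃ m b, IsPreisachDensity (potentialDensity g) m b := by
  obtain ⟨μ, hμi, hμ⟩ := hg.mul_deriv_le
  obtain ⟨_, _, hpos⟩ := hg.deriv_le
  have hD := integrable_prod_of_integrableOn hg.mul_deriv_integrable
  refine ⟨fun r => |μ r|, fun r => ∫ v, ‖v * deriv (g r) v‖, hμi.abs, hD.norm.integral_prod_left,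
    fun r => abs_nonneg _, fun φ hφ => ?_, ?_, ?_⟩
  · have hφm := hφ.aemeasurable (μ := volume) measurableSet_Ioi
    -- the integral `∫₀^ψ` is the integral over one measurable region minus that over another
    set ψ := hφm.mk φ
    have hψ : Measurable ψ := hφm.measurable_mk
    have e₁ : MeasurableSet {p : ℝ × ℝ | p.2 ∈ Ioc 0 (ψ p.1)} :=
      (measurableSet_lt measurable_const measurable_snd).inter
        (measurableSet_le measurable_snd (hψ.comp measurable_fst))
    have e₂ : MeasurableSet {p : ℝ × ℝ | p.2 ∈ Ioc (ψ p.1) 0} :=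
      (measurableSet_lt (hψ.comp measurable_fst) measurable_snd).inter
        (measurableSet_le measurable_snd measurable_const)
    have m₁ := (hD.1.indicator e₁).integral_prod_right'
    have m₂ := (hD.1.indicator e₂).integral_prod_right'
    refine (m₁.sub m₂).congr ?_
    filter_upwards [hφm.ae_eq_mk] with r hr
    simp only [Pi.sub_apply]
    rw [hr, potentialDensity, intervalIntegral, ← integral_indicator measurableSet_Ioc,
      ← integral_indicator measurableSet_Ioc]
    rfl
  · filter_upwards [ae_ae_of_ae_restrict_Ioi_prod hμ, ae_ae_of_ae_restrict_Ioi_prod hpos,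
      hD.prod_right_ae] with r hr hp hi u v
    have hI : ∀ x y : ℝ, IntervalIntegrable (fun v => v * deriv (g r) v) volume x y :=
      fun x y => hi.intervalIntegrable
    unfold potentialDensity
    rw [intervalIntegral.integral_interval_sub_left (hI _ _) (hI _ _)]
    rw [← Real.norm_eq_abs]
    refine intervalIntegral.norm_integral_le_of_norm_le_const_ae ?_
    filter_upwards [hr, hp] with x hx hx' _
    rw [Real.norm_eq_abs, abs_mul, abs_of_nonneg hx'.1]
    exact hx.trans (le_abs_self _)
  · filter_upwards [hD.prod_right_ae] with r hr v
    rw [← Real.norm_eq_abs]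
    refine (intervalIntegral.norm_integral_le_integral_norm_uIoc).trans ?_
    exact setIntegral_le_integral hr.norm (Eventually.of_forall fun x => norm_nonneg _)

/-! ### The resolvent estimate for operators of Preisach type -/

/-- A function whose increments are controlled by those of an absolutely continuous function is
absolutely continuous. -/
theorem ac_of_dist_le {f h : ℝ → ℝ} {a b : ℝ} (hf : AbsolutelyContinuousOnInterval f a b) (C : ℝ)
    (hC : ∀ x ∈ uIcc a b, ∀ y ∈ uIcc a b, dist (h x) (h y) ≤ C * dist (f x) (f y)) :
    AbsolutelyContinuousOnInterval h a b := by
  have hf' := Tendsto.const_mul C hf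
  rw [mul_zero] at hf'
  refine squeeze_zero' (Eventually.of_forall fun E => Finset.sum_nonneg fun _ _ => dist_nonneg) ?_
    hf'
  rw [eventually_inf_principal]
  refine Eventually.of_forall fun E hE => ?_
  rw [Finset.mul_sum]
  exact Finset.sum_le_sum fun i hi => hC _ (hE.1 i hi).1 _ (hE.1 i hi).2

/-- The tail `∫_ρ^∞ N(r) dr`. -/
def tail (N : ℝ → ℝ) (ρ : ℝ) : ℝ := ∫ r in Ioi ρ, N r

section Tail

variable {N : ℝ → ℝ}

theorem tail_nonneg (h0 : ∀ r, 0 ≤ N r) (ρ : ℝ) : 0 ≤ tail N ρ :=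
  integral_nonneg h0

theorem tail_le (hN : IntegrableOn N (Ioi 0)) (h0 : ∀ r, 0 ≤ N r) {ρ : ℝ} (hρ : 0 ≤ ρ) :
    tail N ρ ≤ tail N 0 :=
  setIntegral_mono_set hN (Eventually.of_forall h0) (Ioi_subset_Ioi hρ).eventuallyLE

theorem intervalIntegrable_of_tail (hN : IntegrableOn N (Ioi 0)) {x y : ℝ} (hx : 0 ≤ x)
    (hxy : x ≤ y) : IntervalIntegrable N volume x y := by
  rw [intervalIntegrable_iff_integrableOn_Ioc_of_le hxy]
  exact hN.mono_set fun z hz => hx.trans_lt hz.1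

theorem tail_eq (hN : IntegrableOn N (Ioi 0)) {ρ : ℝ} (hρ : 0 ≤ ρ) :
    tail N ρ = tail N 0 - ∫ r in (0 : ℝ)..ρ, N r := by
  have := intervalIntegral.integral_interval_add_Ioi hN
    (hN.mono_set (Ioi_subset_Ioi hρ))
  unfold tail; linarith

theorem continuousOn_tail (hN : IntegrableOn N (Ioi 0)) : ContinuousOn (tail N) (Ici 0) := by
  have hc : ContinuousOn (fun ρ => tail N 0 - ∫ r in (0 : ℝ)..ρ, N r) (Ici 0) := by
    intro x hx
    have hx' : (0 : ℝ) ≤ x := hx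
    have h1 := intervalIntegral.continuousOn_primitive_interval (μ := volume) (f := N) (a := 0)
      (b := x + 1) (by
        rw [uIcc_of_le (by linarith), integrableOn_Icc_iff_integrableOn_Ioc]
        exact hN.mono_set fun z hz => hz.1)
    have h2 := (h1 x ⟨by simp [hx'], by simp⟩)
    rw [uIcc_of_le (by linarith)] at h2
    refine ContinuousWithinAt.sub continuousWithinAt_const (h2.mono_of_mem_nhdsWithin ?_)
    rw [mem_nhdsWithin]
    exact ⟨Iio (x + 1), isOpen_Iio, by simp, fun z hz => ⟨hz.2, hz.1.le⟩⟩
  exact hc.congr fun x hx => tail_eq hN hx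

theorem integrableOn_mul_exp_tail (hN : IntegrableOn N (Ioi 0)) (h0 : ∀ r, 0 ≤ N r) {m : ℝ → ℝ}
    (hm : IntegrableOn m (Ioi 0)) :
    IntegrableOn (fun r => m r * Real.exp (tail N r)) (Ioi 0) := by
  refine Integrable.mul_bdd (c := Real.exp (tail N 0)) hm ?_ ?_
  · exact (Real.continuous_exp.comp_continuousOn
      ((continuousOn_tail hN).mono Ioi_subset_Ici_self)).aestronglyMeasurable measurableSet_Ioi
  · filter_upwards [ae_restrict_mem measurableSet_Ioi] with r hr
    rw [Real.norm_eq_abs, Real.abs_exp]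
    exact Real.exp_le_exp.mpr (tail_le hN h0 hr.le)

/-- The function `exp (tail N)` solves the integral equation `y(ρ) = 1 + ∫_ρ^∞ N y`. -/
theorem integral_mul_exp_tail (hN : IntegrableOn N (Ioi 0)) (h0 : ∀ r, 0 ≤ N r) {ρ : ℝ}
    (hρ : 0 ≤ ρ) : ∫ r in Ioi ρ, N r * Real.exp (tail N r) = Real.exp (tail N ρ) - 1 := by
  have hint : ∀ R, ρ ≤ R → ∫ r in ρ..R, N r * Real.exp (tail N r)
      = Real.exp (tail N ρ) - Real.exp (tail N R) := by
    intro R hR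
    set h : ℝ → ℝ := fun x => -Real.exp (tail N 0 - ∫ r in (0 : ℝ)..x, N r) with hh
    have hI : IntervalIntegrable N volume 0 R := intervalIntegrable_of_tail hN le_rfl (hρ.trans hR)
    have hsub : uIcc ρ R ⊆ uIcc 0 R := by
      rw [uIcc_of_le hR, uIcc_of_le (hρ.trans hR)]; exact Icc_subset_Icc_left hρ
    have hF := (hI.absolutelyContinuousOnInterval_intervalIntegral (c := 0) (by simp)).mono hsub
    have hac : AbsolutelyContinuousOnInterval h ρ R := by
      refine ac_of_dist_le hF (Real.exp (tail N 0)) fun x hx y hy => ?_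
      rw [uIcc_of_le hR] at hx hy
      have key : ∀ u v : ℝ, u ≤ v → v ≤ tail N 0 → Real.exp v - Real.exp u
          ≤ Real.exp (tail N 0) * (v - u) := by
        intro u v huv hv
        have e1 := Real.add_one_le_exp (u - v)
        have e2 : Real.exp u = Real.exp v * Real.exp (u - v) := by rw [← Real.exp_add]; ring_nf
        have e3 := Real.exp_le_exp.mpr hv
        have e4 := Real.exp_pos v
        rw [e2]
        nlinarith
      have hpos : ∀ z ∈ Icc ρ R, tail N 0 - ∫ r in (0 : ℝ)..z, N r ≤ tail N 0 := fun z hz => by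
        rw [← tail_eq hN (hρ.trans hz.1)]; exact tail_le hN h0 (hρ.trans hz.1)
      simp only [hh, Real.dist_eq]
      rcases le_total (∫ r in (0 : ℝ)..x, N r) (∫ r in (0 : ℝ)..y, N r) with hle | hle
      · have := key _ _ (sub_le_sub_left hle (tail N 0)) (hpos x hx)
        rw [abs_of_nonpos (by
          have := Real.exp_le_exp.mpr (sub_le_sub_left hle (tail N 0)); linarith),
          abs_of_nonpos (by linarith)]
        linarith
      · have := key _ _ (sub_le_sub_left hle (tail N 0)) (hpos y hy)
        rw [abs_of_nonneg (by
          have := Real.exp_le_exp.mpr (sub_le_sub_left hle (tail N 0)); linarith),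
          abs_of_nonneg (by linarith)]
        linarith
    have hd := hac.integral_deriv_eq_sub
    have e : ∫ r in ρ..R, N r * Real.exp (tail N r) = ∫ r in ρ..R, deriv h r := by
      refine intervalIntegral.integral_congr_ae ?_
      filter_upwards [hI.ae_hasDerivAt_integral] with x hx hm
      rw [uIoc_of_le hR] at hm
      have hx0 : 0 ≤ x := hρ.trans hm.1.le
      have := hx (by rw [uIcc_of_le (hρ.trans hR)]; exact ⟨hx0, hm.2⟩) 0 (by simp)
      have h2 := ((this.const_sub (tail N 0)).exp).neg
      have h3 : deriv h x = _ := h2.deriv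
      rw [h3, tail_eq hN hx0]; ring
    rw [e, hd, tail_eq hN hρ, tail_eq hN (hρ.trans hR)]; ring
  have hlim : Tendsto (fun R => ∫ r in ρ..R, N r * Real.exp (tail N r)) atTop
      (𝓝 (∫ r in Ioi ρ, N r * Real.exp (tail N r))) :=
    intervalIntegral_tendsto_integral_Ioi _ ((integrableOn_mul_exp_tail hN h0 hN).mono_set
      (Ioi_subset_Ioi hρ)) tendsto_id
  have htail : Tendsto (fun R => tail N R) atTop (𝓝 0) := by
    have := intervalIntegral_tendsto_integral_Ioi 0 hN tendsto_id
    have h2 := this.const_sub (tail N 0)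
    rw [show tail N 0 - ∫ x in Ioi 0, N x = 0 from sub_self _] at h2
    refine h2.congr' ?_
    filter_upwards [eventually_ge_atTop 0] with R hR using (tail_eq hN hR).symm
  have hlim2 : Tendsto (fun R => Real.exp (tail N ρ) - Real.exp (tail N R)) atTop
      (𝓝 (Real.exp (tail N ρ) - 1)) := by
    have := (Real.continuous_exp.tendsto 0).comp htail
    rw [Real.exp_zero] at this
    exact this.const_sub _
  refine tendsto_nhds_unique hlim (hlim2.congr' ?_)
  filter_upwards [eventually_ge_atTop ρ] with R hR using (hint R hR).symm

end Tail

theorem playInit_mono {r a b : ℝ} (hab : a ≤ b) :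
    max (a - r) (min 0 (a + r)) ≤ max (b - r) (min 0 (b + r)) :=
  max_le_max (by linarith) (min_le_min le_rfl (by linarith))

/-- One-sided improvement step. If the differences of the play responses are bounded by
`k exp (tail N)`, then a difference that increases at threshold `ρ` above the level
`η + k (exp (tail N ρ) - 1)` would, by nestedness, make all contributions of the thresholds below
`ρ` nonnegative, and the remaining ones are too small to be compatible with the equation. -/
theorem play_sub_le_of_resolvent {g : ℝ → ℝ → ℝ} {m b : ℝ → ℝ} {T t A η k ρ : ℝ}
    {a q₁ q₂ : ℝ → ℝ} {ξ₁ ξ₂ : ℝ → ℝ → ℝ} (hg : IsPreisachDensity g m b)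
    (hmono : ∀ᵐ r ∂(volume.restrict (Ioi (0 : ℝ))), Monotone (g r)) (hT : 0 < T) (ht : t ∈ Icc 0 T)
    (h₁ : ∀ r, 0 < r → IsPlayAC T r q₁ (ξ₁ r)) (h₂ : ∀ r, 0 < r → IsPlayAC T r q₂ (ξ₂ r))
    (hA : 0 ≤ A) (ha : ∀ τ ∈ Icc 0 t, a τ ∈ Icc 0 A) (hη : 0 ≤ η) (hk : η ≤ k)
    (hE : ∀ τ ∈ Icc 0 t,
      |q₁ τ - q₂ τ + a τ * (playIntegral T g q₁ τ - playIntegral T g q₂ τ)| ≤ η)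
    (hw : ∀ r, 0 < r → ∀ τ ∈ Icc 0 t,
      |ξ₁ r τ - ξ₂ r τ| ≤ k * Real.exp (tail (fun r => A * m r) r))
    (hρ : 0 < ρ) {s : ℝ} (hs : s ∈ Icc 0 t) :
    ξ₁ ρ s - ξ₂ ρ s ≤ η + k * (Real.exp (tail (fun r => A * m r) ρ) - 1) := by
  set N : ℝ → ℝ := fun r => A * m r with hN
  have hN0 : ∀ r, 0 ≤ N r := fun r => mul_nonneg hA (hg.lip_nonneg r)
  have hNi : IntegrableOn N (Ioi 0) := hg.integrable_lip.const_mul A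
  have hk0 : 0 ≤ k := hη.trans hk
  have hsT : s ∈ Icc 0 T := ⟨hs.1, hs.2.trans ht.2⟩
  have c₁ := (h₁ ρ hρ).continuousOn_input hT
  have c₂ := (h₂ ρ hρ).continuousOn_input hT
  have hexp : 1 ≤ Real.exp (tail N ρ) := Real.one_le_exp (tail_nonneg hN0 ρ)
  have hc : η ≤ η + k * (Real.exp (tail N ρ) - 1) :=
    le_add_of_nonneg_right (mul_nonneg hk0 (by linarith))
  have hΓ : ∀ τ ∈ Icc 0 T, playIntegral T g q₁ τ - playIntegral T g q₂ τ
      = ∫ r in Ioi 0, (g r (ξ₁ r τ) - g r (ξ₂ r τ)) ∧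
      IntegrableOn (fun r => g r (ξ₁ r τ) - g r (ξ₂ r τ)) (Ioi 0) := by
    intro τ hτ
    have i₁ := hg.integrableOn hT c₁ hτ
    have i₂ := hg.integrableOn hT c₂ hτ
    have e : EqOn (fun r => g r (play T r q₁ τ) - g r (play T r q₂ τ))
        (fun r => g r (ξ₁ r τ) - g r (ξ₂ r τ)) (Ioi 0) := fun r hr => by
      simp only
      rw [(h₁ r hr).play_eq hT hr hτ, (h₂ r hr).play_eq hT hr hτ]
    refine ⟨?_, (i₁.sub i₂).congr_fun e measurableSet_Ioi⟩
    rw [← setIntegral_congr_fun measurableSet_Ioi e, integral_sub i₁ i₂]; rfl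
  refine ac_le_of_deriv_nonpos (w := fun s => ξ₁ ρ s - ξ₂ ρ s)
    ((h₁ ρ hρ).output_ac.sub (h₂ ρ hρ).output_ac) hsT ?_ ?_
  · have h0 : (0 : ℝ) ∈ Icc 0 t := ⟨le_rfl, ht.1⟩
    have h0T : (0 : ℝ) ∈ Icc 0 T := ⟨le_rfl, hT.le⟩
    rcases le_total (q₁ 0) (q₂ 0) with hq | hq
    · have := playInit_mono (r := ρ) hq
      rw [← (h₁ ρ hρ).initial, ← (h₂ ρ hρ).initial] at this
      linarith
    · have hpos : 0 ≤ playIntegral T g q₁ 0 - playIntegral T g q₂ 0 := by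
        rw [(hΓ 0 h0T).1]
        refine integral_nonneg_of_ae ?_
        filter_upwards [hmono, ae_restrict_mem measurableSet_Ioi] with r hr hr0
        rw [Pi.zero_apply, sub_nonneg, (h₁ r hr0).initial, (h₂ r hr0).initial]
        exact hr (playInit_mono hq)
      have e1 := (abs_le.mp (hE 0 h0)).2
      have e2 := mul_nonneg (ha 0 h0).1 hpos
      have e3 := (abs_le.mp (abs_playInit_sub_le ρ (q₁ 0) (q₂ 0))).2
      rw [← (h₁ ρ hρ).initial, ← (h₂ ρ hρ).initial, abs_of_nonneg (by linarith)] at e3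
      linarith
  · filter_upwards [IsPlayAC.ae_rise_nested hT.le hρ h₁ h₂, ae_restrict_mem measurableSet_Ioo]
      with τ hτ hm hlt hgt
    by_contra! hd
    obtain ⟨hD, hnest⟩ := hτ hd
    have hτt : τ ∈ Icc 0 t := ⟨hm.1.le, hlt.le.trans hs.2⟩
    have hτT : τ ∈ Icc 0 T := Ioo_subset_Icc_self hm
    set B : ℝ := ∫ r in Ioi ρ, m r * Real.exp (tail N r) with hB
    have hB0 : 0 ≤ B := integral_nonneg fun r => mul_nonneg (hg.lip_nonneg r) (Real.exp_pos _).le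
    have hAB : A * B = Real.exp (tail N ρ) - 1 := by
      rw [← integral_mul_exp_tail hNi hN0 hρ.le, hB, ← integral_const_mul]
      simp only [hN, mul_assoc]
    have hlow : -(k * B) ≤ playIntegral T g q₁ τ - playIntegral T g q₂ τ := by
      obtain ⟨e, hi⟩ := hΓ τ hτT
      rw [e, ← Ioc_union_Ioi_eq_Ioi hρ.le, setIntegral_union Ioc_disjoint_Ioi_same
        measurableSet_Ioi (hi.mono_set Ioc_subset_Ioi_self) (hi.mono_set (Ioi_subset_Ioi hρ.le))]
      have p₁ : 0 ≤ ∫ r in Ioc 0 ρ, (g r (ξ₁ r τ) - g r (ξ₂ r τ)) := by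
        refine integral_nonneg_of_ae ?_
        filter_upwards [ae_restrict_of_ae_restrict_of_subset Ioc_subset_Ioi_self hmono,
          ae_restrict_mem measurableSet_Ioc] with r hr hr0
        have := hnest r hr0.1 hr0.2
        rw [Pi.zero_apply, sub_nonneg]
        exact hr (by linarith)
      have p₂ : |∫ r in Ioi ρ, (g r (ξ₁ r τ) - g r (ξ₂ r τ))| ≤ k * B := by
        rw [hB, ← integral_const_mul, ← Real.norm_eq_abs]
        refine norm_integral_le_of_norm_le
          (((integrableOn_mul_exp_tail hNi hN0 hg.integrable_lip).mono_set
            (Ioi_subset_Ioi hρ.le)).const_mul k) ?_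
        filter_upwards [ae_restrict_of_ae_restrict_of_subset (Ioi_subset_Ioi hρ.le)
          hg.lipschitz, ae_restrict_mem measurableSet_Ioi] with r hr hr0
        refine (hr _ _).trans ?_
        have := hw r (hρ.trans hr0) τ hτt
        have := mul_le_mul_of_nonneg_left this (hg.lip_nonneg r)
        linarith
      have := (abs_le.mp p₂).1
      linarith
    have e1 := (abs_le.mp (hE τ hτt)).2
    have e2 := mul_le_mul_of_nonneg_left hlow (ha τ hτt).1
    have e3 : a τ * (k * B) ≤ A * (k * B) :=
      mul_le_mul_of_nonneg_right (ha τ hτt).2 (mul_nonneg hk0 hB0)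
    have e4 : A * (k * B) = k * (Real.exp (tail N ρ) - 1) := by rw [← hAB]; ring
    linarith

theorem play_abs_sub_le_of_resolvent {g : ℝ → ℝ → ℝ} {m b : ℝ → ℝ} {T t A η k ρ : ℝ}
    {a q₁ q₂ : ℝ → ℝ} {ξ₁ ξ₂ : ℝ → ℝ → ℝ} (hg : IsPreisachDensity g m b)
    (hmono : ∀ᵐ r ∂(volume.restrict (Ioi (0 : ℝ))), Monotone (g r)) (hT : 0 < T) (ht : t ∈ Icc 0 T)
    (h₁ : ∀ r, 0 < r → IsPlayAC T r q₁ (ξ₁ r)) (h₂ : ∀ r, 0 < r → IsPlayAC T r q₂ (ξ₂ r))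
    (hA : 0 ≤ A) (ha : ∀ τ ∈ Icc 0 t, a τ ∈ Icc 0 A) (hη : 0 ≤ η) (hk : η ≤ k)
    (hE : ∀ τ ∈ Icc 0 t,
      |q₁ τ - q₂ τ + a τ * (playIntegral T g q₁ τ - playIntegral T g q₂ τ)| ≤ η)
    (hw : ∀ r, 0 < r → ∀ τ ∈ Icc 0 t,
      |ξ₁ r τ - ξ₂ r τ| ≤ k * Real.exp (tail (fun r => A * m r) r))
    (hρ : 0 < ρ) {s : ℝ} (hs : s ∈ Icc 0 t) :
    |ξ₁ ρ s - ξ₂ ρ s| ≤ η + k * (Real.exp (tail (fun r => A * m r) ρ) - 1) := by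
  have k₁ := play_sub_le_of_resolvent hg hmono hT ht h₁ h₂ hA ha hη hk hE hw hρ hs
  have k₂ := play_sub_le_of_resolvent hg hmono hT ht h₂ h₁ hA ha hη hk
    (fun τ hτ => by rw [← abs_neg]; convert hE τ hτ using 2; ring)
    (fun r hr τ hτ => by rw [abs_sub_comm]; exact hw r hr τ hτ) hρ hs
  rw [abs_le]; constructor <;> linarith

/-- The resolvent estimate for absolutely continuous inputs: the bound by `k exp (tail N)` can be
improved until `k = η`. -/
theorem abs_sub_le_of_resolvent_ac {g : ℝ → ℝ → ℝ} {m b : ℝ → ℝ} {T t A η : ℝ}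
    {a q₁ q₂ : ℝ → ℝ} {ξ₁ ξ₂ : ℝ → ℝ → ℝ} (hg : IsPreisachDensity g m b)
    (hmono : ∀ᵐ r ∂(volume.restrict (Ioi (0 : ℝ))), Monotone (g r)) (hT : 0 < T) (ht : t ∈ Icc 0 T)
    (h₁ : ∀ r, 0 < r → IsPlayAC T r q₁ (ξ₁ r)) (h₂ : ∀ r, 0 < r → IsPlayAC T r q₂ (ξ₂ r))
    (hA : 0 ≤ A) (ha : ∀ τ ∈ Icc 0 t, a τ ∈ Icc 0 A)
    (hE : ∀ τ ∈ Icc 0 t,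
      |q₁ τ - q₂ τ + a τ * (playIntegral T g q₁ τ - playIntegral T g q₂ τ)| ≤ η)
    {s : ℝ} (hs : s ∈ Icc 0 t) :
    |q₁ s - q₂ s| ≤ η * Real.exp (A * ∫ r in Ioi 0, m r) := by
  set N : ℝ → ℝ := fun r => A * m r with hN
  have hN0 : ∀ r, 0 ≤ N r := fun r => mul_nonneg hA (hg.lip_nonneg r)
  have hNi : IntegrableOn N (Ioi 0) := hg.integrable_lip.const_mul A
  have hη : 0 ≤ η := (abs_nonneg _).trans (hE s hs)
  have c₁ := (h₁ 1 one_pos).continuousOn_input hT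
  have c₂ := (h₂ 1 one_pos).continuousOn_input hT
  have hsub : Icc 0 t ⊆ Icc 0 T := Icc_subset_Icc_right ht.2
  -- the least admissible constant `k`
  set S : Set ℝ := {k | η ≤ k ∧ ∀ r, 0 < r → ∀ τ ∈ Icc 0 t,
    |ξ₁ r τ - ξ₂ r τ| ≤ k * Real.exp (tail N r)} with hS
  have hSne : S.Nonempty := by
    obtain ⟨M, hM⟩ := isCompact_Icc.exists_bound_of_continuousOn ((c₁.sub c₂).mono hsub)
    refine ⟨max η M, le_max_left _ _, fun r hr τ hτ => ?_⟩
    have h := (h₁ r hr).abs_sub_le (hsub hτ) (h₂ r hr) (M := M) fun σ hσ =>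
      hM σ ⟨hσ.1, hσ.2.trans hτ.2⟩
    have h0 : 0 ≤ max η M := hη.trans (le_max_left _ _)
    exact (h.trans (le_max_right η M)).trans
      (le_mul_of_one_le_right h0 (Real.one_le_exp (tail_nonneg hN0 r)))
  have hSb : BddBelow S := ⟨η, fun k hk => hk.1⟩
  set k₀ := sInf S with hk₀
  have hk₀S : k₀ ∈ S := by
    refine ⟨le_csInf hSne fun k hk => hk.1, fun r hr τ hτ => ?_⟩
    rw [← div_le_iff₀ (Real.exp_pos _)]
    refine le_csInf hSne fun k hk => ?_
    rw [div_le_iff₀ (Real.exp_pos _)]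
    exact hk.2 r hr τ hτ
  have hk₀η : k₀ = η := by
    refine le_antisymm ?_ hk₀S.1
    by_contra! hlt
    have e0 := Real.exp_pos (-tail N 0)
    -- the gain `k₀ - η` is at least the fraction `(k₀ - η) exp (-tail N 0)` of `exp (tail N r)`
    have hmem : k₀ - (k₀ - η) * Real.exp (-tail N 0) ∈ S := by
      refine ⟨?_, fun r hr τ hτ => ?_⟩
      · have : Real.exp (-tail N 0) ≤ 1 := Real.exp_le_one_iff.mpr (by
          have := tail_nonneg hN0 0; linarith)
        nlinarith
      · refine (play_abs_sub_le_of_resolvent hg hmono hT ht h₁ h₂ hA ha hη hk₀S.1 hE hk₀S.2 hr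
          hτ).trans ?_
        have e1 : Real.exp (-tail N 0) * Real.exp (tail N r) ≤ 1 := by
          rw [← Real.exp_add]
          exact Real.exp_le_one_iff.mpr (by have := tail_le hNi hN0 hr.le; linarith)
        change η + k₀ * (Real.exp (tail N r) - 1) ≤ _
        nlinarith
    have := csInf_le hSb hmem
    nlinarith
  have hwη := hk₀S.2
  rw [hk₀η] at hwη
  have hsT := hsub hs
  have hΓ : |playIntegral T g q₁ s - playIntegral T g q₂ s|
      ≤ ∫ r in Ioi 0, η * (m r * Real.exp (tail N r)) := by
    unfold playIntegral
    rw [← integral_sub (hg.integrableOn hT c₁ hsT) (hg.integrableOn hT c₂ hsT),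
      ← Real.norm_eq_abs]
    refine norm_integral_le_of_norm_le
      ((integrableOn_mul_exp_tail hNi hN0 hg.integrable_lip).const_mul η) ?_
    filter_upwards [hg.lipschitz, ae_restrict_mem measurableSet_Ioi] with r hr hr0
    refine (hr _ _).trans ?_
    rw [(h₁ r hr0).play_eq hT hr0 hsT, (h₂ r hr0).play_eq hT hr0 hsT]
    have := mul_le_mul_of_nonneg_left (hwη r hr0 s hs) (hg.lip_nonneg r)
    linarith
  have hI : A * ∫ r in Ioi 0, η * (m r * Real.exp (tail N r))
      = η * (Real.exp (tail N 0) - 1) := by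
    rw [← integral_mul_exp_tail hNi hN0 le_rfl, ← integral_const_mul, ← integral_const_mul]
    refine integral_congr_ae (Eventually.of_forall fun r => ?_)
    simp only [hN]; ring
  have ht0 : tail N 0 = A * ∫ r in Ioi 0, m r := integral_const_mul _ _
  rw [← ht0]
  have e1 : |a s * (playIntegral T g q₁ s - playIntegral T g q₂ s)|
      ≤ η * (Real.exp (tail N 0) - 1) := by
    rw [abs_mul, abs_of_nonneg (ha s hs).1, ← hI]
    exact mul_le_mul (ha s hs).2 hΓ (abs_nonneg _) hA
  have e2 := abs_le.mp (hE s hs)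
  have e3 := abs_le.mp e1
  rw [abs_le]; constructor <;> linarith

/-- The resolvent estimate: if `q₁ - q₂ + a (P[q₁] - P[q₂])` is bounded by `η` on `[0,t]`, where
the function `a` has values in `[0,A]` and may vary arbitrarily, then `q₁ - q₂` is bounded by
a multiple of `η` that depends only on `A` and on the density of `P`. -/
theorem abs_sub_le_of_resolvent {g : ℝ → ℝ → ℝ} {m b : ℝ → ℝ} {T t A η : ℝ}
    {a q₁ q₂ : ℝ → ℝ} (hg : IsPreisachDensity g m b)
    (hmono : ∀ᵐ r ∂(volume.restrict (Ioi (0 : ℝ))), Monotone (g r)) (hT : 0 < T) (ht : t ∈ Icc 0 T)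
    (hq₁ : ContinuousOn q₁ (Icc 0 T)) (hq₂ : ContinuousOn q₂ (Icc 0 T))
    (hA : 0 ≤ A) (ha : ∀ τ ∈ Icc 0 t, a τ ∈ Icc 0 A)
    (hE : ∀ τ ∈ Icc 0 t,
      |q₁ τ - q₂ τ + a τ * (playIntegral T g q₁ τ - playIntegral T g q₂ τ)| ≤ η)
    {s : ℝ} (hs : s ∈ Icc 0 t) :
    |q₁ s - q₂ s| ≤ η * Real.exp (A * ∫ r in Ioi 0, m r) := by
  have hm0 : 0 ≤ ∫ r in Ioi 0, m r := integral_nonneg hg.lip_nonneg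
  have hsub : Icc 0 t ⊆ Icc 0 T := Icc_subset_Icc_right ht.2
  set L := ∫ r in Ioi 0, m r
  -- `C δ` is the total error of replacing both inputs by `δ`-close piecewise monotone ones
  set C := 2 + (2 + 2 * A * L) * Real.exp (A * L) with hC
  have hC0 : 0 < C := by positivity
  refine le_of_forall_pos_le_add fun ε hε => ?_
  obtain ⟨p₁, hp₁, l₁⟩ := exists_piecewiseMonotone_approx hT hq₁
  obtain ⟨p₂, hp₂, l₂⟩ := exists_piecewiseMonotone_approx hT hq₂
  rw [Metric.tendstoUniformlyOn_iff] at l₁ l₂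
  set δ := ε / C with hδ
  have hδ0 : 0 < δ := by positivity
  obtain ⟨n, n₁, n₂⟩ := ((l₁ δ hδ0).and (l₂ δ hδ0)).exists
  have d₁ : ∀ τ ∈ Icc 0 t, |q₁ τ - p₁ n τ| ≤ δ := fun τ hτ => (n₁ τ (hsub hτ)).le
  have d₂ : ∀ τ ∈ Icc 0 t, |q₂ τ - p₂ n τ| ≤ δ := fun τ hτ => (n₂ τ (hsub hτ)).le
  have hch : ∀ (p : ℝ → ℝ), PiecewiseMonotone p 0 T → ∀ r, ∃ ξ, 0 < r → IsPlayAC T r p ξ := by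
    intro p hp r
    by_cases hr : 0 < r
    · obtain ⟨ξ, hξ⟩ := hp.exists_isPlayAC hr
      exact ⟨ξ, fun _ => hξ⟩
    · exact ⟨0, fun h => absurd h hr⟩
  choose ξ₁ k₁ using hch _ (hp₁ n)
  choose ξ₂ k₂ using hch _ (hp₂ n)
  have key := abs_sub_le_of_resolvent_ac (η := η + 2 * δ + A * (2 * (L * δ))) hg hmono hT ht k₁ k₂
    hA ha (fun τ hτ => ?_) hs
  · have e₁ := abs_le.mp (d₁ s hs)
    have e₂ := abs_le.mp (d₂ s hs)
    have e₃ := abs_le.mp key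
    have e₄ : (η + 2 * δ + A * (2 * (L * δ))) * Real.exp (A * L) + 2 * δ
        = η * Real.exp (A * L) + ε := by
      have : δ * C = ε := by rw [hδ]; field_simp
      rw [← this, hC]; ring
    rw [abs_le]; constructor <;> linarith
  · have hτT := hsub hτ
    have e₁ := d₁ τ hτ
    have e₂ := d₂ τ hτ
    have f₁ := hg.abs_playIntegral_sub_le hT hq₁ (hp₁ n).continuousOn hτT
      (fun σ hσ => d₁ σ ⟨hσ.1, hσ.2.trans hτ.2⟩)
    have f₂ := hg.abs_playIntegral_sub_le hT hq₂ (hp₂ n).continuousOn hτT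
      (fun σ hσ => d₂ σ ⟨hσ.1, hσ.2.trans hτ.2⟩)
    have e₃ := hE τ hτ
    have f₃ : |a τ * ((playIntegral T g (p₁ n) τ - playIntegral T g (p₂ n) τ)
        - (playIntegral T g q₁ τ - playIntegral T g q₂ τ))| ≤ A * (2 * (L * δ)) := by
      rw [abs_mul, abs_of_nonneg (ha τ hτ).1]
      refine mul_le_mul (ha τ hτ).2 ?_ (abs_nonneg _) hA
      rw [abs_le] at f₁ f₂ ⊢; constructor <;> linarith
    rw [abs_le] at e₁ e₂ e₃ f₃ ⊢
    constructor <;> nlinarith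

/-! ### The inverse Preisach operator -/

/-- Continuity method: a Lipschitz perturbation `x ↦ x + B x` of the identity on a Banach space is
surjective if all `x ↦ x + θ B x`, `θ ∈ [0,1]`, are expanding with the same constant. -/
theorem surjective_id_add_of_expanding {E : Type*} [NormedAddCommGroup E] [NormedSpace ℝ E]
    [CompleteSpace E] {B : E → E} {K C : ℝ} (hK : 0 ≤ K) (hC : 0 ≤ C)
    (hB : ∀ x y, ‖B x - B y‖ ≤ K * ‖x - y‖)
    (hexp : ∀ θ ∈ Icc (0 : ℝ) 1, ∀ x y, ‖x - y‖ ≤ C * ‖(x + θ • B x) - (y + θ • B y)‖) (z : E) :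
    ∃ x, x + B x = z := by
  obtain ⟨n, hn⟩ := exists_nat_gt (K * C)
  have hn0 : (0 : ℝ) < n := (mul_nonneg hK hC).trans_lt hn
  have step : ∀ i : ℕ, i ≤ n → ∀ z, ∃ x, x + ((i : ℝ) / n) • B x = z := by
    intro i
    induction i with
    | zero => intro _ z; exact ⟨z, by simp⟩
    | succ i ih =>
      intro hi z
      choose S hS using ih (Nat.le_of_succ_le hi)
      have hi1 : (i : ℝ) / n ∈ Icc (0 : ℝ) 1 := by
        refine ⟨by positivity, ?_⟩
        rw [div_le_one hn0]; exact_mod_cast Nat.le_of_succ_le hi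
      set F : E → E := fun x => S (z - (1 / (n : ℝ)) • B x) with hF
      have hlip : ∀ x y, dist (F x) (F y) ≤ (K * C / n) * dist x y := by
        intro x y
        rw [dist_eq_norm, dist_eq_norm]
        refine (hexp _ hi1 (F x) (F y)).trans ?_
        rw [hF, hS, hS, sub_sub_sub_cancel_left, ← smul_sub, norm_smul, Real.norm_of_nonneg
          (by positivity), norm_sub_rev]
        have := mul_le_mul_of_nonneg_left (hB x y) hC
        calc C * (1 / n * ‖B x - B y‖) = (C * ‖B x - B y‖) / n := by ring
          _ ≤ (C * (K * ‖x - y‖)) / n := by gcongr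
          _ = K * C / n * ‖x - y‖ := by ring
      have hnn : 0 ≤ K * C / n := by positivity
      have hct : ContractingWith (K * C / n).toNNReal F := by
        refine ⟨?_, LipschitzWith.of_dist_le_mul fun x y => ?_⟩
        · rw [Real.toNNReal_lt_one, div_lt_one hn0]; exact hn
        · rw [Real.coe_toNNReal _ hnn]; exact hlip x y
      refine ⟨hct.fixedPoint F, ?_⟩
      have hfix : F (hct.fixedPoint F) = hct.fixedPoint F := hct.fixedPoint_isFixedPt
      set x := hct.fixedPoint F
      have h := hS (z - (1 / (n : ℝ)) • B x)
      change F x + ((i : ℝ) / n) • B (F x) = _ at h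
      rw [hfix] at h
      have : ((i + 1 : ℕ) : ℝ) / n = (i : ℝ) / n + 1 / n := by push_cast; ring
      rw [this, add_smul, ← add_assoc, h, sub_add_cancel]
  obtain ⟨x, hx⟩ := step n le_rfl z
  exact ⟨x, by rwa [div_self hn0.ne', one_smul] at hx⟩

theorem abs_sub_le_of_lipschitzWith {k : ℝ → ℝ} {K : NNReal} (hk : LipschitzWith K k) (x y : ℝ) :
    |k x - k y| ≤ K * |x - y| := by
  have := hk.dist_le_mul x y
  rwa [Real.dist_eq, Real.dist_eq] at this

/-- Since `ε / f ε` is Lipschitz continuous and vanishes at `0`, the function `1 / f` is bounded. -/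
theorem ConstitutiveHypothesis.inv_bounded {f : ℝ → ℝ} (hf : ConstitutiveHypothesis f) :
    ∃ C : ℝ, 0 ≤ C ∧ ∀ ε, 1 / f ε ≤ C := by
  obtain ⟨K, hK⟩ := hf.div_lipschitz
  refine ⟨max K (1 / f 0), K.2.trans (le_max_left _ _), fun ε => ?_⟩
  rcases eq_or_ne ε 0 with rfl | hε
  · exact le_max_right _ _
  · refine le_trans ?_ (le_max_left _ _)
    have := abs_sub_le_of_lipschitzWith hK ε 0
    rw [zero_div, sub_zero, sub_zero, abs_div, abs_of_pos (hf.pos ε), div_eq_mul_one_div,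
      mul_comm] at this
    exact le_of_mul_le_mul_right this (abs_pos.mpr hε)

theorem continuous_IccExtend {T : ℝ} (hT : 0 < T) (y : C(Icc (0 : ℝ) T, ℝ)) :
    Continuous (IccExtend hT.le y) := y.continuous.Icc_extend'

section Inverse

variable {T κ e : ℝ} {g : ℝ → ℝ → ℝ} {f r : ℝ → ℝ}

theorem ConstitutiveHypothesis.coeff_mem {C : ℝ} (hf : ConstitutiveHypothesis f)
    (hC : ∀ ε, 1 / f ε ≤ C) (hκ : 0 < κ) (x : ℝ) : 1 / (κ * f x) ∈ Icc 0 (C / κ) := by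
  have := hf.pos x
  refine ⟨by positivity, ?_⟩
  rw [mul_comm, ← div_div]
  gcongr
  exact hC x

/-- Solvability by the continuity method; the maps `q ↦ q + θ a P[q]` are expanding by the resolvent
estimate. -/
theorem exists_isInverseState (hT : 0 < T) (hκ : 0 < κ) (hg : PreisachHypothesis g)
    (hf : ConstitutiveHypothesis f) (hr : ContinuousOn r (Icc 0 T)) {ε : ℝ → ℝ}
    (hε : ContinuousOn ε (Icc 0 T)) : ∃ q, IsInverseState T g f κ e r ε q := by
  obtain ⟨m, b, hd⟩ := hg.exists_isPreisachDensity
  obtain ⟨C, hC0, hC⟩ := hf.inv_bounded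
  have ha := fun t => hf.coeff_mem hC hκ (ε t)
  set a : ℝ → ℝ := fun t => 1 / (κ * f (ε t)) with hadef
  set A := C / κ with hA
  have hA0 : 0 ≤ A := by positivity
  have hac : ContinuousOn a (Icc 0 T) :=
    continuousOn_const.div (continuousOn_const.mul (hf.differentiable.continuous.comp_continuousOn
      hε)) fun t _ => (mul_pos hκ (hf.pos _)).ne'
  set L := ∫ r in Ioi 0, m r
  have hL0 : 0 ≤ L := integral_nonneg hd.lip_nonneg
  let B : C(Icc (0 : ℝ) T, ℝ) → C(Icc (0 : ℝ) T, ℝ) := fun y =>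
    ⟨fun t => a t * playIntegral T g (IccExtend hT.le y) t, (hac.mul
      (hd.continuousOn_playIntegral hT (continuous_IccExtend hT y).continuousOn)).domRestrict⟩
  let z : C(Icc (0 : ℝ) T, ℝ) := ⟨fun t => a t * (r t - e * ε t),
    (hac.mul (hr.sub (continuousOn_const.mul hε))).domRestrict⟩
  have hpt : ∀ (x : C(Icc (0 : ℝ) T, ℝ)) (τ : ℝ) (hτ : τ ∈ Icc 0 T),
      IccExtend hT.le x τ = x ⟨τ, hτ⟩ := fun x τ hτ => IccExtend_of_mem hT.le x hτ
  have hsurj : ∃ x, x + B x = z := by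
    refine surjective_id_add_of_expanding (K := A * L) (C := Real.exp (A * L)) (by positivity)
      (by positivity) (fun x y => ?_) (fun θ hθ x y => ?_) z
    · rw [ContinuousMap.norm_le _ (by positivity)]
      intro t
      change |a t * _ - a t * _| ≤ _
      rw [← mul_sub, abs_mul, abs_of_nonneg (ha t).1, mul_assoc]
      refine mul_le_mul (ha t).2 ?_ (abs_nonneg _) hA0
      refine hd.abs_playIntegral_sub_le hT (continuous_IccExtend hT x).continuousOn
        (continuous_IccExtend hT y).continuousOn t.2 fun τ hτ => ?_
      have hτ' : τ ∈ Icc 0 T := ⟨hτ.1, hτ.2.trans t.2.2⟩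
      rw [hpt x τ hτ', hpt y τ hτ']
      exact (x - y).norm_coe_le_norm ⟨τ, hτ'⟩
    · rw [ContinuousMap.norm_le _ (by positivity)]
      intro t
      set w := x + θ • B x - (y + θ • B y) with hw
      have := abs_sub_le_of_resolvent (a := fun τ => θ * a τ) (A := A) (η := ‖w‖) hd hg.ae_monotone
        hT ⟨hT.le, le_rfl⟩ (continuous_IccExtend hT x).continuousOn
        (continuous_IccExtend hT y).continuousOn hA0
        (fun τ _ => ⟨mul_nonneg hθ.1 (ha τ).1,
          (mul_le_of_le_one_left (ha τ).1 hθ.2).trans (ha τ).2⟩)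
        (fun τ hτ => ?_) t.2
      · rw [hpt x t t.2, hpt y t t.2, mul_comm] at this
        exact this
      · refine le_trans (le_of_eq ?_) (w.norm_coe_le_norm ⟨τ, hτ⟩)
        rw [hpt x τ hτ, hpt y τ hτ, Real.norm_eq_abs]
        congr 1
        change _ = (x ⟨τ, hτ⟩ + θ * (a τ * _)) - (y ⟨τ, hτ⟩ + θ * (a τ * _))
        ring
  obtain ⟨x, hx⟩ := hsurj
  refine ⟨IccExtend hT.le x, (continuous_IccExtend hT x).continuousOn, fun t ht => ?_⟩
  have := congrArg (fun y : C(Icc (0 : ℝ) T, ℝ) => y ⟨t, ht⟩) hx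
  rw [hpt x t ht]
  exact this

theorem isInverseState_inverseState (hT : 0 < T) (hκ : 0 < κ) (hg : PreisachHypothesis g)
    (hf : ConstitutiveHypothesis f) (hr : ContinuousOn r (Icc 0 T)) {ε : ℝ → ℝ}
    (hε : ContinuousOn ε (Icc 0 T)) :
    IsInverseState T g f κ e r ε (inverseState T g f κ e r ε) :=
  Classical.epsilon_spec (exists_isInverseState hT hκ hg hf hr hε)

/-- The inverse Preisach operator is causal and Lipschitz continuous in the maximum norm. -/
theorem exists_lipschitz_inverseState (hT : 0 < T) (hκ : 0 < κ) (hg : PreisachHypothesis g)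
    (hf : ConstitutiveHypothesis f) (hr : ContinuousOn r (Icc 0 T)) :
    ∃ L : ℝ, 0 ≤ L ∧ ∀ ε₁ ε₂ : ℝ → ℝ, ContinuousOn ε₁ (Icc 0 T) → ContinuousOn ε₂ (Icc 0 T) →
      ∀ t ∈ Icc 0 T, ∀ M : ℝ, (∀ τ ∈ Icc 0 t, |ε₁ τ - ε₂ τ| ≤ M) →
      ∀ τ ∈ Icc 0 t, |inverseState T g f κ e r ε₁ τ - inverseState T g f κ e r ε₂ τ| ≤ L * M := by
  obtain ⟨m, b, hd⟩ := hg.exists_isPreisachDensity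
  obtain ⟨C, hC0, hC⟩ := hf.inv_bounded
  obtain ⟨K₁, hK₁⟩ := hf.inv_lipschitz
  obtain ⟨K₂, hK₂⟩ := hf.div_lipschitz
  obtain ⟨R, hR⟩ := isCompact_Icc.exists_bound_of_continuousOn hr
  have hR0 : 0 ≤ R := (norm_nonneg _).trans (hR 0 ⟨le_rfl, hT.le⟩)
  set β := ∫ r in Ioi 0, b r
  have hβ : 0 ≤ β := (abs_nonneg _).trans (hd.abs_playIntegral_le (T := T) (t := 0) (q := 0))
  refine ⟨1 / κ * (R * K₁ + |e| * K₂ + K₁ * β) * Real.exp (C / κ * ∫ r in Ioi 0, m r),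
    by positivity, fun ε₁ ε₂ h₁ h₂ t ht M hM τ hτ => ?_⟩
  obtain ⟨c₁, e₁⟩ := isInverseState_inverseState (e := e) hT hκ hg hf hr h₁
  obtain ⟨c₂, e₂⟩ := isInverseState_inverseState (e := e) hT hκ hg hf hr h₂
  set q₁ := inverseState T g f κ e r ε₁
  set q₂ := inverseState T g f κ e r ε₂
  rw [mul_right_comm]
  refine abs_sub_le_of_resolvent (a := fun τ => 1 / (κ * f (ε₁ τ))) hd hg.ae_monotone hT ht c₁ c₂
    (by positivity) (fun τ _ => hf.coeff_mem hC hκ (ε₁ τ)) (fun σ hσ => ?_) hτ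
  have hσT : σ ∈ Icc 0 T := ⟨hσ.1, hσ.2.trans ht.2⟩
  have E₁ := e₁ σ hσT
  have E₂ := e₂ σ hσT
  change q₁ σ + _ * playIntegral T g q₁ σ = _ at E₁
  change q₂ σ + _ * playIntegral T g q₂ σ = _ at E₂
  set P₁ := playIntegral T g q₁ σ
  set P₂ := playIntegral T g q₂ σ with hP₂
  have hPb : |P₂| ≤ β := hd.abs_playIntegral_le
  have k₁ := abs_sub_le_of_lipschitzWith hK₁ (ε₁ σ) (ε₂ σ)
  have k₂ := abs_sub_le_of_lipschitzWith hK₂ (ε₁ σ) (ε₂ σ)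
  have hM' := hM σ hσ
  have hsplit : ∀ x, 1 / (κ * f x) = 1 / κ * (1 / f x) := fun x => by rw [one_div_mul_one_div]
  have hid : q₁ σ - q₂ σ + 1 / (κ * f (ε₁ σ)) * (P₁ - P₂)
      = 1 / κ * (r σ * (1 / f (ε₁ σ) - 1 / f (ε₂ σ))
        - e * (ε₁ σ / f (ε₁ σ) - ε₂ σ / f (ε₂ σ))
        - (1 / f (ε₁ σ) - 1 / f (ε₂ σ)) * P₂) := by
    rw [hsplit] at E₁ E₂ ⊢
    rw [div_eq_mul_one_div (ε₁ σ), div_eq_mul_one_div (ε₂ σ)]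
    linear_combination E₁ - E₂
  rw [hid, abs_mul, abs_of_pos (by positivity), mul_assoc]
  refine mul_le_mul_of_nonneg_left ?_ (by positivity)
  have m₁ : |1 / f (ε₁ σ) - 1 / f (ε₂ σ)| ≤ K₁ * M := k₁.trans (by gcongr)
  have m₂ : |ε₁ σ / f (ε₁ σ) - ε₂ σ / f (ε₂ σ)| ≤ K₂ * M := k₂.trans (by gcongr)
  refine (abs_sub _ _).trans ?_
  refine (add_le_add_left (abs_sub _ _) _).trans ?_
  rw [abs_mul, abs_mul, abs_mul]
  have n₁ := mul_le_mul (hR σ hσT) m₁ (abs_nonneg _) hR0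
  have n₂ := mul_le_mul_of_nonneg_left m₂ (abs_nonneg e)
  have n₃ := mul_le_mul m₁ hPb (abs_nonneg _) ((abs_nonneg _).trans m₁)
  rw [Real.norm_eq_abs] at n₁
  linarith

/-- The hysteresis operator `W` is causal and Lipschitz continuous in the maximum norm. -/
theorem exists_lipschitz_W (hT : 0 < T) (hκ : 0 < κ) (hg : PreisachHypothesis g)
    (hf : ConstitutiveHypothesis f) (hr : ContinuousOn r (Icc 0 T)) :
    ∃ L : ℝ, 0 ≤ L ∧ ∀ ε₁ ε₂ : ℝ → ℝ, ContinuousOn ε₁ (Icc 0 T) → ContinuousOn ε₂ (Icc 0 T) →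
      ∀ t ∈ Icc 0 T, ∀ M : ℝ, (∀ τ ∈ Icc 0 t, |ε₁ τ - ε₂ τ| ≤ M) →
      |W T g f κ e r ε₁ t - W T g f κ e r ε₂ t| ≤ L * M := by
  obtain ⟨m, b, hd⟩ := hg.exists_isPreisachDensity
  obtain ⟨m', b', hd'⟩ := hg.exists_isPreisachDensity_potential
  obtain ⟨Q, hQ0, hQ⟩ := exists_lipschitz_inverseState (e := e) hT hκ hg hf hr
  obtain ⟨D, hD⟩ := hf.deriv_bounded
  obtain ⟨K, hK⟩ := hf.deriv_lipschitz
  have hD0 : 0 ≤ D := (abs_nonneg _).trans (hD 0)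
  have hL : 0 ≤ ∫ r in Ioi 0, m r := integral_nonneg hd.lip_nonneg
  have hL' : 0 ≤ ∫ r in Ioi 0, m' r := integral_nonneg hd'.lip_nonneg
  set L := ∫ r in Ioi 0, m r
  set L' := ∫ r in Ioi 0, m' r
  set β := ∫ r in Ioi 0, b' r
  have hβ : 0 ≤ β := (abs_nonneg _).trans (hd'.abs_playIntegral_le (T := T) (t := 0) (q := 0))
  refine ⟨|e / κ| * (|e| + L * Q) + D * (L' * Q) + K * β, by positivity,
    fun ε₁ ε₂ h₁ h₂ t ht M hM => ?_⟩
  have htt : t ∈ Icc 0 t := ⟨ht.1, le_rfl⟩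
  have hq := hQ ε₁ ε₂ h₁ h₂ t ht M hM
  have c₁ := (isInverseState_inverseState (e := e) hT hκ hg hf hr h₁).1
  have c₂ := (isInverseState_inverseState (e := e) hT hκ hg hf hr h₂).1
  unfold W
  change |-(e / κ) * (r t - e * ε₁ t - playIntegral T g _ t)
      + deriv f (ε₁ t) * playIntegral T (potentialDensity g) _ t
      - (-(e / κ) * (r t - e * ε₂ t - playIntegral T g _ t)
      + deriv f (ε₂ t) * playIntegral T (potentialDensity g) _ t)| ≤ _
  set q₁ := inverseState T g f κ e r ε₁
  set q₂ := inverseState T g f κ e r ε₂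
  have p₁ := hd.abs_playIntegral_sub_le hT c₁ c₂ ht hq
  have p₂ := hd'.abs_playIntegral_sub_le hT c₁ c₂ ht hq
  have p₃ : |playIntegral T (potentialDensity g) q₂ t| ≤ β := hd'.abs_playIntegral_le
  have p₄ := (abs_sub_le_of_lipschitzWith hK (ε₁ t) (ε₂ t)).trans
    (mul_le_mul_of_nonneg_left (hM t htt) K.2)
  set P₁ := playIntegral T g q₁ t
  set P₂ := playIntegral T g q₂ t
  set U₁ := playIntegral T (potentialDensity g) q₁ t
  set U₂ := playIntegral T (potentialDensity g) q₂ t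
  have hid : -(e / κ) * (r t - e * ε₁ t - P₁) + deriv f (ε₁ t) * U₁
      - (-(e / κ) * (r t - e * ε₂ t - P₂) + deriv f (ε₂ t) * U₂)
      = e / κ * (e * (ε₁ t - ε₂ t) + (P₁ - P₂)) + deriv f (ε₁ t) * (U₁ - U₂)
        + (deriv f (ε₁ t) - deriv f (ε₂ t)) * U₂ := by ring
  rw [hid]
  have n₀ : |e * (ε₁ t - ε₂ t) + (P₁ - P₂)| ≤ |e| * M + L * (Q * M) := by
    refine (abs_add_le _ _).trans (add_le_add ?_ p₁)
    rw [abs_mul]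
    exact mul_le_mul_of_nonneg_left (hM t htt) (abs_nonneg e)
  have n₁ := mul_le_mul_of_nonneg_left n₀ (abs_nonneg (e / κ))
  have n₂ := mul_le_mul (hD (ε₁ t)) p₂ (abs_nonneg _) hD0
  have n₃ := mul_le_mul p₄ p₃ (abs_nonneg _) ((abs_nonneg _).trans p₄)
  refine (abs_add_three _ _ _).trans ?_
  rw [abs_mul, abs_mul, abs_mul]
  linarith

theorem continuousOn_W (hT : 0 < T) (hκ : 0 < κ) (hg : PreisachHypothesis g)
    (hf : ConstitutiveHypothesis f) (hr : ContinuousOn r (Icc 0 T)) {ε : ℝ → ℝ}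
    (hε : ContinuousOn ε (Icc 0 T)) : ContinuousOn (W T g f κ e r ε) (Icc 0 T) := by
  obtain ⟨m, b, hd⟩ := hg.exists_isPreisachDensity
  obtain ⟨m', b', hd'⟩ := hg.exists_isPreisachDensity_potential
  obtain ⟨K, hK⟩ := hf.deriv_lipschitz
  have c := (isInverseState_inverseState (e := e) hT hκ hg hf hr hε).1
  exact (continuousOn_const.mul ((hr.sub (continuousOn_const.mul hε)).sub
    (hd.continuousOn_playIntegral hT c))).add
    ((hK.continuous.comp_continuousOn hε).mul (hd'.continuousOn_playIntegral hT c))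

/-- The operator `W` on the Banach space `C[0,T]`. -/
def WMap (hT : 0 < T) (hκ : 0 < κ) (hg : PreisachHypothesis g) (hf : ConstitutiveHypothesis f)
    (hr : ContinuousOn r (Icc 0 T)) (e : ℝ) (y : C(Icc (0 : ℝ) T, ℝ)) : C(Icc (0 : ℝ) T, ℝ) :=
  ⟨fun t => W T g f κ e r (IccExtend hT.le y) t,
    (continuousOn_W hT hκ hg hf hr (continuous_IccExtend hT y).continuousOn).domRestrict⟩

end Inverse

/-! ### Primitives of square integrable functions with values in a Hilbert space -/

section Prim

set_option linter.unusedSectionVars false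

variable {E : Type*} [NormedAddCommGroup E] [InnerProductSpace ℝ E] [CompleteSpace E] {T t : ℝ}

theorem intervalIntegrable_of_memLp {f : ℝ → E} (hf : MemLp f 2 (volume.restrict (Ioo 0 T)))
    (ht : t ∈ Icc 0 T) : IntervalIntegrable f volume 0 t := by
  have h : IntegrableOn f (Ioo 0 T) := hf.integrable (by norm_num)
  rw [intervalIntegrable_iff_integrableOn_Ioc_of_le ht.1]
  have h2 : IntegrableOn f (Ioc 0 T) := by rwa [integrableOn_Ioc_iff_integrableOn_Ioo]
  exact h2.mono_set (Ioc_subset_Ioc_right ht.2)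

theorem intervalIntegrable_norm_sq_of_memLp {f : ℝ → E}
    (hf : MemLp f 2 (volume.restrict (Ioo 0 T))) (ht : t ∈ Icc 0 T) :
    IntervalIntegrable (fun τ => ‖f τ‖ ^ 2) volume 0 t := by
  have h : IntegrableOn (fun τ => ‖f τ‖ ^ 2) (Ioo 0 T) := by
    have := hf.integrable_norm_pow (p := 2) (by norm_num)
    exact this
  rw [intervalIntegrable_iff_integrableOn_Ioc_of_le ht.1]
  have h2 : IntegrableOn (fun τ => ‖f τ‖ ^ 2) (Ioc 0 T) := by
    rwa [integrableOn_Ioc_iff_integrableOn_Ioo]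
  exact h2.mono_set (Ioc_subset_Ioc_right ht.2)

theorem ae_Ioc_of_ae_Ioo {p : ℝ → Prop} (h : ∀ᵐ τ ∂(volume.restrict (Ioo (0 : ℝ) T)), p τ)
    (ht : t ∈ Icc 0 T) : ∀ᵐ τ, τ ∈ uIoc 0 t → p τ := by
  rw [uIoc_of_le ht.1, ← ae_restrict_iff' measurableSet_Ioc]
  exact ae_H ht.2 h

theorem intervalIntegral_congr_of_ae_Ioo {F : Type*} [NormedAddCommGroup F] [NormedSpace ℝ F]
    {f g : ℝ → F} (h : f =ᵐ[volume.restrict (Ioo (0 : ℝ) T)] g) (ht : t ∈ Icc 0 T) :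
    ∫ τ in (0 : ℝ)..t, f τ = ∫ τ in (0 : ℝ)..t, g τ :=
  intervalIntegral.integral_congr_ae (ae_Ioc_of_ae_Ioo h ht)

/-- The Cauchy–Schwarz inequality on an interval. -/
theorem sq_intervalIntegral_le {h : ℝ → ℝ} (ht : 0 ≤ t) (h₁ : IntervalIntegrable h volume 0 t)
    (h₂ : IntervalIntegrable (fun τ => h τ ^ 2) volume 0 t) :
    (∫ τ in (0 : ℝ)..t, h τ) ^ 2 ≤ t * ∫ τ in (0 : ℝ)..t, h τ ^ 2 := by
  rcases ht.eq_or_lt with rfl | ht0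
  · simp
  set I := ∫ τ in (0 : ℝ)..t, h τ with hI
  have hpos : 0 ≤ ∫ τ in (0 : ℝ)..t, (h τ - I / t) ^ 2 :=
    intervalIntegral.integral_nonneg ht fun τ _ => sq_nonneg _
  have he : ∫ τ in (0 : ℝ)..t, (h τ - I / t) ^ 2
      = (∫ τ in (0 : ℝ)..t, h τ ^ 2) - 2 * (I / t) * I + t * (I / t) ^ 2 := by
    have : ∀ τ, (h τ - I / t) ^ 2 = h τ ^ 2 - 2 * (I / t) * h τ + (I / t) ^ 2 := fun τ => by ring
    simp only [this]
    rw [intervalIntegral.integral_add (h₂.sub (h₁.const_mul _)) intervalIntegrable_const,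
      intervalIntegral.integral_sub h₂ (h₁.const_mul _), intervalIntegral.integral_const_mul,
      intervalIntegral.integral_const, ← hI]
    simp
  rw [he] at hpos
  have : t * ((∫ τ in (0 : ℝ)..t, h τ ^ 2) - 2 * (I / t) * I + t * (I / t) ^ 2)
      = t * (∫ τ in (0 : ℝ)..t, h τ ^ 2) - I ^ 2 := by field_simp; ring
  nlinarith [mul_nonneg ht hpos]

theorem continuousOn_primitive {f : ℝ → E} (hf : IntervalIntegrable f volume 0 T) (hT : 0 ≤ T) :
    ContinuousOn (fun t => ∫ τ in (0 : ℝ)..t, f τ) (Icc 0 T) := by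
  have := intervalIntegral.continuousOn_primitive_interval' hf (a := 0) (by simp)
  rwa [uIcc_of_le hT] at this

/-- The square of the norm of a primitive is the integral of twice the inner product with the
integrand. -/
theorem norm_sq_primitive {f : ℝ → E} (ht : 0 ≤ t) (hf : IntervalIntegrable f volume 0 t) (a : E) :
    ‖a + ∫ τ in (0 : ℝ)..t, f τ‖ ^ 2
      = ‖a‖ ^ 2 + 2 * ∫ s in (0 : ℝ)..t, inner ℝ (a + ∫ τ in (0 : ℝ)..s, f τ) (f s) := by
  set F : ℝ → E := fun s => a + ∫ τ in (0 : ℝ)..s, f τ with hF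
  have hFc : ContinuousOn F (Icc 0 t) := continuousOn_const.add (continuousOn_primitive hf ht)
  obtain ⟨C, hC⟩ := isCompact_Icc.exists_bound_of_continuousOn hFc
  have hn : IntervalIntegrable (fun τ => ‖f τ‖) volume 0 t := hf.norm
  have hΦ := hn.absolutelyContinuousOnInterval_intervalIntegral (c := 0) (by simp)
  have hsub : ∀ x ∈ uIcc 0 t, IntervalIntegrable f volume 0 x := fun x hx =>
    hf.mono_set (by
      rw [uIcc_of_le ht] at hx ⊢; rw [uIcc_of_le hx.1]; exact Icc_subset_Icc_right hx.2)
  have hac : AbsolutelyContinuousOnInterval (fun s => ‖F s‖ ^ 2) 0 t := by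
    refine ac_of_dist_le hΦ (2 * C) fun x hx y hy => ?_
    have hx' := hx
    have hy' := hy
    rw [uIcc_of_le ht] at hx' hy'
    have e1 : ‖F x - F y‖ ≤ dist (∫ τ in (0 : ℝ)..x, ‖f τ‖) (∫ τ in (0 : ℝ)..y, ‖f τ‖) := by
      rw [Real.dist_eq, intervalIntegral.integral_interval_sub_left (hsub x hx).norm
        (hsub y hy).norm, hF]
      simp only [add_sub_add_left_eq_sub]
      rw [intervalIntegral.integral_interval_sub_left (hsub x hx) (hsub y hy)]
      exact intervalIntegral.norm_integral_le_abs_integral_norm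
    rw [Real.dist_eq]
    have e2 : ‖F x‖ ^ 2 - ‖F y‖ ^ 2 = (‖F x‖ - ‖F y‖) * (‖F x‖ + ‖F y‖) := by ring
    rw [e2, abs_mul, mul_comm]
    refine mul_le_mul ?_ ((abs_norm_sub_norm_le _ _).trans e1) (abs_nonneg _) ?_
    · rw [abs_of_nonneg (by positivity)]; linarith [hC x hx', hC y hy']
    · have := (norm_nonneg _).trans (hC x hx'); linarith
  have hd := hac.integral_deriv_eq_sub
  have h0 : ‖F 0‖ ^ 2 = ‖a‖ ^ 2 := by simp [hF]
  have he : ∫ s in (0 : ℝ)..t, deriv (fun s => ‖F s‖ ^ 2) s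
      = ∫ s in (0 : ℝ)..t, 2 * inner ℝ (F s) (f s) := by
    refine intervalIntegral.integral_congr_ae ?_
    filter_upwards [hf.ae_hasDerivAt_integral] with x hx hm
    exact (((hx (uIoc_subset_uIcc hm) 0 (by simp)).const_add a).norm_sq).deriv
  rw [intervalIntegral.integral_const_mul] at he
  change ‖F t‖ ^ 2 = _
  rw [← he, hd, h0]; ring

theorem norm_sq_Lp {μ : Measure ℝ} (f : Lp E 2 μ) : ‖f‖ ^ 2 = ∫ τ, ‖f τ‖ ^ 2 ∂μ := by
  rw [← real_inner_self_eq_norm_sq, L2.inner_def]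
  simp only [real_inner_self_eq_norm_sq]

theorem integral_Ioo_eq_intervalIntegral {F : Type*} [NormedAddCommGroup F] [NormedSpace ℝ F]
    (hT : 0 ≤ T) (f : ℝ → F) : ∫ τ in Ioo 0 T, f τ = ∫ τ in (0 : ℝ)..T, f τ := by
  rw [intervalIntegral.integral_of_le hT, integral_Ioc_eq_integral_Ioo]

/-- The `L²(0,t)`-norm, squared. -/
def energy (f : ℝ → E) (t : ℝ) : ℝ := ∫ τ in (0 : ℝ)..t, ‖f τ‖ ^ 2

theorem energy_nonneg (f : ℝ → E) (ht : 0 ≤ t) : 0 ≤ energy f t :=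
  intervalIntegral.integral_nonneg ht fun _ _ => by positivity

theorem energy_eq_norm_sq (hT : 0 ≤ T) (f : Lp E 2 (volume.restrict (Ioo 0 T))) :
    energy f T = ‖f‖ ^ 2 := by
  rw [norm_sq_Lp, energy, ← integral_Ioo_eq_intervalIntegral hT]

theorem energy_mono {f : ℝ → E} (hf : MemLp f 2 (volume.restrict (Ioo 0 T))) (ht : t ∈ Icc 0 T)
    {s : ℝ} (hs : s ∈ Icc 0 t) : energy f s ≤ energy f t := by
  refine intervalIntegral.integral_mono_interval le_rfl hs.1 hs.2
    (Eventually.of_forall fun _ => by positivity) (intervalIntegrable_norm_sq_of_memLp hf ht)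

theorem energy_eq_restrict (ht : t ∈ Icc 0 T) (f : Lp E 2 (volume.restrict (Ioo 0 T))) :
    energy f t = ‖LpToLpRestrictCLM ℝ E ℝ (volume.restrict (Ioo 0 T)) 2 (Iio t) f‖ ^ 2 := by
  rw [norm_sq_Lp, energy, ← integral_Ioo_eq_intervalIntegral ht.1]
  have e : (volume.restrict (Ioo 0 T)).restrict (Iio t) = volume.restrict (Ioo 0 t) := by
    rw [Measure.restrict_restrict measurableSet_Iio]
    congr 1
    ext x; simp only [mem_inter_iff, mem_Iio, mem_Ioo]
    constructor
    · rintro ⟨h1, h2, h3⟩; exact ⟨h2, h1⟩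
    · rintro ⟨h1, h2⟩; exact ⟨h2, h1, h2.trans_le ht.2⟩
  rw [← e]
  refine integral_congr_ae ?_
  filter_upwards [LpToLpRestrictCLM_coeFn ℝ (Iio t) f] with x hx
  rw [hx]

theorem continuous_energy (ht : t ∈ Icc 0 T) :
    Continuous fun f : Lp E 2 (volume.restrict (Ioo 0 T)) => energy f t := by
  simp only [energy_eq_restrict ht]
  fun_prop

/-- The primitive `f ↦ ∫₀ᵗ f` as a bounded operator on `L²(0,T)`. -/
def prim (E : Type*) [NormedAddCommGroup E] [InnerProductSpace ℝ E] [CompleteSpace E]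
    (ht : t ∈ Icc 0 T) : Lp E 2 (volume.restrict (Ioo 0 T)) →L[ℝ] E :=
  LinearMap.mkContinuous
    { toFun := fun f => ∫ τ in (0 : ℝ)..t, f τ
      map_add' := fun f g => by
        rw [intervalIntegral_congr_of_ae_Ioo (Lp.coeFn_add f g) ht]
        exact intervalIntegral.integral_add (intervalIntegrable_of_memLp (Lp.memLp f) ht)
          (intervalIntegrable_of_memLp (Lp.memLp g) ht)
      map_smul' := fun c f => by
        rw [intervalIntegral_congr_of_ae_Ioo (Lp.coeFn_smul c f) ht]
        exact intervalIntegral.integral_smul c _ }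
    (Real.sqrt t) fun f => by
      have hf := Lp.memLp f
      have h1 := sq_intervalIntegral_le ht.1 (intervalIntegrable_of_memLp hf ht).norm
        (intervalIntegrable_norm_sq_of_memLp hf ht)
      have h2 : energy f t ≤ ‖f‖ ^ 2 := by
        rw [← energy_eq_norm_sq (ht.1.trans ht.2)]
        exact energy_mono hf ⟨ht.1.trans ht.2, le_rfl⟩ ht
      refine (intervalIntegral.norm_integral_le_integral_norm ht.1).trans ?_
      refine Real.le_sqrt_of_sq_le (h1.trans (mul_le_mul_of_nonneg_left h2 ht.1)) |>.trans ?_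
      rw [Real.sqrt_mul ht.1, Real.sqrt_sq (norm_nonneg _)]

theorem ae_eq_zero_of_primitive_eq_zero {f : ℝ → E}
    (hf : IntervalIntegrable f volume 0 T) (hT : 0 ≤ T)
    (h : ∀ t ∈ Icc 0 T, ∫ τ in (0 : ℝ)..t, f τ = 0) : f =ᵐ[volume.restrict (Ioo 0 T)] 0 := by
  rw [EventuallyEq, ae_restrict_iff' measurableSet_Ioo]
  filter_upwards [hf.ae_hasDerivAt_integral] with x hx hm
  have h1 := hx (by rw [uIcc_of_le hT]; exact Ioo_subset_Icc_self hm) 0 (by simp)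
  have h2 : (fun t => ∫ τ in (0 : ℝ)..t, f τ) =ᶠ[𝓝 x] fun _ => 0 := by
    filter_upwards [Icc_mem_nhds hm.1 hm.2] with s hs using h s hs
  exact h1.unique ((hasDerivAt_const x (0 : E)).congr_of_eventuallyEq h2)

end Prim

/-! ### The linear evolution equation `ρ (J*J w)' + ν w = f` -/

section Linear

set_option linter.unusedSectionVars false

variable {E : Type*} [NormedAddCommGroup E] [InnerProductSpace ℝ E] [CompleteSpace E] {T : ℝ}

/-- `w ∈ L²(0,T;E)` and `v ∈ C([0,T];E)` solve `ρ (J*v)' + ν w = f`, `v = J w`, `v(0) = u`, in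
time-integrated form, and satisfy the energy estimate. -/
structure IsLinearSolution (hT : 0 ≤ T) (J : E →L[ℝ] E) (ρ ν : ℝ)
    (f : Lp E 2 (volume.restrict (Ioo 0 T))) (u : E) (w : Lp E 2 (volume.restrict (Ioo 0 T)))
    (v : C(Icc (0 : ℝ) T, E)) : Prop where
  initial : v ⟨0, le_rfl, hT⟩ = u
  velocity : ∀ t ∈ Icc 0 T, ∫ τ in (0 : ℝ)..t, IccExtend hT v τ = J (∫ τ in (0 : ℝ)..t, w τ)
  equation : ∀ t (ht : t ∈ Icc 0 T), ρ • J.adjoint (v ⟨t, ht⟩) + ν • ∫ τ in (0 : ℝ)..t, w τ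
    = ρ • J.adjoint u + ∫ τ in (0 : ℝ)..t, f τ
  energy_le : ∀ t (ht : t ∈ Icc 0 T),
    ρ * ‖v ⟨t, ht⟩‖ ^ 2 + ν * energy w t ≤ ρ * ‖u‖ ^ 2 + 1 / ν * energy f t

/-- The primitive `t ↦ ∫₀ᵗ f` as a continuous function. -/
def primC (hT : 0 ≤ T) : Lp E 2 (volume.restrict (Ioo 0 T)) →ₗ[ℝ] C(Icc (0 : ℝ) T, E) where
  toFun f := ⟨fun t => ∫ τ in (0 : ℝ)..t, f τ, (continuousOn_primitive
    (intervalIntegrable_of_memLp (Lp.memLp f) ⟨hT, le_rfl⟩) hT).domRestrict⟩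
  map_add' f g := ContinuousMap.ext fun t => (prim E t.2).map_add f g
  map_smul' c f := ContinuousMap.ext fun t => (prim E t.2).map_smul c f

theorem memLp_IccExtend (hT : 0 ≤ T) (v : C(Icc (0 : ℝ) T, E)) :
    MemLp (IccExtend hT v) 2 (volume.restrict (Ioo 0 T)) := by
  have hc : Continuous (IccExtend hT v) := v.continuous.Icc_extend'
  obtain ⟨C, hC⟩ := isCompact_Icc.exists_bound_of_continuousOn (hc.continuousOn (s := Icc 0 T))
  exact MemLp.of_bound hc.aestronglyMeasurable C
    (ae_restrict_of_forall_mem measurableSet_Ioo fun x hx => hC x (Ioo_subset_Icc_self hx))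

/-- The inclusion of `C([0,T];E)` into `L²(0,T;E)`. -/
def inclC (hT : 0 ≤ T) : C(Icc (0 : ℝ) T, E) →ₗ[ℝ] Lp E 2 (volume.restrict (Ioo 0 T)) where
  toFun v := (memLp_IccExtend hT v).toLp
  map_add' v w := (MemLp.toLp_add (memLp_IccExtend hT v) (memLp_IccExtend hT w)).symm ▸ rfl
  map_smul' c v := (MemLp.toLp_const_smul c (memLp_IccExtend hT v)).symm ▸ rfl

theorem inclC_ae (hT : 0 ≤ T) (v : C(Icc (0 : ℝ) T, E)) :
    inclC hT v =ᵐ[volume.restrict (Ioo 0 T)] IccExtend hT v :=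
  MemLp.coeFn_toLp (memLp_IccExtend hT v)

theorem continuous_integral_IccExtend (hT : 0 ≤ T) {t : ℝ} (ht : 0 ≤ t) :
    Continuous fun v : C(Icc (0 : ℝ) T, E) => ∫ τ in (0 : ℝ)..t, IccExtend hT v τ := by
  refine (LipschitzWith.of_dist_le_mul (K := ⟨t, ht⟩) fun v w => ?_).continuous
  have hv : Continuous (IccExtend hT v) := v.continuous.Icc_extend'
  have hw : Continuous (IccExtend hT w) := w.continuous.Icc_extend'
  rw [dist_eq_norm, ← intervalIntegral.integral_sub (hv.intervalIntegrable _ _)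
    (hw.intervalIntegrable _ _)]
  refine (intervalIntegral.norm_integral_le_of_norm_le_const (C := dist v w)
    fun x _ => ?_).trans (le_of_eq ?_)
  · rw [← dist_eq_norm]; exact ContinuousMap.dist_apply_le_dist _
  · rw [sub_zero, abs_of_nonneg ht, mul_comm]; rfl

theorem intervalIntegrable_clm_comp (L : E →L[ℝ] E) {w : ℝ → E} {a b : ℝ}
    (hw : IntervalIntegrable w volume a b) : IntervalIntegrable (fun τ => L (w τ)) volume a b :=
  ⟨L.integrable_comp hw.1, L.integrable_comp hw.2⟩

/-- Uniqueness for the homogeneous linear equation. With `Q = ∫ v = J ∫ w` one has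
`(|Q|²)' = 2 ⟨J*v, ∫ w⟩ ≤ 0`. -/
theorem primitive_eq_zero_of_homogeneous {J : E →L[ℝ] E} (hJ : Function.Injective J) {ρ ν : ℝ}
    (hρ : 0 < ρ) (hν : 0 < ν) {w v : ℝ → E} (hv : ContinuousOn v (Icc 0 T))
    (hvel : ∀ t ∈ Icc 0 T, ∫ τ in (0 : ℝ)..t, v τ = J (∫ τ in (0 : ℝ)..t, w τ))
    (heq : ∀ t ∈ Icc 0 T, ρ • J.adjoint (v t) + ν • ∫ τ in (0 : ℝ)..t, w τ = 0)
    {t : ℝ} (ht : t ∈ Icc 0 T) : ∫ τ in (0 : ℝ)..t, w τ = 0 := by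
  have hvi : IntervalIntegrable v volume 0 t := by
    refine ContinuousOn.intervalIntegrable (hv.mono ?_)
    rw [uIcc_of_le ht.1]; exact Icc_subset_Icc_right ht.2
  have h := norm_sq_primitive ht.1 hvi 0
  simp only [zero_add, norm_zero] at h
  have hle : ∫ s in (0 : ℝ)..t, inner ℝ (∫ τ in (0 : ℝ)..s, v τ) (v s) ≤ 0 := by
    have : 0 ≤ ∫ s in (0 : ℝ)..t, -inner ℝ (∫ τ in (0 : ℝ)..s, v τ) (v s) := by
      refine intervalIntegral.integral_nonneg ht.1 fun s hs => ?_
      have hsT : s ∈ Icc 0 T := ⟨hs.1, hs.2.trans ht.2⟩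
      rw [hvel s hsT, real_inner_comm, ← ContinuousLinearMap.adjoint_inner_left]
      have e := heq s hsT
      set Wv := ∫ τ in (0 : ℝ)..s, w τ
      have e2 : ρ * inner ℝ (J.adjoint (v s)) Wv = -(ν * ‖Wv‖ ^ 2) := by
        have := congrArg (fun x => inner ℝ x Wv) e
        simp only [inner_add_left, real_inner_smul_left, real_inner_self_eq_norm_sq,
          inner_zero_left] at this
        linarith
      have e3 : 0 ≤ ρ * -inner ℝ (J.adjoint (v s)) Wv := by
        have := mul_nonneg hν.le (sq_nonneg ‖Wv‖)
        linarith
      exact nonneg_of_mul_nonneg_right e3 hρ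
    rw [intervalIntegral.integral_neg] at this
    linarith
  have h0 : ‖∫ τ in (0 : ℝ)..t, v τ‖ ^ 2 ≤ 0 := by rw [h]; linarith
  have h1 : ∫ τ in (0 : ℝ)..t, v τ = 0 := by
    rw [← norm_eq_zero]; exact pow_eq_zero_iff (two_ne_zero) |>.mp (le_antisymm h0 (sq_nonneg _))
  rw [hvel t ht] at h1
  exact hJ (h1.trans (map_zero J).symm)

section Regular

variable (hT : 0 ≤ T) (J : E →L[ℝ] E) (ρ ν : ℝ)

/-- The continuous functions `w(t) = w₀ + ∫₀ᵗ w₁`. They solve the equation, with a right-hand side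
and an initial velocity that depend linearly on `(w₀, w₁)`. -/
def regC : (E × Lp E 2 (volume.restrict (Ioo 0 T))) →ₗ[ℝ] C(Icc (0 : ℝ) T, E) :=
  (ContinuousLinearMap.const ℝ (Icc (0 : ℝ) T)).toLinearMap.comp (LinearMap.fst ℝ _ _)
    + (primC hT).comp (LinearMap.snd ℝ _ _)

/-- The velocity that belongs to `regC`. -/
def regV : (E × Lp E 2 (volume.restrict (Ioo 0 T))) →ₗ[ℝ] C(Icc (0 : ℝ) T, E) :=
  (J.compLeftContinuous ℝ (Icc (0 : ℝ) T)).toLinearMap.comp (regC hT)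

/-- The right-hand side that belongs to `regC`. -/
def regF : (E × Lp E 2 (volume.restrict (Ioo 0 T))) →ₗ[ℝ] Lp E 2 (volume.restrict (Ioo 0 T)) :=
  ρ • (ContinuousLinearMap.compLpL 2 _ (J.adjoint ∘L J)).toLinearMap.comp (LinearMap.snd ℝ _ _)
    + ν • (inclC hT).comp (regC hT)

/-- The right-hand side and the initial velocity that belong to `regC`. -/
def regData : (E × Lp E 2 (volume.restrict (Ioo 0 T))) →ₗ[ℝ]
    WithLp 2 (Lp E 2 (volume.restrict (Ioo 0 T)) × E) :=
  (WithLp.linearEquiv 2 ℝ _).symm.toLinearMap.comp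
    ((regF hT J ρ ν).prod (J.toLinearMap.comp (LinearMap.fst ℝ _ _)))

theorem regF_ae (p : E × Lp E 2 (volume.restrict (Ioo 0 T))) :
    regF hT J ρ ν p =ᵐ[volume.restrict (Ioo 0 T)]
      fun τ => ρ • J.adjoint (J (p.2 τ)) + ν • IccExtend hT (regC hT p) τ := by
  have h1 := (J.adjoint ∘L J).coeFn_compLpL (p := 2) p.2
  have h2 := inclC_ae hT (regC hT p)
  have h3 := Lp.coeFn_smul ρ ((J.adjoint ∘L J).compLpL 2 (volume.restrict (Ioo 0 T)) p.2)
  have h4 := Lp.coeFn_smul ν (inclC hT (regC hT p))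
  have h5 := Lp.coeFn_add (ρ • ((J.adjoint ∘L J).compLpL 2 (volume.restrict (Ioo 0 T)) p.2))
    (ν • inclC hT (regC hT p))
  filter_upwards [h1, h2, h3, h4, h5] with τ a1 a2 a3 a4 a5
  change (ρ • ((J.adjoint ∘L J).compLpL 2 (volume.restrict (Ioo 0 T)) p.2)
    + ν • inclC hT (regC hT p) : Lp E 2 (volume.restrict (Ioo 0 T))) τ = _
  rw [a5, Pi.add_apply, a3, a4, Pi.smul_apply, Pi.smul_apply, a1, a2]
  rfl

/-- The energy estimate comes from testing the equation with `w = regC hT p`. -/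
theorem isLinearSolution_reg {ρ ν : ℝ} (hν : 0 < ν)
    (p : E × Lp E 2 (volume.restrict (Ioo 0 T))) :
    IsLinearSolution hT J ρ ν (regF hT J ρ ν p) (J p.1) (inclC hT (regC hT p)) (regV hT J p) := by
  have hwc : Continuous (IccExtend hT (regC hT p)) := (regC hT p).continuous.Icc_extend'
  have hwi : ∀ t ∈ Icc 0 T, ∫ τ in (0 : ℝ)..t, inclC hT (regC hT p) τ
      = ∫ τ in (0 : ℝ)..t, IccExtend hT (regC hT p) τ := fun t ht =>
    intervalIntegral_congr_of_ae_Ioo (inclC_ae hT _) ht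
  have hp : ∀ t ∈ Icc 0 T, IntervalIntegrable p.2 volume 0 t := fun t ht =>
    intervalIntegrable_of_memLp (Lp.memLp p.2) ht
  have hF : ∀ t ∈ Icc 0 T, ∫ τ in (0 : ℝ)..t, regF hT J ρ ν p τ
      = ρ • J.adjoint (J (∫ τ in (0 : ℝ)..t, p.2 τ))
        + ν • ∫ τ in (0 : ℝ)..t, IccExtend hT (regC hT p) τ := by
    intro t ht
    have hJ : IntervalIntegrable (fun τ => (J.adjoint ∘L J) (p.2 τ)) volume 0 t :=
      intervalIntegrable_clm_comp (J.adjoint ∘L J) (hp t ht)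
    have e := (J.adjoint ∘L J).intervalIntegral_comp_comm (hp t ht)
    simp only [ContinuousLinearMap.comp_apply] at hJ e
    rw [intervalIntegral_congr_of_ae_Ioo (regF_ae hT J ρ ν p) ht, intervalIntegral.integral_add
      (f := fun τ => ρ • J.adjoint (J (p.2 τ))) (g := fun τ => ν • IccExtend hT (regC hT p) τ)
      (hJ.smul ρ) ((hwc.intervalIntegrable _ _).smul ν), intervalIntegral.integral_smul,
      intervalIntegral.integral_smul, e]
  refine ⟨?_, fun t ht => ?_, fun t ht => ?_, fun t ht => ?_⟩
  · change J (p.1 + ∫ τ in (0 : ℝ)..0, p.2 τ) = J p.1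
    simp
  · rw [hwi t ht, ← J.intervalIntegral_comp_comm (hwc.intervalIntegrable _ _)]
    rfl
  · rw [hwi t ht, hF t ht]
    change ρ • J.adjoint (J (p.1 + ∫ τ in (0 : ℝ)..t, p.2 τ)) + _ = _
    rw [map_add, map_add, smul_add, add_assoc]
  · have hJp : IntervalIntegrable (fun τ => J (p.2 τ)) volume 0 t :=
      intervalIntegrable_clm_comp J (hp t ht)
    have hfi := intervalIntegrable_norm_sq_of_memLp (Lp.memLp (regF hT J ρ ν p)) ht
    have hwi2 := intervalIntegrable_norm_sq_of_memLp (Lp.memLp (inclC hT (regC hT p))) ht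
    have hnorm := norm_sq_primitive ht.1 hJp (J p.1)
    rw [J.intervalIntegral_comp_comm (hp t ht), ← map_add] at hnorm
    change ρ * ‖J (p.1 + ∫ τ in (0 : ℝ)..t, p.2 τ)‖ ^ 2 + _ ≤ _
    rw [hnorm, energy, energy, mul_add]
    have key : ρ * (2 * ∫ s in (0 : ℝ)..t,
        inner ℝ (J p.1 + ∫ τ in (0 : ℝ)..s, J (p.2 τ)) (J (p.2 s)))
        ≤ ∫ s in (0 : ℝ)..t, (1 / ν * ‖regF hT J ρ ν p s‖ ^ 2
          - ν * ‖inclC hT (regC hT p) s‖ ^ 2) := by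
      rw [← mul_assoc, ← intervalIntegral.integral_const_mul]
      refine intervalIntegral.integral_mono_ae_restrict ht.1 ?_
        ((hfi.const_mul _).sub (hwi2.const_mul _)) ?_
      · refine IntervalIntegrable.const_mul ?_ _
        have hc : ContinuousOn (fun s => J p.1 + ∫ τ in (0 : ℝ)..s, J (p.2 τ)) (uIcc 0 t) := by
          rw [uIcc_of_le ht.1]
          exact continuousOn_const.add (continuousOn_primitive hJp ht.1)
        obtain ⟨C, hC⟩ := isCompact_uIcc.exists_bound_of_continuousOn hc
        refine IntervalIntegrable.mono_fun (hJp.norm.const_mul C) ?_ ?_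
        · exact ((hc.mono uIoc_subset_uIcc).aestronglyMeasurable measurableSet_uIoc).inner
            hJp.def'.aestronglyMeasurable
        · filter_upwards [ae_restrict_mem measurableSet_uIoc] with s hs
          have hC0 := hC s (uIoc_subset_uIcc hs)
          refine (norm_inner_le_norm _ _).trans ?_
          rw [norm_mul, norm_norm, Real.norm_of_nonneg ((norm_nonneg _).trans hC0)]
          gcongr
      · have h1 := ae_Ioc_of_ae_Ioo (regF_ae hT J ρ ν p) ht
        have h2 := ae_Ioc_of_ae_Ioo (inclC_ae hT (regC hT p)) ht
        rw [EventuallyLE, ae_restrict_iff' measurableSet_Icc]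
        have h0 : ∀ᵐ s : ℝ, s ≠ 0 := by simp [ae_iff, measure_singleton]
        filter_upwards [h1, h2, h0] with s a1 a2 a3 hs
        have hs' : s ∈ uIoc 0 t := by
          rw [uIoc_of_le ht.1]; exact ⟨lt_of_le_of_ne hs.1 (Ne.symm a3), hs.2⟩
        have hsT : s ∈ Icc 0 T := ⟨hs.1, hs.2.trans ht.2⟩
        rw [J.intervalIntegral_comp_comm (hp s hsT), ← map_add, a2 hs']
        have e : IccExtend hT (regC hT p) s = p.1 + ∫ τ in (0 : ℝ)..s, p.2 τ :=
          IccExtend_of_mem hT _ hsT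
        have a1' := a1 hs'
        rw [e] at a1' ⊢
        set x := p.1 + ∫ τ in (0 : ℝ)..s, p.2 τ
        set F := (regF hT J ρ ν p : ℝ → E) s
        have i1 : inner ℝ x F = ρ * inner ℝ (J x) (J (p.2 s)) + ν * ‖x‖ ^ 2 := by
          rw [a1', inner_add_right, real_inner_smul_right, real_inner_smul_right,
            ContinuousLinearMap.adjoint_inner_right, real_inner_self_eq_norm_sq]
        have i2 := real_inner_le_norm x F
        have i3 : 2 * (‖x‖ * ‖F‖) ≤ ν * ‖x‖ ^ 2 + 1 / ν * ‖F‖ ^ 2 := by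
          have : 0 ≤ 1 / ν * (ν * ‖x‖ - ‖F‖) ^ 2 := by positivity
          have e2 : 1 / ν * (ν * ‖x‖ - ‖F‖) ^ 2
              = ν * ‖x‖ ^ 2 + 1 / ν * ‖F‖ ^ 2 - 2 * (‖x‖ * ‖F‖) := by field_simp; ring
          linarith
        linarith
    rw [intervalIntegral.integral_sub (hfi.const_mul _) (hwi2.const_mul _),
      intervalIntegral.integral_const_mul, intervalIntegral.integral_const_mul] at key
    linarith

/-- The data of the functions `regC` are dense: if `(f̂, û)` is orthogonal to all of them, the
choice `w₀ = 0`, `w₁ = f̂` gives `J f̂ = 0`. -/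
theorem dense_regData {J : E →L[ℝ] E} {ρ ν : ℝ} (hρ : 0 < ρ) (hν : 0 < ν)
    (hJ : Function.Injective J) (hJd : ∀ u, (∀ x, inner ℝ (J x) u = 0) → u = 0) :
    (LinearMap.range (regData hT J ρ ν)).topologicalClosure = ⊤ := by
  rw [Submodule.topologicalClosure_eq_top_iff, Submodule.eq_bot_iff]
  intro d hd
  rw [Submodule.mem_orthogonal] at hd
  have hd' : ∀ p : E × Lp E 2 (volume.restrict (Ioo 0 T)),
      inner ℝ (regF hT J ρ ν p) d.fst + inner ℝ (J p.1) d.snd = 0 := fun p => by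
    have := hd _ ⟨p, rfl⟩
    rwa [WithLp.prod_inner_apply] at this
  have hfi : IntervalIntegrable d.fst volume 0 T :=
    intervalIntegrable_of_memLp (Lp.memLp d.fst) ⟨hT, le_rfl⟩
  have hf : d.fst = 0 := by
    have h0 := hd' (0, d.fst)
    simp only [map_zero, inner_zero_left, add_zero] at h0
    rw [L2.inner_def] at h0
    have h1 : ∫ τ in Ioo 0 T, inner ℝ ((regF hT J ρ ν (0, d.fst) : ℝ → E) τ) (d.fst τ)
        = ∫ τ in Ioo 0 T, (ρ * ‖J (d.fst τ)‖ ^ 2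
          + ν * inner ℝ (0 + ∫ σ in (0 : ℝ)..τ, d.fst σ) (d.fst τ)) := by
      refine integral_congr_ae ?_
      filter_upwards [regF_ae hT J ρ ν (0, d.fst), ae_restrict_mem measurableSet_Ioo]
        with τ hτ hm
      rw [hτ, inner_add_left, real_inner_smul_left, real_inner_smul_left,
        ContinuousLinearMap.adjoint_inner_left, real_inner_self_eq_norm_sq,
        IccExtend_of_mem hT _ (Ioo_subset_Icc_self hm)]
      rfl
    have hJi : IntervalIntegrable (fun τ => ‖J (d.fst τ)‖ ^ 2) volume 0 T :=
      intervalIntegrable_norm_sq_of_memLp (J.comp_memLp' (Lp.memLp d.fst)) ⟨hT, le_rfl⟩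
    have hii : IntervalIntegrable
        (fun τ => inner ℝ (0 + ∫ σ in (0 : ℝ)..τ, d.fst σ) (d.fst τ)) volume 0 T := by
      have hc : ContinuousOn (fun s => 0 + ∫ τ in (0 : ℝ)..s, d.fst τ) (uIcc 0 T) := by
        rw [uIcc_of_le hT]
        exact continuousOn_const.add (continuousOn_primitive hfi hT)
      obtain ⟨C, hC⟩ := isCompact_uIcc.exists_bound_of_continuousOn hc
      refine IntervalIntegrable.mono_fun (hfi.norm.const_mul C) ?_ ?_
      · exact ((hc.mono uIoc_subset_uIcc).aestronglyMeasurable measurableSet_uIoc).inner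
          hfi.def'.aestronglyMeasurable
      · filter_upwards [ae_restrict_mem measurableSet_uIoc] with s hs
        have hC0 := hC s (uIoc_subset_uIcc hs)
        refine (norm_inner_le_norm _ _).trans ?_
        rw [norm_mul, norm_norm, Real.norm_of_nonneg ((norm_nonneg _).trans hC0)]
        gcongr
    rw [h1, integral_Ioo_eq_intervalIntegral hT, intervalIntegral.integral_add (hJi.const_mul _)
      (hii.const_mul _), intervalIntegral.integral_const_mul,
      intervalIntegral.integral_const_mul] at h0
    have h2 := norm_sq_primitive hT hfi 0
    rw [norm_zero] at h2
    have h3 : 0 ≤ ‖0 + ∫ τ in (0 : ℝ)..T, d.fst τ‖ ^ 2 := by positivity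
    have h4 : 0 ≤ ∫ τ in (0 : ℝ)..T, ‖J (d.fst τ)‖ ^ 2 :=
      intervalIntegral.integral_nonneg hT fun _ _ => by positivity
    have h5 : ∫ τ in (0 : ℝ)..T, ‖J (d.fst τ)‖ ^ 2 = 0 := by
      have : 0 ≤ ν * ∫ s in (0 : ℝ)..T, inner ℝ (0 + ∫ τ in (0 : ℝ)..s, d.fst τ) (d.fst s) :=
        mul_nonneg hν.le (by linarith)
      nlinarith
    have h6 : (J.compLpL 2 (volume.restrict (Ioo 0 T)) d.fst) = 0 := by
      rw [← integral_Ioo_eq_intervalIntegral hT] at h5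
      rw [← norm_eq_zero, ← sq_eq_zero_iff, norm_sq_Lp]
      refine (integral_congr_ae ?_).trans h5
      filter_upwards [J.coeFn_compLpL (p := 2) d.fst] with τ hτ
      rw [hτ]
    rw [Lp.eq_zero_iff_ae_eq_zero] at h6 ⊢
    filter_upwards [h6, J.coeFn_compLpL (p := 2) d.fst] with τ a1 a2
    rw [a2] at a1
    exact hJ (a1.trans (map_zero J).symm)
  have hu : d.snd = 0 := hJd _ fun x => by
    have := hd' (x, 0)
    rwa [hf, inner_zero_right, zero_add] at this
  exact (WithLp.ofLp_injective 2) (Prod.ext hf hu)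

/-- Solvability of the linear equation for all data in `L²(0,T;E) × E`. The assumption `hJd` says
that `J` has dense range. -/
theorem exists_isLinearSolution {J : E →L[ℝ] E} {ρ ν : ℝ} (hρ : 0 < ρ) (hν : 0 < ν)
    (hJ : Function.Injective J) (hJd : ∀ u, (∀ x, inner ℝ (J x) u = 0) → u = 0)
    (f : Lp E 2 (volume.restrict (Ioo 0 T))) (u : E) :
    ∃ w v, IsLinearSolution hT J ρ ν f u w v := by
  -- approximate the data by data of `regC`; by the energy estimate the solutions are Cauchy
  have hmem : WithLp.toLp 2 (f, u) ∈
      (LinearMap.range (regData hT J ρ ν)).topologicalClosure := by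
    rw [dense_regData hT hρ hν hJ hJd]; trivial
  obtain ⟨d, hd, hlim⟩ := mem_closure_iff_seq_limit.mp hmem
  choose p hp using hd
  have hF : Tendsto (fun n => regF hT J ρ ν (p n)) atTop (𝓝 f) := by
    have := ((WithLp.fstL 2 ℝ _ _).continuous.tendsto _).comp hlim
    refine this.congr fun n => ?_
    rw [Function.comp_apply, ← hp n]; rfl
  have hU : Tendsto (fun n => J (p n).1) atTop (𝓝 u) := by
    have := ((WithLp.sndL 2 ℝ _ _).continuous.tendsto _).comp hlim
    refine this.congr fun n => ?_
    rw [Function.comp_apply, ← hp n]; rfl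
  set w := fun n => inclC hT (regC hT (p n)) with hw
  set v := fun n => regV hT J (p n) with hv
  set δ : ℕ → ℕ → ℝ := fun n k => ρ * dist (J (p n).1) (J (p k).1) ^ 2
    + 1 / ν * dist (regF hT J ρ ν (p n)) (regF hT J ρ ν (p k)) ^ 2 with hδ
  have hδ0 : Tendsto (fun x : ℕ × ℕ => δ x.1 x.2) atTop (𝓝 0) := by
    have a1 := (cauchySeq_iff_tendsto_dist_atTop_0.mp hU.cauchySeq).pow 2
    have a2 := (cauchySeq_iff_tendsto_dist_atTop_0.mp hF.cauchySeq).pow 2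
    have := (a1.const_mul ρ).add (a2.const_mul (1 / ν))
    simp only [ne_eq, OfNat.ofNat_ne_zero, not_false_eq_true, zero_pow, mul_zero, add_zero] at this
    exact this
  have hest : ∀ n k t (ht : t ∈ Icc 0 T), ρ * ‖(v n - v k) ⟨t, ht⟩‖ ^ 2
      + ν * energy (w n - w k : Lp E 2 (volume.restrict (Ioo 0 T))) t ≤ δ n k := by
    intro n k t ht
    have h := (isLinearSolution_reg hT J (ρ := ρ) hν (p n - p k)).energy_le t ht
    rw [map_sub, map_sub, map_sub, map_sub, Prod.fst_sub, map_sub] at h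
    refine h.trans ?_
    rw [hδ]
    simp only [dist_eq_norm]
    rw [← energy_eq_norm_sq hT]
    gcongr
    exact energy_mono (Lp.memLp _) ⟨hT, le_rfl⟩ ht
  have hdw : ∀ n k, dist (w n) (w k) ≤ Real.sqrt (1 / ν * δ n k) := by
    intro n k
    rw [dist_eq_norm]
    refine Real.le_sqrt_of_sq_le ?_
    have h := hest n k T ⟨hT, le_rfl⟩
    rw [energy_eq_norm_sq hT] at h
    have h0 : 0 ≤ ρ * ‖(v n - v k) ⟨T, hT, le_rfl⟩‖ ^ 2 := by positivity
    rw [one_div, inv_mul_eq_div, le_div_iff₀ hν]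
    linarith
  have hdv : ∀ n k, dist (v n) (v k) ≤ Real.sqrt (1 / ρ * δ n k) := by
    intro n k
    rw [dist_eq_norm, ContinuousMap.norm_le _ (Real.sqrt_nonneg _)]
    intro t
    refine Real.le_sqrt_of_sq_le ?_
    have h := hest n k t t.2
    have h0 := mul_nonneg hν.le (energy_nonneg (w n - w k : Lp E 2 (volume.restrict (Ioo 0 T)))
      t.2.1)
    rw [one_div, inv_mul_eq_div, le_div_iff₀ hρ]
    linarith
  have hsq : ∀ c : ℝ, Tendsto (fun x : ℕ × ℕ => Real.sqrt (c * δ x.1 x.2)) atTop (𝓝 0) := by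
    intro c
    have := (Real.continuous_sqrt.tendsto _).comp (hδ0.const_mul c)
    rw [mul_zero, Real.sqrt_zero] at this
    exact this
  obtain ⟨w', hw'⟩ := cauchySeq_tendsto_of_complete (cauchySeq_iff_tendsto_dist_atTop_0.mpr
    (squeeze_zero (fun _ => dist_nonneg) (fun x => hdw x.1 x.2) (hsq _)))
  obtain ⟨v', hv'⟩ := cauchySeq_tendsto_of_complete (cauchySeq_iff_tendsto_dist_atTop_0.mpr
    (squeeze_zero (fun _ => dist_nonneg) (fun x => hdv x.1 x.2) (hsq _)))
  have hsol := fun n => isLinearSolution_reg hT J (ρ := ρ) hν (p n)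
  have hev : ∀ t (ht : t ∈ Icc 0 T), Tendsto (fun n => v n ⟨t, ht⟩) atTop (𝓝 (v' ⟨t, ht⟩)) :=
    fun t ht => ((continuous_eval_const (F := C(Icc (0 : ℝ) T, E))
      (⟨t, ht⟩ : Icc (0 : ℝ) T)).tendsto v').comp hv'
  have hpr : ∀ t (ht : t ∈ Icc 0 T), Tendsto (fun n => ∫ τ in (0 : ℝ)..t, w n τ) atTop
      (𝓝 (∫ τ in (0 : ℝ)..t, w' τ)) := fun t ht =>
    ((prim E ht).continuous.tendsto w').comp hw'
  have hpf : ∀ t (ht : t ∈ Icc 0 T), Tendsto (fun n => ∫ τ in (0 : ℝ)..t, regF hT J ρ ν (p n) τ)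
      atTop (𝓝 (∫ τ in (0 : ℝ)..t, f τ)) := fun t ht =>
    ((prim E ht).continuous.tendsto f).comp hF
  refine ⟨w', v', ?_, fun t ht => ?_, fun t ht => ?_, fun t ht => ?_⟩
  · refine tendsto_nhds_unique (hev 0 ⟨le_rfl, hT⟩) ?_
    exact hU.congr fun n => (hsol n).initial.symm
  · refine tendsto_nhds_unique (((continuous_integral_IccExtend hT ht.1).tendsto v').comp hv') ?_
    refine ((J.continuous.tendsto _).comp (hpr t ht)).congr fun n => ?_
    exact ((hsol n).velocity t ht).symm
  · refine tendsto_nhds_unique (((((J.adjoint).continuous.tendsto _).comp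
      (hev t ht)).const_smul ρ).add ((hpr t ht).const_smul ν)) ?_
    refine (((((J.adjoint).continuous.tendsto _).comp hU).const_smul ρ).add
      (hpf t ht)).congr fun n => ?_
    exact ((hsol n).equation t ht).symm
  · have e1 := (((continuous_energy (E := E) ht).tendsto w').comp hw')
    have e2 := (((continuous_energy (E := E) ht).tendsto f).comp hF)
    refine le_of_tendsto_of_tendsto'
      (((((hev t ht).norm).pow 2).const_mul ρ).add (e1.const_mul ν))
      (((hU.norm.pow 2).const_mul ρ).add (e2.const_mul (1 / ν))) fun n => ?_
    exact (hsol n).energy_le t ht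

end Regular

end Linear

/-! ### Square-integrable families of continuous paths -/

section Paths

variable {T : ℝ} {μ : Measure ℝ}

/-- `C[0,T]`. -/
abbrev Path (T : ℝ) : Type := C(Icc (0 : ℝ) T, ℝ)

/-- Evaluation at time `t`, from `L²(μ; C[0,T])` to `L²(μ)`. -/
def evL (μ : Measure ℝ) (t : Icc (0 : ℝ) T) : Lp (Path T) 2 μ →L[ℝ] Lp ℝ 2 μ :=
  (ContinuousMap.evalCLM ℝ t : Path T →L[ℝ] ℝ).compLpL 2 μ

theorem evL_ae (t : Icc (0 : ℝ) T) (y : Lp (Path T) 2 μ) :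
    evL μ t y =ᵐ[μ] fun x => (y x : Path T) t :=
  (ContinuousMap.evalCLM ℝ t : Path T →L[ℝ] ℝ).coeFn_compLpL y

/-- Continuous functions that agree almost everywhere at each time agree almost everywhere at all
times. -/
theorem ae_forall_eq {a b : ℝ → Icc (0 : ℝ) T → ℝ} (ha : ∀ᵐ x ∂μ, Continuous (a x))
    (hb : ∀ᵐ x ∂μ, Continuous (b x)) (h : ∀ t, ∀ᵐ x ∂μ, a x t = b x t) :
    ∀ᵐ x ∂μ, a x = b x := by
  obtain ⟨s, hs, hd⟩ := TopologicalSpace.exists_countable_dense (Icc (0 : ℝ) T)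
  have h' : ∀ᵐ x ∂μ, ∀ t ∈ s, a x t = b x t := (ae_ball_iff hs).mpr fun t _ => h t
  filter_upwards [ha, hb, h'] with x h1 h2 h3
  exact Continuous.ext_on hd h1 h2 h3

/-- An element of `L²(μ; C[0,T])` is determined by its values at all times. -/
theorem ext_evL {y z : Lp (Path T) 2 μ} (h : ∀ t, evL μ t y = evL μ t z) : y = z := by
  refine Lp.ext ?_
  have := ae_forall_eq (μ := μ) (a := fun x => ⇑(y x : Path T)) (b := fun x => ⇑(z x : Path T))
    (Eventually.of_forall fun x => (y x : Path T).continuous)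
    (Eventually.of_forall fun x => (z x : Path T).continuous) (fun t => by
      filter_upwards [evL_ae t y, evL_ae t z] with x h1 h2
      rw [← h1, ← h2, h t])
  filter_upwards [this] with x hx
  exact DFunLike.coe_injective hx

theorem continuous_evL (y : Lp (Path T) 2 μ) : Continuous fun t => evL μ t y := by
  rw [continuous_iff_continuousAt]
  intro s
  have hi : Integrable (fun x => ‖(y x : Path T)‖ ^ 2) μ :=
    (Lp.memLp y).integrable_norm_pow (p := 2) (by norm_num)
  have hc : Continuous fun t : Icc (0 : ℝ) T =>
      ∫ x, ((y x : Path T) t - (y x : Path T) s) ^ 2 ∂μ := by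
    refine continuous_of_dominated (bound := fun x => 4 * ‖(y x : Path T)‖ ^ 2)
      (fun t => ?_) (fun t => Eventually.of_forall fun x => ?_) (hi.const_mul 4)
      (Eventually.of_forall fun x => by fun_prop)
    · have h : ∀ t : Icc (0 : ℝ) T, AEStronglyMeasurable (fun x => (y x : Path T) t) μ := fun t =>
        (ContinuousMap.evalCLM ℝ t : Path T →L[ℝ] ℝ).continuous.comp_aestronglyMeasurable
          (Lp.aestronglyMeasurable y)
      exact ((h t).sub (h s)).pow 2
    · have h1 := (y x : Path T).norm_coe_le_norm t
      have h2 := (y x : Path T).norm_coe_le_norm s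
      rw [Real.norm_eq_abs] at h1 h2
      rw [Real.norm_of_nonneg (sq_nonneg _), ← sq_abs]
      have h3 := abs_sub ((y x : Path T) t) ((y x : Path T) s)
      have h4 : |(y x : Path T) t - (y x : Path T) s| ≤ 2 * ‖(y x : Path T)‖ := by linarith
      calc _ ≤ (2 * ‖(y x : Path T)‖) ^ 2 := by gcongr
        _ = _ := by ring
  have he : ∀ t, ‖evL μ t y - evL μ s y‖ ^ 2
      = ∫ x, ((y x : Path T) t - (y x : Path T) s) ^ 2 ∂μ := by
    intro t
    rw [norm_sq_Lp]
    refine integral_congr_ae ?_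
    filter_upwards [evL_ae t y, evL_ae s y, Lp.coeFn_sub (evL μ t y) (evL μ s y)] with x h1 h2 h3
    rw [h3, Pi.sub_apply, h1, h2, Real.norm_eq_abs, sq_abs]
  have ht := hc.tendsto s
  simp only [sub_self, ne_eq, OfNat.ofNat_ne_zero, not_false_eq_true, zero_pow,
    integral_zero] at ht
  rw [ContinuousAt, tendsto_iff_norm_sub_tendsto_zero]
  have := (Real.continuous_sqrt.tendsto 0).comp ht
  rw [Real.sqrt_zero] at this
  refine this.congr fun t => ?_
  rw [Function.comp_apply, ← he, Real.sqrt_sq (norm_nonneg _)]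

/-- The path `τ ↦ φ (min τ t)`, frozen at time `t`; its norm is the maximum of `|φ|` on `[0,t]`. -/
def freeze (t : Icc (0 : ℝ) T) : Path T →L[ℝ] Path T :=
  LinearMap.mkContinuous
    { toFun := fun φ => φ.comp ⟨fun τ => min τ t, by fun_prop⟩
      map_add' := fun _ _ => rfl
      map_smul' := fun _ _ => rfl } 1 fun φ => by
    rw [one_mul, ContinuousMap.norm_le _ (norm_nonneg _)]
    exact fun τ => φ.norm_coe_le_norm _

theorem freeze_apply (t τ : Icc (0 : ℝ) T) (φ : Path T) : freeze t φ τ = φ (min τ t) := rfl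

theorem abs_le_norm_freeze {t τ : Icc (0 : ℝ) T} (h : τ ≤ t) (φ : Path T) :
    |φ τ| ≤ ‖freeze t φ‖ := by
  have := (freeze t φ).norm_coe_le_norm τ
  rwa [freeze_apply, min_eq_left h] at this

/-- Freezing at time `t`, on `L²(μ; C[0,T])`. -/
def freezeL (μ : Measure ℝ) (t : Icc (0 : ℝ) T) : Lp (Path T) 2 μ →L[ℝ] Lp (Path T) 2 μ :=
  (freeze t).compLpL 2 μ

theorem freezeL_ae (t : Icc (0 : ℝ) T) (y : Lp (Path T) 2 μ) :
    freezeL μ t y =ᵐ[μ] fun x => freeze t (y x) := (freeze t).coeFn_compLpL y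

theorem freezeL_top (hT : 0 ≤ T) (y : Lp (Path T) 2 μ) : freezeL μ ⟨T, hT, le_rfl⟩ y = y := by
  refine Lp.ext ?_
  filter_upwards [freezeL_ae ⟨T, hT, le_rfl⟩ y] with x hx
  rw [hx]
  ext τ
  rw [freeze_apply, min_eq_left]
  exact τ.2.2

/-- `y ∈ L²(μ; C[0,T])` is the primitive of `w ∈ L²(0,T; L²(μ))`. -/
def IsPrimitive (w : Lp (Lp ℝ 2 μ) 2 (volume.restrict (Ioo 0 T))) (y : Lp (Path T) 2 μ) : Prop :=
  ∀ t : Icc (0 : ℝ) T, evL μ t y = ∫ τ in (0 : ℝ)..t, w τ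

theorem IsPrimitive.add {w₁ w₂ : Lp (Lp ℝ 2 μ) 2 (volume.restrict (Ioo 0 T))}
    {y₁ y₂ : Lp (Path T) 2 μ} (h₁ : IsPrimitive w₁ y₁) (h₂ : IsPrimitive w₂ y₂) :
    IsPrimitive (w₁ + w₂) (y₁ + y₂) := fun t => by
  rw [map_add, h₁ t, h₂ t]
  exact ((prim _ t.2).map_add w₁ w₂).symm

theorem IsPrimitive.sub {w₁ w₂ : Lp (Lp ℝ 2 μ) 2 (volume.restrict (Ioo 0 T))}
    {y₁ y₂ : Lp (Path T) 2 μ} (h₁ : IsPrimitive w₁ y₁) (h₂ : IsPrimitive w₂ y₂) :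
    IsPrimitive (w₁ - w₂) (y₁ - y₂) := fun t => by
  rw [map_sub, h₁ t, h₂ t]
  exact ((prim _ t.2).map_sub w₁ w₂).symm

theorem IsPrimitive.unique {w : Lp (Lp ℝ 2 μ) 2 (volume.restrict (Ioo 0 T))}
    {y₁ y₂ : Lp (Path T) 2 μ} (h₁ : IsPrimitive w y₁) (h₂ : IsPrimitive w y₂) : y₁ = y₂ :=
  ext_evL fun t => (h₁ t).trans (h₂ t).symm

/-- Minkowski's inequality `‖max_{τ ≤ t} |∫₀^τ w|‖ ≤ ∫₀ᵗ ‖w‖` for a function of one value. -/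
theorem exists_isPrimitive_indicator (hT : 0 ≤ T) (h : Lp ℝ 2 μ) {s : Set ℝ}
    (hs : MeasurableSet s) (hμs : volume.restrict (Ioo 0 T) s ≠ ⊤) :
    ∃ y : Lp (Path T) 2 μ, IsPrimitive (indicatorConstLp 2 hs hμs h) y ∧
      ∀ t : Icc (0 : ℝ) T, ‖freezeL μ t y‖
        ≤ ∫ τ in (0 : ℝ)..t, ‖(indicatorConstLp 2 hs hμs h : ℝ → Lp ℝ 2 μ) τ‖ := by
  have hi : ∀ a b : ℝ, IntervalIntegrable (s.indicator fun _ => (1 : ℝ)) volume a b := fun a b =>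
    ⟨(integrable_indicator_iff hs).mpr (integrableOn_const (by
        rw [Measure.restrict_apply hs]
        exact ((measure_mono inter_subset_right).trans_lt measure_Ioc_lt_top).ne)),
     (integrable_indicator_iff hs).mpr (integrableOn_const (by
        rw [Measure.restrict_apply hs]
        exact ((measure_mono inter_subset_right).trans_lt measure_Ioc_lt_top).ne))⟩
  set φ : Path T := ⟨fun t => ∫ τ in (0 : ℝ)..t, s.indicator (fun _ => (1 : ℝ)) τ,
    (continuousOn_primitive (hi 0 T) hT).domRestrict⟩ with hφ
  have hφ_apply : ∀ t, φ t = ∫ τ in (0 : ℝ)..t, s.indicator (fun _ => (1 : ℝ)) τ := fun _ => rfl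
  set y : Lp (Path T) 2 μ := (ContinuousLinearMap.toSpanSingleton ℝ φ).compLpL 2 μ h with hy
  have hy_ae : y =ᵐ[μ] fun x => h x • φ :=
    (ContinuousLinearMap.toSpanSingleton ℝ φ).coeFn_compLpL h
  have hind := indicatorConstLp_coeFn (p := 2) (hs := hs) (hμs := hμs) (c := h)
  have hnonneg : ∀ τ, 0 ≤ s.indicator (fun _ => (1 : ℝ)) τ := fun τ =>
    indicator_nonneg (fun _ _ => zero_le_one) τ
  refine ⟨y, fun t => ?_, fun t => ?_⟩
  · rw [intervalIntegral_congr_of_ae_Ioo hind t.2]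
    have e : ∀ τ, s.indicator (fun _ => h) τ = s.indicator (fun _ => (1 : ℝ)) τ • h := by
      intro τ; by_cases hτ : τ ∈ s <;> simp [hτ]
    simp only [e]
    rw [intervalIntegral.integral_smul_const, ← hφ_apply]
    refine Lp.ext ?_
    filter_upwards [evL_ae t y, hy_ae, Lp.coeFn_smul (φ t) h] with x h1 h2 h3
    rw [h1, h2, h3, ContinuousMap.smul_apply, Pi.smul_apply, smul_eq_mul, smul_eq_mul, mul_comm]
  · have e : ∫ τ in (0 : ℝ)..t, ‖(indicatorConstLp 2 hs hμs h : ℝ → Lp ℝ 2 μ) τ‖ = φ t * ‖h‖ := by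
      have hn : (fun τ => ‖(indicatorConstLp 2 hs hμs h : ℝ → Lp ℝ 2 μ) τ‖)
          =ᵐ[volume.restrict (Ioo 0 T)] fun τ => s.indicator (fun _ => (1 : ℝ)) τ * ‖h‖ := by
        filter_upwards [hind] with τ hτ
        rw [hτ]
        by_cases hτ' : τ ∈ s <;> simp [hτ']
      rw [intervalIntegral_congr_of_ae_Ioo hn t.2, intervalIntegral.integral_mul_const,
        ← hφ_apply]
    rw [e]
    refine Lp.norm_le_mul_norm_of_ae_le_mul ?_
    filter_upwards [freezeL_ae t y, hy_ae] with x h1 h2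
    rw [h1, h2, map_smul, norm_smul, mul_comm]
    refine mul_le_mul_of_nonneg_right ?_ (norm_nonneg _)
    have hmono : ∀ τ : Icc (0 : ℝ) T, 0 ≤ φ τ := fun τ =>
      intervalIntegral.integral_nonneg τ.2.1 fun u _ => hnonneg u
    rw [ContinuousMap.norm_le _ (hmono t)]
    intro τ
    rw [freeze_apply, Real.norm_of_nonneg (hmono _)]
    refine intervalIntegral.integral_mono_interval le_rfl (min τ t).2.1 (min_le_right τ t)
      (Eventually.of_forall hnonneg) (hi _ _)

/-- For functions with disjoint supports the norms `‖w τ‖` add up, so the estimate extends from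
indicators to simple functions. -/
theorem exists_isPrimitive_simpleFunc (hT : 0 ≤ T)
    (w : Lp.simpleFunc (Lp ℝ 2 μ) 2 (volume.restrict (Ioo 0 T))) :
    ∃ y : Lp (Path T) 2 μ, IsPrimitive (w : Lp (Lp ℝ 2 μ) 2 (volume.restrict (Ioo 0 T))) y ∧
      ∀ t : Icc (0 : ℝ) T, ‖freezeL μ t y‖ ≤
        ∫ τ in (0 : ℝ)..t,
          ‖((w : Lp (Lp ℝ 2 μ) 2 (volume.restrict (Ioo 0 T))) : ℝ → Lp ℝ 2 μ) τ‖ := by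
  induction w using Lp.simpleFunc.induction two_ne_zero ENNReal.ofNat_ne_top with
  | indicatorConst c hs hμs =>
    exact exists_isPrimitive_indicator hT c hs hμs.ne
  | @add f g hf hg hfg h₁ h₂ =>
    obtain ⟨y₁, p₁, b₁⟩ := h₁
    obtain ⟨y₂, p₂, b₂⟩ := h₂
    refine ⟨y₁ + y₂, p₁.add p₂, fun t => ?_⟩
    rw [map_add]
    refine (norm_add_le _ _).trans ((add_le_add (b₁ t) (b₂ t)).trans (le_of_eq ?_))
    have i₁ := (intervalIntegrable_of_memLp (Lp.memLp
      (SimpleFunc.toLp f hf : Lp (Lp ℝ 2 μ) 2 (volume.restrict (Ioo 0 T)))) t.2).norm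
    have i₂ := (intervalIntegrable_of_memLp (Lp.memLp
      (SimpleFunc.toLp g hg : Lp (Lp ℝ 2 μ) 2 (volume.restrict (Ioo 0 T)))) t.2).norm
    rw [← intervalIntegral.integral_add i₁ i₂]
    refine intervalIntegral_congr_of_ae_Ioo ?_ t.2
    filter_upwards [Lp.coeFn_add
      (SimpleFunc.toLp f hf : Lp (Lp ℝ 2 μ) 2 (volume.restrict (Ioo 0 T)))
      (SimpleFunc.toLp g hg : Lp (Lp ℝ 2 μ) 2 (volume.restrict (Ioo 0 T))),
      MemLp.coeFn_toLp hf, MemLp.coeFn_toLp hg] with τ a1 a2 a3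
    rw [AddSubgroup.coe_add, a1, Pi.add_apply, a2, a3]
    by_cases h0 : f τ = 0
    · rw [h0, norm_zero, zero_add, zero_add]
    · have : g τ = 0 := by
        by_contra h1
        exact Set.disjoint_left.mp hfg h0 h1
      rw [this, norm_zero, add_zero, add_zero]

/-- Every `w ∈ L²(0,T; L²(μ))` has a primitive in `L²(μ; C[0,T])`, and
`‖max_{τ ≤ t} |∫₀^τ w|‖² ≤ t ∫₀ᵗ ‖w‖²`. -/
theorem exists_isPrimitive (hT : 0 ≤ T) (w : Lp (Lp ℝ 2 μ) 2 (volume.restrict (Ioo 0 T))) :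
    ∃ y : Lp (Path T) 2 μ, IsPrimitive w y ∧
      ∀ t : Icc (0 : ℝ) T, ‖freezeL μ t y‖ ^ 2 ≤ t * energy w t := by
  have hsimple : ∀ w : Lp.simpleFunc (Lp ℝ 2 μ) 2 (volume.restrict (Ioo 0 T)),
      ∃ y : Lp (Path T) 2 μ, IsPrimitive (w : Lp (Lp ℝ 2 μ) 2 (volume.restrict (Ioo 0 T))) y ∧
      ∀ t : Icc (0 : ℝ) T, ‖freezeL μ t y‖ ^ 2
        ≤ t * energy (w : Lp (Lp ℝ 2 μ) 2 (volume.restrict (Ioo 0 T))) t := by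
    intro w
    obtain ⟨y, hy, hb⟩ := exists_isPrimitive_simpleFunc hT w
    refine ⟨y, hy, fun t => ?_⟩
    refine (pow_le_pow_left₀ (norm_nonneg _) (hb t) 2).trans ?_
    exact sq_intervalIntegral_le t.2.1 (intervalIntegrable_of_memLp (Lp.memLp _) t.2).norm
      (intervalIntegrable_norm_sq_of_memLp (Lp.memLp _) t.2)
  obtain ⟨a, ha, hlim⟩ := mem_closure_iff_seq_limit.mp
    (Lp.simpleFunc.dense (E := Lp ℝ 2 μ) (μ := volume.restrict (Ioo 0 T)) (p := 2) (by norm_num) w)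
  set ws : ℕ → Lp.simpleFunc (Lp ℝ 2 μ) 2 (volume.restrict (Ioo 0 T)) := fun n => ⟨a n, ha n⟩
  choose y hy hb using fun n => hsimple (ws n)
  have hd : ∀ n k, dist (y n) (y k) ≤ Real.sqrt T * dist (a n) (a k) := by
    intro n k
    obtain ⟨z, hz, hzb⟩ := hsimple (ws n - ws k)
    have e : z = y n - y k := hz.unique ((hy n).sub (hy k))
    have h := hzb ⟨T, hT, le_rfl⟩
    rw [freezeL_top hT, e, energy_eq_norm_sq hT] at h
    rw [dist_eq_norm, dist_eq_norm]
    refine abs_le_of_sq_le_sq' ?_ (by positivity) |>.2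
    rw [mul_pow, Real.sq_sqrt hT]
    exact h
  have hc : CauchySeq y := by
    have h := (cauchySeq_iff_tendsto_dist_atTop_0.mp hlim.cauchySeq).const_mul (Real.sqrt T)
    rw [mul_zero] at h
    exact cauchySeq_iff_tendsto_dist_atTop_0.mpr
      (squeeze_zero (fun _ => dist_nonneg) (fun x => hd x.1 x.2) h)
  obtain ⟨y', hy'⟩ := cauchySeq_tendsto_of_complete hc
  refine ⟨y', fun t => ?_, fun t => ?_⟩
  · refine tendsto_nhds_unique (((evL μ t).continuous.tendsto y').comp hy') ?_
    refine (((prim (Lp ℝ 2 μ) t.2).continuous.tendsto w).comp hlim).congr fun n => ?_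
    exact (hy n t).symm
  · refine le_of_tendsto_of_tendsto' ((((freezeL μ t).continuous.tendsto y').comp hy').norm.pow 2)
      ((((continuous_energy (E := Lp ℝ 2 μ) t.2).tendsto w).comp hlim).const_mul (t : ℝ))
      fun n => hb n t

/-- The primitive in `L²(μ; C[0,T])` of a function in `L²(0,T; L²(μ))`. -/
def pathPrim (hT : 0 ≤ T) (w : Lp (Lp ℝ 2 μ) 2 (volume.restrict (Ioo 0 T))) : Lp (Path T) 2 μ :=
  (exists_isPrimitive hT w).choose

theorem evL_pathPrim (hT : 0 ≤ T) (w : Lp (Lp ℝ 2 μ) 2 (volume.restrict (Ioo 0 T)))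
    (t : Icc (0 : ℝ) T) : evL μ t (pathPrim hT w) = ∫ τ in (0 : ℝ)..t, w τ :=
  (exists_isPrimitive hT w).choose_spec.1 t

theorem norm_freezeL_pathPrim_sub (hT : 0 ≤ T)
    (w₁ w₂ : Lp (Lp ℝ 2 μ) 2 (volume.restrict (Ioo 0 T))) (t : Icc (0 : ℝ) T) :
    ‖freezeL μ t (pathPrim hT w₁ - pathPrim hT w₂)‖ ^ 2
      ≤ t * energy (w₁ - w₂ : Lp (Lp ℝ 2 μ) 2 (volume.restrict (Ioo 0 T))) t := by
  obtain ⟨z, hz, hb⟩ := exists_isPrimitive hT (w₁ - w₂)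
  have : IsPrimitive (w₁ - w₂) (pathPrim hT w₁ - pathPrim hT w₂) :=
    IsPrimitive.sub (evL_pathPrim hT w₁) (evL_pathPrim hT w₂)
  rw [← hz.unique this]
  exact hb t

/-- The constant paths. -/
def constL (T : ℝ) (μ : Measure ℝ) : Lp ℝ 2 μ →L[ℝ] Lp (Path T) 2 μ :=
  (ContinuousLinearMap.const ℝ (Icc (0 : ℝ) T)).compLpL 2 μ

theorem evL_constL (t : Icc (0 : ℝ) T) (h : Lp ℝ 2 μ) : evL μ t (constL T μ h) = h := by
  refine Lp.ext ?_
  filter_upwards [evL_ae t (constL T μ h),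
    (ContinuousLinearMap.const ℝ (M := ℝ) (Icc (0 : ℝ) T)).coeFn_compLpL (p := 2) h] with x h1 h2
  rw [h1, constL, h2]
  rfl

end Paths

/-! ### The space `X` and its dual -/

section SpaceX

variable {ℓ : ℝ}

/-- The primitive `ψ ↦ (x ↦ ∫₀ˣ ψ)` on `L²(0,ℓ)`. -/
def volterra (hℓ : 0 ≤ ℓ) : H ℓ →L[ℝ] H ℓ :=
  LinearMap.mkContinuous ((inclC hℓ).comp (primC hℓ)) ℓ fun ψ => by
    refine abs_le_of_sq_le_sq' ?_ (by positivity) |>.2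
    rw [norm_sq_Lp]
    have hb : ∀ x ∈ Icc 0 ℓ, ‖IccExtend hℓ (primC hℓ ψ) x‖ ^ 2 ≤ ℓ * ‖ψ‖ ^ 2 := by
      intro x hx
      rw [IccExtend_of_mem hℓ _ hx, Real.norm_eq_abs, sq_abs]
      refine (sq_intervalIntegral_le hx.1 (intervalIntegrable_of_memLp (Lp.memLp ψ) hx) ?_).trans ?_
      · simpa only [Real.norm_eq_abs, sq_abs] using
          intervalIntegrable_norm_sq_of_memLp (Lp.memLp ψ) hx
      · rw [← energy_eq_norm_sq hℓ]
        have h1 := energy_mono (Lp.memLp ψ) ⟨hℓ, le_rfl⟩ hx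
        have h2 := energy_nonneg ψ hx.1
        simp only [energy, Real.norm_eq_abs, sq_abs] at h1 h2 ⊢
        exact mul_le_mul hx.2 h1 h2 hℓ
    have hc : Continuous (IccExtend hℓ (primC hℓ ψ)) := (primC hℓ ψ).continuous.Icc_extend'
    have he : (fun x => ‖inclC hℓ (primC hℓ ψ) x‖ ^ 2)
        =ᵐ[volume.restrict (Ioo 0 ℓ)] fun x => ‖IccExtend hℓ (primC hℓ ψ) x‖ ^ 2 := by
      filter_upwards [inclC_ae hℓ (primC hℓ ψ)] with x hx
      rw [hx]
    rw [LinearMap.comp_apply, integral_Ioo_eq_intervalIntegral hℓ,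
      intervalIntegral_congr_of_ae_Ioo he ⟨hℓ, le_rfl⟩]
    calc ∫ x in (0 : ℝ)..ℓ, ‖IccExtend hℓ (primC hℓ ψ) x‖ ^ 2
        ≤ ∫ x in (0 : ℝ)..ℓ, ℓ * ‖ψ‖ ^ 2 :=
          intervalIntegral.integral_mono_on hℓ ((hc.norm.pow 2).intervalIntegrable _ _)
            intervalIntegrable_const hb
      _ = (ℓ * ‖ψ‖) ^ 2 := by
          rw [intervalIntegral.integral_const, smul_eq_mul]; ring

theorem volterra_ae (hℓ : 0 ≤ ℓ) (ψ : H ℓ) :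
    volterra hℓ ψ =ᵐ[volume.restrict (Ioo 0 ℓ)] fun x => ∫ y in (0 : ℝ)..x, ψ y := by
  filter_upwards [inclC_ae hℓ (primC hℓ ψ), ae_restrict_mem measurableSet_Ioo] with x h hx
  exact h.trans (IccExtend_of_mem hℓ _ (Ioo_subset_Icc_self hx))

theorem volterra_injective (hℓ : 0 < ℓ) : Function.Injective (volterra hℓ.le) := by
  rw [injective_iff_map_eq_zero]
  intro ψ h
  have hi : IntervalIntegrable ψ volume 0 ℓ :=
    intervalIntegrable_of_memLp (Lp.memLp ψ) ⟨hℓ.le, le_rfl⟩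
  have h1 : (fun x => ∫ y in (0 : ℝ)..x, ψ y) =ᵐ[volume.restrict (Icc 0 ℓ)] fun _ => 0 := by
    rw [← restrict_Ioo_eq_restrict_Icc]
    filter_upwards [volterra_ae hℓ.le ψ, Lp.coeFn_zero ℝ 2 (volume.restrict (Ioo 0 ℓ))]
      with x h1 h2
    rw [← h1, h, h2, Pi.zero_apply]
  have h2 := Measure.eqOn_Icc_of_ae_eq volume hℓ.ne h1 (continuousOn_primitive hi hℓ.le)
    continuousOn_const
  exact Lp.ext ((ae_eq_zero_of_primitive_eq_zero hi hℓ.le h2).trans (Lp.coeFn_zero _ _ _).symm)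

/-- The range of `volterra` is dense, since it contains the test functions. -/
theorem eq_zero_of_inner_volterra_eq_zero (hℓ : 0 ≤ ℓ) (u : H ℓ)
    (h : ∀ ψ, inner ℝ (volterra hℓ ψ) u = 0) : u = 0 := by
  have hu : IntegrableOn u (Ioo 0 ℓ) := (Lp.memLp u).integrable (by norm_num)
  have h0 := isOpen_Ioo.ae_eq_zero_of_integral_contDiff_smul_eq_zero
    hu.locallyIntegrableOn fun φ hφ hφc hφs => ?_
  · refine Lp.ext (EventuallyEq.trans ?_ (Lp.coeFn_zero _ _ _).symm)
    rw [EventuallyEq, ae_restrict_iff' measurableSet_Ioo]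
    exact h0
  · have hd : Continuous (deriv φ) := hφ.continuous_deriv (by simp)
    have hm : MemLp (deriv φ) 2 (volume.restrict (Ioo 0 ℓ)) :=
      (hd.memLp_of_hasCompactSupport hφc.deriv).restrict _
    have e := h hm.toLp
    rw [L2.inner_def] at e
    have hφ0 : φ 0 = 0 := by
      by_contra h0
      exact lt_irrefl _ (hφs (subset_tsupport φ h0)).1
    rw [← setIntegral_eq_integral_of_forall_compl_eq_zero (s := Ioo 0 ℓ) fun x hx => by
      rw [image_eq_zero_of_notMem_tsupport fun h => hx (hφs h), zero_smul]]
    refine (integral_congr_ae ?_).trans e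
    filter_upwards [volterra_ae hℓ hm.toLp, ae_restrict_mem measurableSet_Ioo] with x hx hxm
    rw [hx, intervalIntegral_congr_of_ae_Ioo hm.coeFn_toLp (Ioo_subset_Icc_self hxm),
      intervalIntegral.integral_deriv_eq_sub' φ rfl
        (fun y _ => (hφ.differentiable (by simp)) y) hd.continuousOn, hφ0, sub_zero]
    simp [mul_comm]

/-- The isomorphism `ψ ↦ (∫₀ˣ ψ, ψ)` of `L²(0,ℓ)` with `X`, inverse to `ddx`. -/
def ofDeriv (hℓ : 0 ≤ ℓ) : H ℓ →L[ℝ] X ℓ :=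
  (((WithLp.prodContinuousLinearEquiv 2 ℝ (H ℓ) (H ℓ)).symm : (H ℓ × H ℓ) →L[ℝ] _).comp
    ((volterra hℓ).prod (ContinuousLinearMap.id ℝ (H ℓ)))).codRestrict (X ℓ) fun ψ => by
    change ∀ᵐ x ∂(volume.restrict (Ioo (0 : ℝ) ℓ)),
      (volterra hℓ ψ : ℝ → ℝ) x = ∫ y in Ioc 0 x, (ψ : ℝ → ℝ) y
    filter_upwards [volterra_ae hℓ ψ, ae_restrict_mem measurableSet_Ioo] with x h hx
    rw [h, intervalIntegral.integral_of_le hx.1.le]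

theorem ddx_ofDeriv (hℓ : 0 ≤ ℓ) (ψ : H ℓ) : ddx ℓ (ofDeriv hℓ ψ) = ψ := rfl

theorem toL2_ofDeriv (hℓ : 0 ≤ ℓ) (ψ : H ℓ) : toL2 ℓ (ofDeriv hℓ ψ) = volterra hℓ ψ := rfl

theorem ddx_injective : Function.Injective (ddx ℓ) := by
  intro p q h
  refine Subtype.ext (WithLp.ofLp_injective 2 (Prod.ext (Lp.ext ?_) h))
  have h' : (p : WithLp 2 (H ℓ × H ℓ)).snd = (q : WithLp 2 (H ℓ × H ℓ)).snd := h
  filter_upwards [p.2, q.2] with x h1 h2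
  rw [h'] at h1
  exact h1.trans h2.symm

theorem ofDeriv_ddx (hℓ : 0 ≤ ℓ) (φ : X ℓ) : ofDeriv hℓ (ddx ℓ φ) = φ :=
  ddx_injective (ddx_ofDeriv hℓ _)

theorem toL2_eq_volterra (hℓ : 0 ≤ ℓ) (φ : X ℓ) : toL2 ℓ φ = volterra hℓ (ddx ℓ φ) := by
  rw [← toL2_ofDeriv, ofDeriv_ddx]

/-- The map `L²(0,ℓ) → X'`, `h ↦ (φ ↦ ∫₀^ℓ h φ_x dx)`. -/
def derivDual (ℓ : ℝ) : H ℓ →L[ℝ] StrongDual ℝ (X ℓ) :=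
  LinearMap.mkContinuous
    { toFun := fun h => (innerSL ℝ h).comp (ddx ℓ)
      map_add' := fun h k => by ext φ; simp
      map_smul' := fun a h => by ext φ; simp } ‖ddx ℓ‖ fun h => by
    rw [mul_comm]
    refine (ContinuousLinearMap.opNorm_comp_le _ _).trans (le_of_eq ?_)
    rw [innerSL_apply_norm]

theorem derivDual_apply (h : H ℓ) (φ : X ℓ) : derivDual ℓ h φ = inner ℝ h (ddx ℓ φ) := rfl

theorem derivDual_injective (hℓ : 0 ≤ ℓ) : Function.Injective (derivDual ℓ) := by
  rw [injective_iff_map_eq_zero]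
  intro h h0
  have := congrArg (fun L : StrongDual ℝ (X ℓ) => L (ofDeriv hℓ h)) h0
  rwa [derivDual_apply, ddx_ofDeriv, zero_apply, inner_self_eq_zero] at this

theorem toDual_eq_derivDual (hℓ : 0 ≤ ℓ) (v : H ℓ) :
    toDual ℓ v = derivDual ℓ ((volterra hℓ).adjoint v) := by
  ext φ
  rw [derivDual_apply, ContinuousLinearMap.adjoint_inner_left, ← toL2_eq_volterra]
  rfl

/-- The constant function `1`. -/
def oneL2 (ℓ : ℝ) : H ℓ := Lp.const 2 (volume.restrict (Ioo 0 ℓ)) (1 : ℝ)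

theorem oneL2_ae : oneL2 ℓ =ᵐ[volume.restrict (Ioo 0 ℓ)] fun _ => 1 := Lp.coeFn_const ..

theorem endValue_eq (φ : X ℓ) : endValue φ = inner ℝ (oneL2 ℓ) (ddx ℓ φ) := by
  rw [L2.inner_def, endValue, integral_Ioc_eq_integral_Ioo]
  refine integral_congr_ae ?_
  filter_upwards [oneL2_ae] with x hx
  rw [hx]
  simp

theorem inner_eq_integral_mul {h : H ℓ} {p : ℝ → ℝ} (hp : h =ᵐ[volume.restrict (Ioo 0 ℓ)] p)
    (k : H ℓ) : inner ℝ h k = ∫ x in Ioo 0 ℓ, p x * (k : ℝ → ℝ) x := by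
  rw [L2.inner_def]
  refine integral_congr_ae ?_
  filter_upwards [hp] with x hx
  rw [hx]
  simp [mul_comm]

end SpaceX

/-! ### Causal Lipschitz operators acting on families of paths -/

section Causal

variable {T : ℝ} {μ : Measure ℝ}

/-- `Φ` is a causal operator on `C[0,T]`, Lipschitz continuous on each `[0,t]` with constant `L`. -/
structure IsCausalLipschitz (L : ℝ) (Φ : Path T → Path T) : Prop where
  nonneg : 0 ≤ L
  abs_sub_le : ∀ a b t, |Φ a t - Φ b t| ≤ L * ‖freeze t (a - b)‖

theorem norm_freeze_le (t : Icc (0 : ℝ) T) (φ : Path T) : ‖freeze t φ‖ ≤ ‖φ‖ := by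
  rw [ContinuousMap.norm_le _ (norm_nonneg _)]
  exact fun τ => φ.norm_coe_le_norm _

theorem IsCausalLipschitz.lipschitzWith {L : ℝ} {Φ : Path T → Path T}
    (h : IsCausalLipschitz L Φ) : LipschitzWith L.toNNReal Φ := by
  refine LipschitzWith.of_dist_le_mul fun a b => ?_
  rw [Real.coe_toNNReal _ h.nonneg, dist_eq_norm, dist_eq_norm,
    ContinuousMap.norm_le _ (mul_nonneg h.nonneg (norm_nonneg _))]
  intro t
  exact (h.abs_sub_le a b t).trans (mul_le_mul_of_nonneg_left (norm_freeze_le _ _) h.nonneg)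

theorem IsCausalLipschitz.memLp [IsFiniteMeasure μ] {L : ℝ} {Φ : Path T → Path T}
    (h : IsCausalLipschitz L Φ) (y : Lp (Path T) 2 μ) : MemLp (fun x => Φ (y x)) 2 μ := by
  refine MemLp.of_le (g := fun x => L * ‖(y x : Path T)‖ + ‖Φ 0‖)
    (((Lp.memLp y).norm.const_mul L).add (memLp_const _))
    (h.lipschitzWith.continuous.comp_aestronglyMeasurable (Lp.aestronglyMeasurable y))
    (Eventually.of_forall fun x => ?_)
  have h1 := h.lipschitzWith.dist_le_mul (y x) 0
  rw [Real.coe_toNNReal _ h.nonneg, dist_eq_norm, dist_zero_right] at h1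
  have h2 : 0 ≤ L * ‖(y x : Path T)‖ + ‖Φ 0‖ := by
    have := mul_nonneg h.nonneg (norm_nonneg (y x : Path T)); positivity
  rw [Real.norm_of_nonneg h2]
  have := norm_le_norm_add_norm_sub' (Φ (y x)) (Φ 0)
  linarith

/-- The function `t ↦ Φ[y](t)` in `C([0,T]; L²(μ))`, for `y ∈ L²(μ; C[0,T])`. -/
def IsCausalLipschitz.response [IsFiniteMeasure μ] {L : ℝ} {Φ : Path T → Path T}
    (h : IsCausalLipschitz L Φ) (y : Lp (Path T) 2 μ) : C(Icc (0 : ℝ) T, Lp ℝ 2 μ) :=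
  ⟨fun t => evL μ t (h.memLp y).toLp, continuous_evL _⟩

theorem IsCausalLipschitz.response_ae [IsFiniteMeasure μ] {L : ℝ} {Φ : Path T → Path T}
    (h : IsCausalLipschitz L Φ) (y : Lp (Path T) 2 μ) (t : Icc (0 : ℝ) T) :
    h.response y t =ᵐ[μ] fun x => Φ (y x) t := by
  filter_upwards [evL_ae t (h.memLp y).toLp, (h.memLp y).coeFn_toLp] with x h1 h2
  rw [← h2]
  exact h1

theorem IsCausalLipschitz.norm_response_sub_le [IsFiniteMeasure μ] {L : ℝ} {Φ : Path T → Path T}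
    (h : IsCausalLipschitz L Φ) (y₁ y₂ : Lp (Path T) 2 μ) (t : Icc (0 : ℝ) T) :
    ‖h.response y₁ t - h.response y₂ t‖ ≤ L * ‖freezeL μ t (y₁ - y₂)‖ := by
  refine Lp.norm_le_mul_norm_of_ae_le_mul ?_
  filter_upwards [h.response_ae y₁ t, h.response_ae y₂ t,
    Lp.coeFn_sub (h.response y₁ t) (h.response y₂ t), freezeL_ae t (y₁ - y₂), Lp.coeFn_sub y₁ y₂]
    with x h1 h2 h3 h4 h5
  rw [h3, Pi.sub_apply, h1, h2, h4, h5]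
  exact h.abs_sub_le _ _ _

end Causal

/-! ### The fixed point -/

section FixedPoint

set_option linter.unusedSectionVars false

variable {E : Type*} [NormedAddCommGroup E] [InnerProductSpace ℝ E] [CompleteSpace E] {T : ℝ}

theorem continuousOn_energy (hT : 0 ≤ T) {f : ℝ → E} (hf : MemLp f 2 (volume.restrict (Ioo 0 T))) :
    ContinuousOn (energy f) (Icc 0 T) :=
  continuousOn_primitive (intervalIntegrable_norm_sq_of_memLp hf ⟨hT, le_rfl⟩) hT

/-- A map of Volterra type on `L²(0,T;E)` has exactly one fixed point: its `n`-th iterate is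
Lipschitz continuous with constant `√((CT)ⁿ / n!)`. -/
theorem existsUnique_fixedPoint_of_energy_le (hT : 0 ≤ T)
    {Θ : Lp E 2 (volume.restrict (Ioo 0 T)) → Lp E 2 (volume.restrict (Ioo 0 T))} {C : ℝ}
    (hC : 0 ≤ C)
    (h : ∀ w₁ w₂, ∀ t ∈ Icc 0 T, energy (Θ w₁ - Θ w₂ : Lp E 2 (volume.restrict (Ioo 0 T))) t
      ≤ C * ∫ τ in (0 : ℝ)..t, energy (w₁ - w₂ : Lp E 2 (volume.restrict (Ioo 0 T))) τ) :
    ∃! w, Θ w = w := by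
  have hn : ∀ n w₁ w₂, ∀ t ∈ Icc 0 T,
      energy (Θ^[n] w₁ - Θ^[n] w₂ : Lp E 2 (volume.restrict (Ioo 0 T))) t
        ≤ (C * t) ^ n / n.factorial * ‖w₁ - w₂‖ ^ 2 := by
    intro n
    induction n with
    | zero =>
      intro w₁ w₂ t ht
      simp only [Function.iterate_zero, id_eq, pow_zero, Nat.factorial_zero, Nat.cast_one, div_one,
        one_mul]
      rw [← energy_eq_norm_sq hT]
      exact energy_mono (Lp.memLp _) ⟨hT, le_rfl⟩ ht
    | succ n ih =>
      intro w₁ w₂ t ht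
      rw [Function.iterate_succ_apply', Function.iterate_succ_apply']
      refine (h _ _ t ht).trans ?_
      have hc := (continuousOn_energy hT (Lp.memLp (Θ^[n] w₁ - Θ^[n] w₂))).mono
        (Icc_subset_Icc_right ht.2)
      have hle : ∫ τ in (0 : ℝ)..t,
          energy (Θ^[n] w₁ - Θ^[n] w₂ : Lp E 2 (volume.restrict (Ioo 0 T))) τ
          ≤ ∫ τ in (0 : ℝ)..t, C ^ n / n.factorial * ‖w₁ - w₂‖ ^ 2 * τ ^ n := by
        refine intervalIntegral.integral_mono_on ht.1
          (ContinuousOn.intervalIntegrable (by rwa [uIcc_of_le ht.1]))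
          (Continuous.intervalIntegrable (by fun_prop) _ _) fun τ hτ => ?_
        refine (ih w₁ w₂ τ ⟨hτ.1, hτ.2.trans ht.2⟩).trans (le_of_eq ?_)
        rw [mul_pow]; ring
      rw [intervalIntegral.integral_const_mul, integral_pow] at hle
      refine (mul_le_mul_of_nonneg_left hle hC).trans (le_of_eq ?_)
      rw [Nat.factorial_succ, mul_pow]
      push_cast
      have : ((n : ℝ) + 1) ≠ 0 := by positivity
      have : (n.factorial : ℝ) ≠ 0 := by positivity
      simp only [ne_eq, Nat.add_eq_zero_iff, one_ne_zero, and_false, not_false_eq_true, zero_pow,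
        sub_zero]
      field_simp
      ring
  obtain ⟨n, hn4⟩ : ∃ n : ℕ, (C * T) ^ n / n.factorial < 1 / 4 :=
    ((FloorSemiring.tendsto_pow_div_factorial_atTop (C * T)).eventually
      (gt_mem_nhds (by norm_num))).exists
  have hcon : ContractingWith (1 / 2) Θ^[n] := by
    refine ⟨by rw [← NNReal.coe_lt_coe]; norm_num, LipschitzWith.of_dist_le_mul fun w₁ w₂ => ?_⟩
    have h1 := hn n w₁ w₂ T ⟨hT, le_rfl⟩
    rw [energy_eq_norm_sq hT] at h1
    rw [dist_eq_norm, dist_eq_norm]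
    refine abs_le_of_sq_le_sq' ?_ (by positivity) |>.2
    refine (h1.trans (mul_le_mul_of_nonneg_right hn4.le (sq_nonneg _))).trans (le_of_eq ?_)
    push_cast
    ring
  refine ⟨_, hcon.isFixedPt_fixedPoint_iterate, fun w hw => ?_⟩
  exact hcon.fixedPoint_unique (Function.IsFixedPt.iterate hw n)

/-- Uniqueness for the linear equation. -/
theorem IsLinearSolution.eq_of_equation {hT : 0 ≤ T} {J : E →L[ℝ] E} {ρ ν : ℝ} (hρ : 0 < ρ)
    (hν : 0 < ν) (hJ : Function.Injective J) {f : Lp E 2 (volume.restrict (Ioo 0 T))} {u : E}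
    {w : Lp E 2 (volume.restrict (Ioo 0 T))} {v : C(Icc (0 : ℝ) T, E)}
    (h : IsLinearSolution hT J ρ ν f u w v) {w' v' : ℝ → E}
    (hw' : MemLp w' 2 (volume.restrict (Ioo 0 T))) (hv' : ContinuousOn v' (Icc 0 T))
    (hvel : ∀ t ∈ Icc 0 T, ∫ τ in (0 : ℝ)..t, v' τ = J (∫ τ in (0 : ℝ)..t, w' τ))
    (heq : ∀ t ∈ Icc 0 T, ρ • J.adjoint (v' t) + ν • ∫ τ in (0 : ℝ)..t, w' τ
      = ρ • J.adjoint u + ∫ τ in (0 : ℝ)..t, f τ) :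
    w' =ᵐ[volume.restrict (Ioo 0 T)] w := by
  have hi : ∀ t ∈ Icc 0 T, IntervalIntegrable (fun τ => w' τ - w τ) volume 0 t := fun t ht =>
    (intervalIntegrable_of_memLp hw' ht).sub (intervalIntegrable_of_memLp (Lp.memLp w) ht)
  have hvc : Continuous (IccExtend hT v) := v.continuous.Icc_extend'
  have hwint : ∀ t ∈ Icc 0 T, ∫ τ in (0 : ℝ)..t, (w' τ - w τ)
      = (∫ τ in (0 : ℝ)..t, w' τ) - ∫ τ in (0 : ℝ)..t, w τ := fun t ht =>
    intervalIntegral.integral_sub (intervalIntegrable_of_memLp hw' ht)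
      (intervalIntegrable_of_memLp (Lp.memLp w) ht)
  have h0 : ∀ t ∈ Icc 0 T, ∫ τ in (0 : ℝ)..t, (w' τ - w τ) = 0 := fun t ht => by
    refine primitive_eq_zero_of_homogeneous hJ hρ hν (T := T)
      (v := fun τ => v' τ - IccExtend hT v τ) (hv'.sub hvc.continuousOn) (fun t ht => ?_)
      (fun t ht => ?_) ht
    · have hv'i : IntervalIntegrable v' volume 0 t := by
        refine ContinuousOn.intervalIntegrable (hv'.mono ?_)
        rw [uIcc_of_le ht.1]; exact Icc_subset_Icc_right ht.2
      rw [hwint t ht, map_sub, intervalIntegral.integral_sub hv'i (hvc.intervalIntegrable _ _),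
        hvel t ht, h.velocity t ht]
    · rw [hwint t ht, IccExtend_of_mem hT _ ht, map_sub, smul_sub, smul_sub]
      have e1 := heq t ht
      have e2 := h.equation t ht
      rw [sub_add_sub_comm, e1, e2, sub_self]
  filter_upwards [ae_eq_zero_of_primitive_eq_zero (hi T ⟨hT, le_rfl⟩) hT h0] with τ hτ
  exact sub_eq_zero.mp hτ

/-- The difference of two solutions with the same initial velocity is controlled by the difference
of the right-hand sides. -/
theorem IsLinearSolution.energy_sub_le {hT : 0 ≤ T} {J : E →L[ℝ] E} {ρ ν : ℝ} (hρ : 0 < ρ)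
    (hν : 0 < ν) (hJ : Function.Injective J) (hJd : ∀ u, (∀ x, inner ℝ (J x) u = 0) → u = 0)
    {f₁ f₂ : Lp E 2 (volume.restrict (Ioo 0 T))} {u : E}
    {w₁ w₂ : Lp E 2 (volume.restrict (Ioo 0 T))} {v₁ v₂ : C(Icc (0 : ℝ) T, E)}
    (h₁ : IsLinearSolution hT J ρ ν f₁ u w₁ v₁) (h₂ : IsLinearSolution hT J ρ ν f₂ u w₂ v₂)
    {t : ℝ} (ht : t ∈ Icc 0 T) :
    ν ^ 2 * energy (w₁ - w₂ : Lp E 2 (volume.restrict (Ioo 0 T))) t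
      ≤ energy (f₁ - f₂ : Lp E 2 (volume.restrict (Ioo 0 T))) t := by
  obtain ⟨w, v, h⟩ := exists_isLinearSolution hT hρ hν hJ hJd (f₁ - f₂) 0
  have hvc : ∀ v : C(Icc (0 : ℝ) T, E), Continuous (IccExtend hT v) := fun v =>
    v.continuous.Icc_extend'
  have hsub : ∀ a b : Lp E 2 (volume.restrict (Ioo 0 T)), ∀ t ∈ Icc 0 T,
      ∫ τ in (0 : ℝ)..t, (a - b : Lp E 2 (volume.restrict (Ioo 0 T))) τ
        = (∫ τ in (0 : ℝ)..t, a τ) - ∫ τ in (0 : ℝ)..t, b τ := fun a b t ht =>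
    (prim E ht).map_sub a b
  have hw : w₁ - w₂ = w := by
    refine Lp.ext (h.eq_of_equation hρ hν hJ (Lp.memLp _)
      (v' := fun τ => IccExtend hT v₁ τ - IccExtend hT v₂ τ)
      ((hvc v₁).sub (hvc v₂)).continuousOn (fun t ht => ?_) (fun t ht => ?_))
    · rw [hsub _ _ t ht, map_sub, intervalIntegral.integral_sub ((hvc v₁).intervalIntegrable _ _)
        ((hvc v₂).intervalIntegrable _ _), h₁.velocity t ht, h₂.velocity t ht]
    · rw [hsub _ _ t ht, hsub _ _ t ht, IccExtend_of_mem hT _ ht, IccExtend_of_mem hT _ ht, map_sub,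
        smul_sub, smul_sub, sub_add_sub_comm, h₁.equation t ht, h₂.equation t ht, map_zero,
        smul_zero, zero_add, add_sub_add_left_eq_sub]
  have h0 := h.energy_le t ht
  rw [norm_zero] at h0
  have h1 : 0 ≤ ρ * ‖v ⟨t, ht⟩‖ ^ 2 := by positivity
  rw [hw]
  have h2 : ν * energy w t ≤ 1 / ν * energy (f₁ - f₂ : Lp E 2 (volume.restrict (Ioo 0 T))) t := by
    linarith
  have h3 := mul_le_mul_of_nonneg_left h2 hν.le
  rw [← mul_assoc, ← mul_assoc, mul_one_div_cancel hν.ne', one_mul] at h3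
  rw [sq]
  exact h3

/-- The equation `ρ (J*v)' + ν w + Φ[ε₀ + ∫ w] = F`, `v = J w`, `v(0) = u` has exactly one solution
`w` when `Φ` is causal and Lipschitz continuous. -/
theorem exists_solution_of_isCausalLipschitz {μ : Measure ℝ} [IsFiniteMeasure μ] (hT : 0 ≤ T)
    {J : Lp ℝ 2 μ →L[ℝ] Lp ℝ 2 μ} {ρ ν : ℝ} (hρ : 0 < ρ) (hν : 0 < ν)
    (hJ : Function.Injective J) (hJd : ∀ u, (∀ x, inner ℝ (J x) u = 0) → u = 0)
    {L : ℝ} {Φ : Path T → Path T} (hΦ : IsCausalLipschitz L Φ)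
    (F : Lp (Lp ℝ 2 μ) 2 (volume.restrict (Ioo 0 T))) (ε₀ u : Lp ℝ 2 μ) :
    ∃ w v, IsLinearSolution hT J ρ ν
        (F - inclC hT (hΦ.response (constL T μ ε₀ + pathPrim hT w))) u w v ∧
      ∀ (w' : Lp (Lp ℝ 2 μ) 2 (volume.restrict (Ioo 0 T))) (v' : ℝ → Lp ℝ 2 μ),
        ContinuousOn v' (Icc 0 T) →
        (∀ t ∈ Icc 0 T, ∫ τ in (0 : ℝ)..t, v' τ = J (∫ τ in (0 : ℝ)..t, w' τ)) →
        (∀ t ∈ Icc 0 T, ρ • J.adjoint (v' t) + ν • ∫ τ in (0 : ℝ)..t, w' τ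
          = ρ • J.adjoint u + ∫ τ in (0 : ℝ)..t, (F - inclC hT (hΦ.response
            (constL T μ ε₀ + pathPrim hT w')) : Lp (Lp ℝ 2 μ) 2 (volume.restrict (Ioo 0 T))) τ) →
        w' = w := by
  set R : Lp (Lp ℝ 2 μ) 2 (volume.restrict (Ioo 0 T)) → Lp (Lp ℝ 2 μ) 2 (volume.restrict (Ioo 0 T))
    := fun w => F - inclC hT (hΦ.response (constL T μ ε₀ + pathPrim hT w)) with hR
  choose Θ V hΘ using fun w => exists_isLinearSolution hT hρ hν hJ hJd (R w) u
  have hest : ∀ w₁ w₂, ∀ t ∈ Icc 0 T,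
      energy (Θ w₁ - Θ w₂ : Lp (Lp ℝ 2 μ) 2 (volume.restrict (Ioo 0 T))) t ≤ L ^ 2 * T / ν ^ 2
        * ∫ τ in (0 : ℝ)..t,
          energy (w₁ - w₂ : Lp (Lp ℝ 2 μ) 2 (volume.restrict (Ioo 0 T))) τ := by
    intro w₁ w₂ t ht
    have h1 := (hΘ w₁).energy_sub_le hρ hν hJ hJd (hΘ w₂) ht
    have h2 : energy (R w₁ - R w₂ : Lp (Lp ℝ 2 μ) 2 (volume.restrict (Ioo 0 T))) t ≤
        ∫ τ in (0 : ℝ)..t, L ^ 2 * T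
          * energy (w₁ - w₂ : Lp (Lp ℝ 2 μ) 2 (volume.restrict (Ioo 0 T))) τ := by
      set r₁ := hΦ.response (constL T μ ε₀ + pathPrim hT w₁)
      set r₂ := hΦ.response (constL T μ ε₀ + pathPrim hT w₂)
      have e : (fun τ => ‖(R w₁ - R w₂ : Lp (Lp ℝ 2 μ) 2 (volume.restrict (Ioo 0 T))) τ‖ ^ 2)
          =ᵐ[volume.restrict (Ioo 0 T)] fun τ => ‖IccExtend hT r₁ τ - IccExtend hT r₂ τ‖ ^ 2 := by
        have : R w₁ - R w₂ = inclC hT r₂ - inclC hT r₁ := by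
          rw [hR]; exact sub_sub_sub_cancel_left _ _ _
        rw [this]
        filter_upwards [inclC_ae hT r₁, inclC_ae hT r₂, Lp.coeFn_sub (inclC hT r₂) (inclC hT r₁)]
          with τ h1 h2 h3
        rw [h3, Pi.sub_apply, h1, h2, norm_sub_rev]
      rw [energy, intervalIntegral_congr_of_ae_Ioo e ht]
      have hc : ∀ r : C(Icc (0 : ℝ) T, Lp ℝ 2 μ), Continuous (IccExtend hT r) := fun r =>
        r.continuous.Icc_extend'
      have hce := (continuousOn_energy hT (Lp.memLp (w₁ - w₂))).mono
        (Icc_subset_Icc_right ht.2)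
      refine intervalIntegral.integral_mono_on ht.1
        ((((hc r₁).sub (hc r₂)).norm.pow 2).intervalIntegrable _ _)
        (ContinuousOn.intervalIntegrable (by
          rw [uIcc_of_le ht.1]; exact continuousOn_const.mul hce)) fun τ hτ => ?_
      have hτT : τ ∈ Icc 0 T := ⟨hτ.1, hτ.2.trans ht.2⟩
      rw [IccExtend_of_mem hT _ hτT, IccExtend_of_mem hT _ hτT]
      have h3 := hΦ.norm_response_sub_le (constL T μ ε₀ + pathPrim hT w₁)
        (constL T μ ε₀ + pathPrim hT w₂) ⟨τ, hτT⟩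
      rw [add_sub_add_left_eq_sub] at h3
      refine (pow_le_pow_left₀ (norm_nonneg _) h3 2).trans ?_
      rw [mul_pow, mul_assoc]
      refine mul_le_mul_of_nonneg_left
        ((norm_freezeL_pathPrim_sub hT w₁ w₂ ⟨τ, hτT⟩).trans ?_) (sq_nonneg _)
      exact mul_le_mul_of_nonneg_right hτT.2 (energy_nonneg _ hτ.1)
    rw [intervalIntegral.integral_const_mul] at h2
    rw [div_mul_eq_mul_div, le_div_iff₀ (by positivity), mul_comm]
    exact h1.trans h2
  obtain ⟨w, hw, huniq⟩ := existsUnique_fixedPoint_of_energy_le hT (by positivity) hest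
  refine ⟨w, V w, ?_, fun w' v' hv' hvel heq => huniq w' ?_⟩
  · have := hΘ w
    rwa [hw] at this
  · exact (Lp.ext ((hΘ w').eq_of_equation hρ hν hJ (Lp.memLp w') hv' hvel heq)).symm

end FixedPoint

/-! ### The variational equation as an evolution equation for the strain rate -/

section Stress

variable {T κ c e : ℝ} {g : ℝ → ℝ → ℝ} {f r : ℝ → ℝ}

/-- The part `c ε + W[ε]` of the stress that depends causally on the strain. -/
def stressMap (hT : 0 < T) (hκ : 0 < κ) (hg : PreisachHypothesis g) (hf : ConstitutiveHypothesis f)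
    (hr : ContinuousOn r (Icc 0 T)) (c e : ℝ) (y : Path T) : Path T :=
  c • y + WMap hT hκ hg hf hr e y

theorem exists_isCausalLipschitz_WMap (hT : 0 < T) (hκ : 0 < κ) (hg : PreisachHypothesis g)
    (hf : ConstitutiveHypothesis f) (hr : ContinuousOn r (Icc 0 T)) (e : ℝ) :
    ∃ L, IsCausalLipschitz L (WMap hT hκ hg hf hr e) := by
  obtain ⟨L, hL0, hL⟩ := exists_lipschitz_W (e := e) hT hκ hg hf hr
  refine ⟨L, hL0, fun a b t => ?_⟩
  refine hL _ _ (continuous_IccExtend hT a).continuousOn (continuous_IccExtend hT b).continuousOn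
    t t.2 _ fun τ hτ => ?_
  have hτT : τ ∈ Icc 0 T := ⟨hτ.1, hτ.2.trans t.2.2⟩
  rw [IccExtend_of_mem hT.le _ hτT, IccExtend_of_mem hT.le _ hτT]
  exact abs_le_norm_freeze (τ := ⟨τ, hτT⟩) hτ.2 (a - b)

theorem exists_isCausalLipschitz_stressMap (hT : 0 < T) (hκ : 0 < κ) (hg : PreisachHypothesis g)
    (hf : ConstitutiveHypothesis f) (hr : ContinuousOn r (Icc 0 T)) (hc : 0 ≤ c) (e : ℝ) :
    ∃ L, IsCausalLipschitz L (stressMap hT hκ hg hf hr c e) := by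
  obtain ⟨L, hL⟩ := exists_isCausalLipschitz_WMap hT hκ hg hf hr e
  refine ⟨c + L, add_nonneg hc hL.nonneg, fun a b t => ?_⟩
  have h1 : |c * a t - c * b t| ≤ c * ‖freeze t (a - b)‖ := by
    rw [← mul_sub, abs_mul, abs_of_nonneg hc]
    exact mul_le_mul_of_nonneg_left (abs_le_norm_freeze le_rfl (a - b)) hc
  have h2 := hL.abs_sub_le a b t
  change |c * a t + WMap hT hκ hg hf hr e a t - (c * b t + WMap hT hκ hg hf hr e b t)| ≤ _
  rw [add_sub_add_comm, add_mul]
  exact (abs_add_le _ _).trans (add_le_add h1 h2)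

/-- `W` depends only on the values of its argument on `[0,T]`. -/
theorem W_eq_WMap (hT : 0 < T) (hκ : 0 < κ) (hg : PreisachHypothesis g)
    (hf : ConstitutiveHypothesis f) (hr : ContinuousOn r (Icc 0 T)) {ε : ℝ → ℝ} {y : Path T}
    (h : ∀ τ : Icc (0 : ℝ) T, ε τ = y τ) (t : Icc (0 : ℝ) T) :
    W T g f κ e r ε t = WMap hT hκ hg hf hr e y t := by
  obtain ⟨L, hL0, hL⟩ := exists_lipschitz_W (e := e) hT hκ hg hf hr
  have he : EqOn ε (IccExtend hT.le y) (Icc 0 T) := fun τ hτ => by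
    rw [IccExtend_of_mem hT.le _ hτ]; exact h ⟨τ, hτ⟩
  have hy := (continuous_IccExtend hT y).continuousOn (s := Icc 0 T)
  have h0 := hL ε _ (hy.congr he) hy t t.2 0 fun τ hτ => by
    rw [he ⟨hτ.1, hτ.2.trans t.2.2⟩, sub_self, abs_zero]
  rw [mul_zero] at h0
  exact sub_eq_zero.mp (abs_eq_zero.mp (le_antisymm h0 (abs_nonneg _)))

/-- Pointwise form of the total stress `c ε + ν ε_t + W[ε]` at time `t`, for any representative `ε`
of the strain. -/
theorem stress_ae {ℓ ν L : ℝ} (hT : 0 < T) (hκ : 0 < κ) (hg : PreisachHypothesis g)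
    (hf : ConstitutiveHypothesis f) (hr : ContinuousOn r (Icc 0 T))
    (hΦ : IsCausalLipschitz L (stressMap hT hκ hg hf hr c e))
    {y : Lp (Path T) 2 (volume.restrict (Ioo 0 ℓ))} {ε : ℝ → ℝ → ℝ}
    (hε : ∀ᵐ x ∂(volume.restrict (Ioo 0 ℓ)), ∀ τ : Icc (0 : ℝ) T, ε x τ = (y x : Path T) τ)
    (w : H ℓ) (t : Icc (0 : ℝ) T) :
    (hΦ.response y t + ν • w : H ℓ) =ᵐ[volume.restrict (Ioo 0 ℓ)]
      fun x => c * ε x t + ν * (w : ℝ → ℝ) x + W T g f κ e r (ε x) t := by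
  filter_upwards [hΦ.response_ae y t, hε, Lp.coeFn_add (hΦ.response y t) (ν • w),
    Lp.coeFn_smul ν w] with x h1 h2 h3 h4
  rw [h3, Pi.add_apply, h4, h1, h2 t, W_eq_WMap hT hκ hg hf hr h2]
  change c * (y x : Path T) t + WMap hT hκ hg hf hr e (y x) t + ν * (w : ℝ → ℝ) x = _
  ring

end Stress

section Variational

variable {ℓ T ρ ν : ℝ}

/-- The variational equation at a fixed time, with stress `P`, determines `u_tt ∈ X'`. -/
theorem variational_iff (hρ : 0 < ρ) {Z : StrongDual ℝ (X ℓ)} {P : H ℓ} {p : ℝ → ℝ}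
    (hp : P =ᵐ[volume.restrict (Ioo 0 ℓ)] p) (σ : ℝ) :
    (∀ φ : X ℓ, ρ * Z φ + ∫ x in Ioo 0 ℓ, p x * (ddx ℓ φ : ℝ → ℝ) x = σ * endValue φ) ↔
      Z = derivDual ℓ (ρ⁻¹ • (σ • oneL2 ℓ - P)) := by
  have h : ∀ φ : X ℓ, derivDual ℓ (ρ⁻¹ • (σ • oneL2 ℓ - P)) φ
      = ρ⁻¹ * (σ * endValue φ - ∫ x in Ioo 0 ℓ, p x * (ddx ℓ φ : ℝ → ℝ) x) := fun φ => by
    rw [derivDual_apply, real_inner_smul_left, inner_sub_left, real_inner_smul_left,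
      ← endValue_eq, inner_eq_integral_mul hp]
  rw [ContinuousLinearMap.ext_iff]
  refine forall_congr' fun φ => ?_
  rw [h φ, eq_inv_mul_iff_mul_eq₀ hρ.ne', eq_sub_iff_add_eq]

/-- `ContinuousLinearMap.intervalIntegral_comp_comm` for values in an abstract dual space. For the
dual of `X ℓ` itself the instances are expensive to unify, so this form is specialized instead. -/
theorem intervalIntegral_strongDual_comp {E V : Type*} [NormedAddCommGroup E] [NormedSpace ℝ E]
    [CompleteSpace E] [NormedAddCommGroup V] [NormedSpace ℝ V] (D : E →L[ℝ] StrongDual ℝ V)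
    {h : ℝ → E} {t : ℝ} (hi : IntervalIntegrable h volume 0 t) :
    ∫ τ in (0 : ℝ)..t, D (h τ) = D (∫ τ in (0 : ℝ)..t, h τ) :=
  D.intervalIntegral_comp_comm hi

theorem memLp_strongDual_comp {E V : Type*} [NormedAddCommGroup E] [NormedSpace ℝ E]
    [NormedAddCommGroup V] [NormedSpace ℝ V] (D : E →L[ℝ] StrongDual ℝ V) {h : ℝ → E}
    {μ : Measure ℝ} (hh : MemLp h 2 μ) : MemLp (fun τ => D (h τ)) 2 μ :=
  D.comp_memLp' hh

/-- The momentum balance in `X'` as an equation in `L²(0,ℓ)`. -/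
theorem toDual_eq_iff (hℓ : 0 ≤ ℓ) (hρ : 0 < ρ)
    {z : ℝ → StrongDual ℝ (X ℓ)} {w : ℝ → H ℓ} {R : Lp (H ℓ) 2 (volume.restrict (Ioo 0 T))}
    (hw : MemLp w 2 (volume.restrict (Ioo 0 T)))
    (hz : z =ᵐ[volume.restrict (Ioo 0 T)] fun t => derivDual ℓ (ρ⁻¹ • (R t - ν • w t)))
    (v u : H ℓ) {t : ℝ} (ht : t ∈ Icc 0 T) :
    toDual ℓ v = toDual ℓ u + ∫ τ in (0 : ℝ)..t, z τ ↔
      ρ • (volterra hℓ).adjoint v + ν • ∫ τ in (0 : ℝ)..t, w τ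
        = ρ • (volterra hℓ).adjoint u + ∫ τ in (0 : ℝ)..t, R τ := by
  have hRi := intervalIntegrable_of_memLp (Lp.memLp R) ht
  have hwi := intervalIntegrable_of_memLp hw ht
  have hi : IntervalIntegrable (fun τ => ρ⁻¹ • (R τ - ν • w τ)) volume 0 t :=
    (hRi.sub (hwi.smul ν)).smul ρ⁻¹
  have e : ∫ τ in (0 : ℝ)..t, ρ⁻¹ • (R τ - ν • w τ)
      = ρ⁻¹ • ((∫ τ in (0 : ℝ)..t, R τ) - ν • ∫ τ in (0 : ℝ)..t, w τ) := by
    rw [intervalIntegral.integral_smul, ← intervalIntegral.integral_smul ν]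
    exact congrArg (ρ⁻¹ • ·) (intervalIntegral.integral_sub hRi (hwi.smul ν))
  rw [intervalIntegral_congr_of_ae_Ioo hz ht, intervalIntegral_strongDual_comp (derivDual ℓ) hi, e,
    toDual_eq_derivDual hℓ, toDual_eq_derivDual hℓ, ← map_add,
    (derivDual_injective hℓ).eq_iff, ← (smul_right_injective (H ℓ) hρ.ne').eq_iff]
  simp only [smul_add, smul_inv_smul₀ hρ.ne']
  rw [← add_sub_assoc, eq_sub_iff_add_eq]

end Variational

/-! ### Existence and uniqueness of the weak solution -/

section Solution

variable {T ℓ ρ ν κ c e L : ℝ} {g : ℝ → ℝ → ℝ} {f r s : ℝ → ℝ}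

/-- The load `s(t)` at the end `x = ℓ`, as the function `(x,t) ↦ s(t)` that represents it in the
weak form. -/
def load (ℓ : ℝ) (hs : MemLp s 2 (volume.restrict (Ioo 0 T))) :
    Lp (H ℓ) 2 (volume.restrict (Ioo 0 T)) :=
  (ContinuousLinearMap.toSpanSingleton ℝ (oneL2 ℓ)).compLpL 2 _ hs.toLp

theorem load_ae (hs : MemLp s 2 (volume.restrict (Ioo 0 T))) :
    load ℓ hs =ᵐ[volume.restrict (Ioo 0 T)] fun t => s t • oneL2 ℓ := by
  filter_upwards [(ContinuousLinearMap.toSpanSingleton ℝ (oneL2 ℓ)).coeFn_compLpL hs.toLp,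
    hs.coeFn_toLp] with t h1 h2
  rw [load, h1, h2]
  rfl

theorem load_sub_ae (hs : MemLp s 2 (volume.restrict (Ioo 0 T))) (hT : 0 ≤ T)
    (S : C(Icc (0 : ℝ) T, H ℓ)) :
    (load ℓ hs - inclC hT S : Lp (H ℓ) 2 (volume.restrict (Ioo 0 T)))
      =ᵐ[volume.restrict (Ioo 0 T)] fun t => s t • oneL2 ℓ - IccExtend hT S t := by
  filter_upwards [Lp.coeFn_sub (load ℓ hs) (inclC hT S), load_ae (ℓ := ℓ) hs, inclC_ae hT S]
    with t h1 h2 h3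
  rw [h1, Pi.sub_apply, h2, h3]

/-- A solution of the evolution equation for the strain rate `w` yields the weak solution with
strain `u₀' + ∫₀ᵗ w`. -/
theorem isWeakSolution_of_isLinearSolution (hT : 0 < T) (hℓ : 0 ≤ ℓ) (hρ : 0 < ρ) (hκ : 0 < κ)
    (hg : PreisachHypothesis g) (hf : ConstitutiveHypothesis f) (hr : ContinuousOn r (Icc 0 T))
    (hs : MemLp s 2 (volume.restrict (Ioo 0 T)))
    (hΦ : IsCausalLipschitz L (stressMap hT hκ hg hf hr c e)) (u₀ : X ℓ) (u₁ : H ℓ)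
    {w : Lp (H ℓ) 2 (volume.restrict (Ioo 0 T))} {v : C(Icc (0 : ℝ) T, H ℓ)}
    (h : IsLinearSolution hT.le (volterra hℓ) ρ ν (load ℓ hs - inclC hT.le
      (hΦ.response (constL T _ (ddx ℓ u₀) + pathPrim hT.le w))) u₁ w v) :
    IsWeakSolution T ℓ ρ ν c κ e g f r s u₀ u₁
      fun t => ofDeriv hℓ (ddx ℓ u₀ + ∫ τ in (0 : ℝ)..t, w τ) := by
  set y : Lp (Path T) 2 (volume.restrict (Ioo 0 ℓ)) := constL T _ (ddx ℓ u₀) + pathPrim hT.le w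
    with hy
  set S := hΦ.response y with hS
  have hwi : IntervalIntegrable w volume 0 T :=
    intervalIntegrable_of_memLp (Lp.memLp w) ⟨hT.le, le_rfl⟩
  have hvc : Continuous (IccExtend hT.le v) := v.continuous.Icc_extend'
  have hv0 : IccExtend hT.le v 0 = u₁ := by
    rw [IccExtend_of_mem hT.le _ ⟨le_rfl, hT.le⟩]; exact h.initial
  have hyt : ∀ t, evL _ t y = ddx ℓ u₀ + ∫ τ in (0 : ℝ)..t, w τ := fun t => by
    rw [hy, map_add, evL_constL, evL_pathPrim]
  refine ⟨(ofDeriv hℓ).continuous.comp_continuousOn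
      (continuousOn_const.add (continuousOn_primitive hwi hT.le)),
    IccExtend hT.le v, w, fun t => derivDual ℓ (ρ⁻¹ • (s t • oneL2 ℓ - (IccExtend hT.le S t
      + ν • w t))), fun x => IccExtend hT.le (y x : Path T), hvc.continuousOn, fun t ht => ?_,
    Lp.memLp w, fun t ht => ?_, ?_, fun t ht => ?_, ?_, fun t ht => ?_, ?_, hv0, ?_⟩
  · have hd : HasDerivWithinAt (fun τ => volterra hℓ (ddx ℓ u₀)
        + ∫ σ in (0 : ℝ)..τ, IccExtend hT.le v σ) (IccExtend hT.le v t) (Icc 0 T) t :=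
      ((hvc.integral_hasStrictDerivAt 0 t).hasDerivAt.const_add _).hasDerivWithinAt
    refine hd.congr_of_mem (fun τ hτ => ?_) ht
    rw [toL2_ofDeriv, map_add, h.velocity τ hτ]
  · rw [ddx_ofDeriv, ddx_ofDeriv, intervalIntegral.integral_same, add_zero]
  · have hσ : MemLp (fun t => s t • oneL2 ℓ) 2 (volume.restrict (Ioo 0 T)) :=
      (ContinuousLinearMap.toSpanSingleton ℝ (oneL2 ℓ)).comp_memLp' hs
    exact memLp_strongDual_comp (derivDual ℓ)
      ((hσ.sub ((memLp_IccExtend hT.le S).add ((Lp.memLp w).const_smul ν))).const_smul ρ⁻¹)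
  · rw [hv0, toDual_eq_iff hℓ hρ (Lp.memLp w) (ν := ν) ?_ _ _ ht, IccExtend_of_mem hT.le _ ht]
    · exact h.equation t ht
    · filter_upwards [load_sub_ae hs hT.le S] with τ hτ
      rw [hτ, sub_sub]
  · exact Eventually.of_forall fun x => (continuous_IccExtend hT (y x)).continuousOn
  · rw [ddx_ofDeriv, ← hyt ⟨t, ht⟩]
    filter_upwards [evL_ae ⟨t, ht⟩ y] with x hx
    rw [hx, IccExtend_of_mem hT.le _ ht]
  · change ofDeriv hℓ (ddx ℓ u₀ + ∫ τ in (0 : ℝ)..0, w τ) = u₀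
    rw [intervalIntegral.integral_same, add_zero, ofDeriv_ddx]
  · filter_upwards [ae_restrict_mem measurableSet_Ioo] with t ht
    have htT := Ioo_subset_Icc_self ht
    refine ⟨?_, ?_⟩
    · obtain ⟨L', hW⟩ := exists_isCausalLipschitz_WMap hT hκ hg hf hr e
      refine (memLp_congr_ae ?_).mp (Lp.memLp (hW.response y ⟨t, htT⟩))
      exact hW.response_ae y ⟨t, htT⟩
    · rw [variational_iff hρ (stress_ae hT hκ hg hf hr hΦ (y := y) (Eventually.of_forall
        fun x τ => IccExtend_of_mem hT.le _ τ.2) (w t) ⟨t, htT⟩), IccExtend_of_mem hT.le _ htT]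

/-- The strain rate of a weak solution solves the evolution equation. -/
theorem IsWeakSolution.exists_strainRate (hT : 0 < T) (hℓ : 0 ≤ ℓ) (hρ : 0 < ρ) (hκ : 0 < κ)
    (hg : PreisachHypothesis g) (hf : ConstitutiveHypothesis f) (hr : ContinuousOn r (Icc 0 T))
    (hs : MemLp s 2 (volume.restrict (Ioo 0 T)))
    (hΦ : IsCausalLipschitz L (stressMap hT hκ hg hf hr c e)) {u₀ : X ℓ} {u₁ : H ℓ}
    {u : ℝ → X ℓ} (h : IsWeakSolution T ℓ ρ ν c κ e g f r s u₀ u₁ u) :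
    ∃ (w : Lp (H ℓ) 2 (volume.restrict (Ioo 0 T))) (v : ℝ → H ℓ), ContinuousOn v (Icc 0 T) ∧
      (∀ t ∈ Icc 0 T, ddx ℓ (u t) = ddx ℓ u₀ + ∫ τ in (0 : ℝ)..t, w τ) ∧
      (∀ t ∈ Icc 0 T, ∫ τ in (0 : ℝ)..t, v τ = volterra hℓ (∫ τ in (0 : ℝ)..t, w τ)) ∧
      (∀ t ∈ Icc 0 T, ρ • (volterra hℓ).adjoint (v t) + ν • ∫ τ in (0 : ℝ)..t, w τ
        = ρ • (volterra hℓ).adjoint u₁ + ∫ τ in (0 : ℝ)..t, (load ℓ hs - inclC hT.le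
          (hΦ.response (constL T _ (ddx ℓ u₀) + pathPrim hT.le w)) :
            Lp (H ℓ) 2 (volume.restrict (Ioo 0 T))) τ) := by
  obtain ⟨-, v, w, z, ε, hv, hd, hw, hdw, -, hz, hεc, hε, hu0, hv0, heq⟩ := h
  rw [hu0] at hdw
  rw [hv0] at hz
  have hwt : ∀ t ∈ Icc 0 T, ∫ τ in (0 : ℝ)..t, (hw.toLp w : ℝ → H ℓ) τ
      = ∫ τ in (0 : ℝ)..t, w τ := fun t ht =>
    intervalIntegral_congr_of_ae_Ioo hw.coeFn_toLp ht
  refine ⟨hw.toLp w, v, hv, fun t ht => ?_, fun t ht => ?_, fun t ht => ?_⟩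
  · rw [hwt t ht, hdw t ht]
  · rw [hwt t ht]
    have hsub : Icc 0 t ⊆ Icc 0 T := Icc_subset_Icc_right ht.2
    have hft : ∫ τ in (0 : ℝ)..t, v τ = toL2 ℓ (u t) - toL2 ℓ (u 0) := by
      refine intervalIntegral.integral_eq_sub_of_hasDerivAt_of_le ht.1
        (f := fun τ => toL2 ℓ (u τ))
        (fun τ hτ => ((hd τ (hsub hτ)).continuousWithinAt).mono hsub) (fun τ hτ => ?_) ?_
      · exact (hd τ (hsub (Ioo_subset_Icc_self hτ))).hasDerivAt
          (Icc_mem_nhds hτ.1 (hτ.2.trans_le ht.2))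
      · refine ContinuousOn.intervalIntegrable ?_
        rw [uIcc_of_le ht.1]; exact hv.mono hsub
    rw [hft, toL2_eq_volterra hℓ, toL2_eq_volterra hℓ, ← map_sub, hdw t ht, hu0,
      add_sub_cancel_left]
  · set y : Lp (Path T) 2 (volume.restrict (Ioo 0 ℓ)) :=
      constL T _ (ddx ℓ u₀) + pathPrim hT.le (hw.toLp w) with hy
    have hyt : ∀ t : Icc (0 : ℝ) T, evL _ t y = ddx ℓ (u t) := fun t => by
      rw [hy, map_add, evL_constL, evL_pathPrim, hwt t t.2, hdw t t.2]
    -- the representative `ε` of the strain is the path `y x`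
    have hεy : ∀ᵐ x ∂(volume.restrict (Ioo 0 ℓ)), ∀ τ : Icc (0 : ℝ) T,
        ε x τ = (y x : Path T) τ := by
      have := ae_forall_eq (μ := volume.restrict (Ioo 0 ℓ)) (T := T)
        (a := fun x τ => ε x τ) (b := fun x τ => (y x : Path T) τ)
        (hεc.mono fun x hx => continuousOn_iff_continuous_domRestrict.mp hx)
        (Eventually.of_forall fun x => (y x : Path T).continuous) fun τ => by
          filter_upwards [hε τ τ.2, evL_ae τ y] with x h1 h2
          rw [h1, ← h2, hyt]
      exact this.mono fun x hx τ => congrFun hx τ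
    have hzt : z =ᵐ[volume.restrict (Ioo 0 T)] fun t => derivDual ℓ (ρ⁻¹ • (
        (load ℓ hs - inclC hT.le (hΦ.response y) : Lp (H ℓ) 2 (volume.restrict (Ioo 0 T))) t
          - ν • w t)) := by
      filter_upwards [heq, load_sub_ae hs hT.le (hΦ.response y), ae_restrict_mem measurableSet_Ioo]
        with t h1 h2 ht
      have htT := Ioo_subset_Icc_self ht
      rw [h2, sub_sub, IccExtend_of_mem hT.le _ htT]
      exact (variational_iff hρ (stress_ae hT hκ hg hf hr hΦ hεy (w t) ⟨t, htT⟩) (s t)).mp h1.2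
    have := (toDual_eq_iff hℓ hρ hw hzt (v t) u₁ ht).mp (hz t ht)
    rw [hwt t ht]
    exact this

end Solution

end PiezoBeam

end

theorem theorem4p2 (T ℓ ρ ν c κ e : ℝ) (hT : 0 < T) (hℓ : 0 < ℓ) (hρ : 0 < ρ) (hν : 0 < ν)
    (hc : 0 < c) (hκ : 0 < κ) (g : ℝ → ℝ → ℝ) (hg : PiezoBeam.PreisachHypothesis g)
    (f : ℝ → ℝ) (hf : PiezoBeam.ConstitutiveHypothesis f)
    (r : ℝ → ℝ) (hr : ContinuousOn r (Set.Icc 0 T))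
    (s : ℝ → ℝ) (hs : MeasureTheory.MemLp s 2 (MeasureTheory.volume.restrict (Set.Ioo 0 T)))
    (u₀ : PiezoBeam.X ℓ) (u₁ : PiezoBeam.H ℓ) :
    ∃ u : ℝ → PiezoBeam.X ℓ,
      PiezoBeam.IsWeakSolution T ℓ ρ ν c κ e g f r s u₀ u₁ u ∧
      ∀ u' : ℝ → PiezoBeam.X ℓ,
        PiezoBeam.IsWeakSolution T ℓ ρ ν c κ e g f r s u₀ u₁ u' →
        Set.EqOn u' u (Set.Icc 0 T) := by
  obtain ⟨L, hΦ⟩ := PiezoBeam.exists_isCausalLipschitz_stressMap hT hκ hg hf hr hc.le e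
  obtain ⟨w, v, h, huniq⟩ := PiezoBeam.exists_solution_of_isCausalLipschitz hT.le hρ hν
    (PiezoBeam.volterra_injective hℓ) (PiezoBeam.eq_zero_of_inner_volterra_eq_zero hℓ.le) hΦ
    (PiezoBeam.load ℓ hs) (PiezoBeam.ddx ℓ u₀) u₁
  refine ⟨_, PiezoBeam.isWeakSolution_of_isLinearSolution hT hℓ.le hρ hκ hg hf hr hs hΦ u₀ u₁ h,
    fun u' hu' t ht => ?_⟩
  obtain ⟨w', v', hv', hdw, hvel, heq⟩ :=
    hu'.exists_strainRate hT hℓ.le hρ hκ hg hf hr hs hΦ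
  have hw : w' = w := huniq w' v' hv' hvel heq
  refine PiezoBeam.ddx_injective ?_
  rw [hdw t ht, hw, PiezoBeam.ddx_ofDeriv]
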